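/- For a bounded convex domain $\Omega\subset\mathbb{R}^n$ with smooth boundary put $\Omega^{\mathrm{ext}}:=\mathbb{R}^n\setminus\overline{\Omega}$. A real number $\sigma$ is an eigenvalue of the exterior Steklov problem on $\Omega^{\mathrm{ext}}$ if there is a function $u:\Omega^{\mathrm{ext}}\to\mathbb{R}$, not identically zero, with $u\in H^1(\Omega^{\mathrm{ext}}\cap B_R)$ for every $R>0$ (where $B_R=\{|x|<R\}$), such that $$\Delta u=0\ \text{ in }\Omega^{\mathrm{ext}},\qquad \partial_\nu u=\sigma u\ \text{ on }\partial\Omega,\qquad u(x)=O\bigl(|x|^{2-n}\bigr)\ \text{ as }|x|\to\infty,$$ where $\nu$ is the unit normal on $\partial\Omega$ pointing out of $\Omega^{\mathrm{ext}}$ (into $\Omega$), and the boundary condition is understood in the weak sense, $\int_{\Omega^{\mathrm{ext}}}\nabla u\cdot\nabla\varphi\,dx=\sigma\int_{\partial\Omega}u\varphi\,dS$ for all $\varphi\in C_c^\infty(\mathbb{R}^n)$, with $u$ on $\partial\Omega$ being the trace. Let $\sigma_1(\Omega^{\mathrm{ext}})$ denote the smallest eigenvalue. **Theorem.** Let $n\ge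 3$ and $V>0$. There exists a sequence $(\Omega_m)_{m\in\mathbb{N}}$ of nonempty bounded convex domains in $\mathbb{R}^n$ with smooth boundary, each of volume $V$, such that for every $m$ the smallest eigenvalue $\sigma_1(\Omega_m^{\mathrm{ext}})$ exists, and $\sigma_1(\Omega_m^{\mathrm{ext}})\to+\infty$ as $m\to\infty$. -/

import Mathlib

open MeasureTheory Set Filter Topology
open scoped ContDiff Gradient

namespace ExteriorSteklov

/-- The exterior `ℝⁿ \ closure Ω` of a set `Ω`. -/
def ext {n : ℕ} (Ω : Set (EuclideanSpace ℝ (Fin n))) : Set (EuclideanSpace ℝ (Fin n)) :=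
  (closure Ω)ᶜ

/-- Surface measure on `∂Ω`: the Euclidean (i.e. normalised so that it agrees with Lebesgue measure
on hyperplanes) `(n - 1)`-dimensional Hausdorff measure, restricted to the boundary. -/
noncomputable def surfaceMeasure {n : ℕ} (Ω : Set (EuclideanSpace ℝ (Fin n))) :
    Measure (EuclideanSpace ℝ (Fin n)) :=
  μHE[n - 1].restrict (frontier Ω)

/-- `Ω` has a smooth (`C^∞`) boundary: near each of its boundary points, `Ω` is the sublevel set
`{ρ < 0}` of a smooth function `ρ` whose differential does not vanish at the point. -/
def HasSmoothBoundary {n : ℕ} (Ω : Set (EuclideanSpace ℝ (Fin n))) : Prop :=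
  ∀ x ∈ frontier Ω, ∃ ρ : EuclideanSpace ℝ (Fin n) → ℝ,
    ContDiff ℝ ∞ ρ ∧ fderiv ℝ ρ x ≠ 0 ∧ ∀ᶠ y in 𝓝 x, (y ∈ Ω ↔ ρ y < 0)

/-- A smooth convex bounded domain. -/
structure IsSmoothConvexBoundedDomain {n : ℕ} (Ω : Set (EuclideanSpace ℝ (Fin n))) : Prop where
  isOpen : IsOpen Ω
  nonempty : Ω.Nonempty
  convex : Convex ℝ Ω
  isBounded : Bornology.IsBounded Ω
  hasSmoothBoundary : HasSmoothBoundary Ω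

/-- Smooth compactly supported functions on the whole of `ℝⁿ` (they need not vanish on `∂Ω`). -/
def IsTestFunction {n : ℕ} (φ : EuclideanSpace ℝ (Fin n) → ℝ) : Prop :=
  ContDiff ℝ ∞ φ ∧ HasCompactSupport φ

/-- `u` restricted to `ext Ω ∩ B_R` is in `H¹` for every `R`. This is used for functions `u`
that are `C²` in the open set `ext Ω`, whose weak gradient is the classical one. -/
def MemH1loc {n : ℕ} (Ω : Set (EuclideanSpace ℝ (Fin n)))
    (u : EuclideanSpace ℝ (Fin n) → ℝ) : Prop :=
  ∀ R : ℝ, MemLp u 2 (volume.restrict (ext Ω ∩ Metric.ball 0 R)) ∧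
    MemLp (∇ u) 2 (volume.restrict (ext Ω ∩ Metric.ball 0 R))

/-- `f ∈ L²(∂Ω)` is the boundary trace of `u ∈ H¹_loc(ext Ω)`: the trace operator is the
continuous extension of the restriction `φ ↦ φ|_{∂Ω}` of test functions, so that `f` is the limit
in `L²(∂Ω)` of the restrictions of test functions which converge to `u` in `H¹_loc(ext Ω)`. -/
def IsTrace {n : ℕ} (Ω : Set (EuclideanSpace ℝ (Fin n)))
    (u f : EuclideanSpace ℝ (Fin n) → ℝ) : Prop :=
  MemLp f 2 (surfaceMeasure Ω) ∧
  ∃ g : ℕ → EuclideanSpace ℝ (Fin n) → ℝ,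
    (∀ k, IsTestFunction (g k)) ∧
    (∀ R : ℝ,
      Tendsto (fun k => eLpNorm (fun x => g k x - u x) 2
        (volume.restrict (ext Ω ∩ Metric.ball 0 R))) atTop (𝓝 0) ∧
      Tendsto (fun k => eLpNorm (fun x => ∇ (g k) x - ∇ u x) 2
        (volume.restrict (ext Ω ∩ Metric.ball 0 R))) atTop (𝓝 0)) ∧
    Tendsto (fun k => eLpNorm (fun x => g k x - f x) 2 (surfaceMeasure Ω)) atTop (𝓝 0)

/-- For `u ∈ H¹_loc(ext Ω)` harmonic in `ext Ω`, the Steklov condition `∂_ν u = σ u` on `∂Ω`,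
where `ν` is the unit normal pointing out of `ext Ω` (into `Ω`). The normal derivative is the
one given by Green's formula `∫_{ext Ω} ∇u · ∇φ dx = ∫_{∂Ω} (∂_ν u) φ dS` for test functions `φ`,
and the values of `u` on `∂Ω` are those of its trace. -/
def SteklovCondition {n : ℕ} (Ω : Set (EuclideanSpace ℝ (Fin n))) (σ : ℝ)
    (u : EuclideanSpace ℝ (Fin n) → ℝ) : Prop :=
  ∃ f : EuclideanSpace ℝ (Fin n) → ℝ, IsTrace Ω u f ∧
    ∀ φ : EuclideanSpace ℝ (Fin n) → ℝ, IsTestFunction φ →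
      ∫ x in ext Ω, inner ℝ (∇ u x) (∇ φ x) = σ * ∫ x, f x * φ x ∂(surfaceMeasure Ω)

/-- `u` is an eigenfunction of the exterior Steklov problem for the eigenvalue `σ`. Only the values
of `u` in `ext Ω` matter. -/
structure IsEigenfunction {n : ℕ} (Ω : Set (EuclideanSpace ℝ (Fin n))) (σ : ℝ)
    (u : EuclideanSpace ℝ (Fin n) → ℝ) : Prop where
  ne_zero : ∃ x ∈ ext Ω, u x ≠ 0
  memH1loc : MemH1loc Ω u
  harmonic : InnerProductSpace.HarmonicOnNhd u (ext Ω)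
  steklov : SteklovCondition Ω σ u
  decay : u =O[Bornology.cobounded (EuclideanSpace ℝ (Fin n)) ⊓ 𝓟 (ext Ω)]
    fun x => ‖x‖ ^ (2 - (n : ℤ))

/-- The set of all eigenvalues of the exterior Steklov problem on `ext Ω`. -/
def spectrum {n : ℕ} (Ω : Set (EuclideanSpace ℝ (Fin n))) : Set ℝ :=
  {σ | ∃ u, IsEigenfunction Ω σ u}

/-- The first exterior Steklov eigenvalue `σ₁(ext Ω)`, i.e. the least element of the spectrum
(it is meaningful only when the spectrum has a least element). -/
noncomputable def firstEigenvalue {n : ℕ} (Ω : Set (EuclideanSpace ℝ (Fin n))) : ℝ :=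
  sInf (spectrum Ω)

end ExteriorSteklov

open scoped ENNReal NNReal

namespace ExteriorSteklov

/-! The first eigenvalue is `1 / τ ^ 2`, where `τ ^ 2` is the best constant in the trace inequality
`∫_{∂Ω} φ² ≤ τ² ∫_{ext Ω} |∇φ|²`. It therefore suffices to make this constant tend to zero at fixed
volume, and ellipsoids stretched along one axis do so.

For convex `Ω` the constant is controlled by a potential of the surface measure. From a point `x`
outside `Ω`, a supporting half-space contains a distant ball on which `φ` vanishes, and every
segment from `x` to it runs through the exterior. Integrating `∇φ` along these segments gives
`|φ(x)| ≤ C ∫_{ext Ω} |∇φ(z)| |z - x|^(1-n) dz` with `C` depending on `n` only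
(`enorm_le_potential`). The kernel composed with itself is at most a multiple of `|z|^(2-n)`
(`lintegral_powKer_mul_le`), so duality and Schur's test (`lintegral_sq_le_of_le_kernel`) yield `τ²
≤ C sup_x ∫ |y - x|^(2-n) dS(y)` (`trace_inequality`).

Take one semi-axis `2^m b` and all others `b`. A convex surface inside a box has no more area than
the faces of the box (`measure_frontier_inter_box_le`), so each dyadic scale between `b` and `2^m b`
contributes `O(b)`, and the supremum is `O(b (1 + m))` (`lintegral_powKer_tube_le`). Fixed volume
means `b = β 2^(-m/n)`, whence `τ² = O((1 + m) 2^(-m/n))`.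

It remains to identify `1 / τ ^ 2` as the least eigenvalue. Averages over small balls in exterior
cones approximate the trace by finite rank operators (`exists_finite_rank_approx`), so the trace is
compact in the Dirichlet norm and has an extremal (`exists_maximiser`), which is a weak solution of
the Steklov problem. A mollifier equal to minus the Laplacian of a smoothed fundamental solution
supplies Weyl's lemma, and the same smoothed solution, with cutoffs, gives the decay at infinity, so
the extremal becomes an eigenfunction (`exists_isEigenfunction`). Conversely, testing the equation
of any eigenfunction with its own cutoff, whose error vanishes by decay, shows that no eigenvalue is
smaller (`inv_sq_le_of_isEigenfunction`). -/

abbrev E (n : ℕ) := EuclideanSpace ℝ (Fin n)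

variable {n : ℕ}

/-! ### Power kernels and potentials of measures with polynomial growth. -/

/-- The power kernel `‖z‖ ^ (-p)`, with value `∞` at the origin when `p ≠ 0`. -/
noncomputable def powKer (p : ℕ) (z : E n) : ℝ≥0∞ := (‖z‖ₑ⁻¹) ^ p

theorem measurable_powKer (p : ℕ) : Measurable (powKer p : E n → ℝ≥0∞) :=
  (measurable_enorm.inv).pow_const p

theorem measurable_powKer_sub (p : ℕ) (x : E n) : Measurable fun y => powKer p (y - x) :=
  (measurable_powKer p).comp (measurable_id.sub_const x)

theorem powKer_neg (p : ℕ) (z : E n) : powKer p (-z) = powKer p z := by simp [powKer]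

theorem powKer_sub_comm (p : ℕ) (x y : E n) : powKer p (x - y) = powKer p (y - x) := by
  rw [← neg_sub, powKer_neg]

theorem powKer_anti (p : ℕ) {x y : E n} (h : ‖x‖ ≤ ‖y‖) : powKer p y ≤ powKer p x := by
  unfold powKer
  gcongr
  exact enorm_le_iff_norm_le.mpr h

theorem powKer_le_of_le_norm (p : ℕ) {r : ℝ} (hr : 0 < r) {z : E n} (h : r ≤ ‖z‖) :
    powKer p z ≤ ENNReal.ofReal (r⁻¹ ^ p) := by
  unfold powKer
  rw [ENNReal.ofReal_pow (by positivity), ENNReal.ofReal_inv_of_pos hr]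
  gcongr
  rw [← ofReal_norm]
  exact ENNReal.ofReal_le_ofReal h

theorem powKer_eq (p : ℕ) {z : E n} (hz : z ≠ 0) :
    powKer p z = ENNReal.ofReal (‖z‖⁻¹ ^ p) := by
  have : 0 < ‖z‖ := norm_pos_iff.mpr hz
  unfold powKer
  rw [ENNReal.ofReal_pow (by positivity), ENNReal.ofReal_inv_of_pos this, ofReal_norm]

theorem powKer_zero {p : ℕ} (hp : p ≠ 0) : powKer p (0 : E n) = ⊤ := by
  simp [powKer, hp]

/-- The crude far-field bound, kernel maximum times mass. It serves each dyadic annulus as well as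
the complement of a single large ball; `t` only carries the mass. -/
theorem setLIntegral_powKer_compl_closedBall_le (p : ℕ) (m : Measure (E n)) (x : E n) {r : ℝ}
    (hr : 0 < r) {s t : Set (E n)} (hs : s ⊆ t \ Metric.closedBall x r) :
    ∫⁻ y in s, powKer p (y - x) ∂m ≤ ENNReal.ofReal (r⁻¹ ^ p) * m t := by
  calc ∫⁻ y in s, powKer p (y - x) ∂m
      ≤ ∫⁻ y in t \ Metric.closedBall x r, powKer p (y - x) ∂m := lintegral_mono_set hs
    _ ≤ ∫⁻ y in (Metric.closedBall x r)ᶜ, powKer p (y - x) ∂(m.restrict t) := by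
        rw [Measure.restrict_restrict Metric.isClosed_closedBall.measurableSet.compl, sdiff_eq,
          inter_comm]
    _ ≤ ∫⁻ _ in (Metric.closedBall x r)ᶜ, ENNReal.ofReal (r⁻¹ ^ p) ∂(m.restrict t) := by
        refine setLIntegral_mono measurable_const fun y hy => powKer_le_of_le_norm p hr ?_
        rw [mem_compl_iff, Metric.mem_closedBall, dist_eq_norm, not_le] at hy
        exact hy.le
    _ ≤ ENNReal.ofReal (r⁻¹ ^ p) * m t := by
        rw [setLIntegral_const]
        refine mul_le_mul_right ?_ _
        exact (measure_mono (subset_univ _)).trans (by simp)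

theorem tsum_ofReal_half_pow (c : ℝ) (hc : 0 ≤ c) :
    ∑' j : ℕ, ENNReal.ofReal (c * (1 / 2) ^ j) = ENNReal.ofReal (c * 2) := by
  rw [← ENNReal.ofReal_tsum_of_nonneg (fun j => by positivity)
    (summable_geometric_two.mul_left c), tsum_mul_left, tsum_geometric_two]

/-- For `p ≠ 0` the kernel is infinite at its pole, so an atom there would destroy every potential
estimate. Letting `r → 0` in the growth condition excludes it. -/
theorem measure_singleton_eq_zero_of_growth {m : Measure (E n)} {p : ℕ} {A : ℝ≥0∞} (hA : A ≠ ⊤)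
    {R : ℝ} (hR : 0 < R) {x : E n}
    (h : ∀ r, 0 < r → r ≤ R → m (Metric.closedBall x r) ≤ A * ENNReal.ofReal (r ^ (p + 1))) :
    m {x} = 0 := by
  have hlim : Tendsto (fun r : ℝ => A * ENNReal.ofReal (r ^ (p + 1))) (𝓝[>] 0) (𝓝 0) := by
    have : Tendsto (fun r : ℝ => A * ENNReal.ofReal (r ^ (p + 1))) (𝓝 0)
        (𝓝 (A * ENNReal.ofReal ((0 : ℝ) ^ (p + 1)))) := by
      refine ENNReal.Tendsto.const_mul (ENNReal.tendsto_ofReal ?_) (Or.inr hA)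
      exact (continuous_pow (p + 1)).tendsto 0
    simpa using this.mono_left nhdsWithin_le_nhds
  refine le_antisymm (ge_of_tendsto hlim ?_) bot_le
  filter_upwards [Ioo_mem_nhdsGT hR] with r hr
  refine le_trans (measure_mono ?_) (h r hr.1 hr.2.le)
  simpa using hr.1.le

/-- On the annulus between radii `R / 2^(j+1)` and `R / 2^j` the kernel is at most `(2^(j+1) / R)^p`
and the mass at most `A (R / 2^j)^(p+1)`. The products form a geometric series in `j`. -/
theorem lintegral_powKer_closedBall_le {m : Measure (E n)} {p : ℕ} {A : ℝ≥0∞} (hA : A ≠ ⊤)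
    {R : ℝ} (hR : 0 < R) {x : E n}
    (h : ∀ r, 0 < r → r ≤ R → m (Metric.closedBall x r) ≤ A * ENNReal.ofReal (r ^ (p + 1))) :
    ∫⁻ y in Metric.closedBall x R, powKer p (y - x) ∂m ≤
      A * ENNReal.ofReal (2 ^ (p + 1) * R) := by
  let s : ℕ → Set (E n) := fun j =>
    Metric.closedBall x (R / 2 ^ j) \ Metric.closedBall x (R / 2 ^ (j + 1))
  have hsub : Metric.closedBall x R ⊆ {x} ∪ ⋃ j, s j := by
    intro y hy
    by_cases hyx : y = x
    · exact Or.inl hyx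
    refine Or.inr (mem_iUnion.mpr ?_)
    have hpos : 0 < dist y x := dist_pos.mpr hyx
    have hex : ∃ j : ℕ, R / 2 ^ (j + 1) < dist y x := by
      obtain ⟨j, hj⟩ := exists_pow_lt_of_lt_one (div_pos hpos hR) (one_half_lt_one (α := ℝ))
      refine ⟨j, ?_⟩
      rw [lt_div_iff₀ hR] at hj
      refine lt_of_le_of_lt ?_ hj
      rw [one_div, inv_pow, div_eq_mul_inv, mul_comm]
      gcongr
      · norm_num
      · omega
    classical
    -- Minimality of the first admissible index gives the outer radius of the annulus; at index zero
    -- the outer radius is `R` itself.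
    refine ⟨Nat.find hex, ?_, ?_⟩
    · rw [Metric.mem_closedBall]
      rcases Nat.eq_zero_or_pos (Nat.find hex) with h0 | h0
      · rw [h0]; simpa using hy
      · have := Nat.find_min hex (Nat.sub_lt h0 one_pos)
        rw [Nat.sub_add_cancel (by omega), not_lt] at this
        exact this
    · rw [Metric.mem_closedBall, not_le]
      exact Nat.find_spec hex
  calc ∫⁻ y in Metric.closedBall x R, powKer p (y - x) ∂m
      ≤ ∫⁻ y in {x} ∪ ⋃ j, s j, powKer p (y - x) ∂m := lintegral_mono_set hsub
    _ ≤ ∫⁻ y in {x}, powKer p (y - x) ∂m + ∫⁻ y in ⋃ j, s j, powKer p (y - x) ∂m :=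
        lintegral_union_le _ _ _
    _ ≤ 0 + ∑' j, ∫⁻ y in s j, powKer p (y - x) ∂m := by
        gcongr
        · rw [setLIntegral_measure_zero _ _ (measure_singleton_eq_zero_of_growth hA hR h)]
        · exact lintegral_iUnion_le _ _
    _ ≤ ∑' j : ℕ, A * ENNReal.ofReal (2 ^ p * R * (1 / 2) ^ j) := by
        rw [zero_add]
        refine ENNReal.tsum_le_tsum fun j => ?_
        refine (setLIntegral_powKer_compl_closedBall_le p m x (r := R / 2 ^ (j + 1)) (by positivity)
          (subset_refl _)).trans ?_
        have h2 : R / 2 ^ j ≤ R := div_le_self hR.le (one_le_pow₀ one_le_two)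
        grw [h (R / 2 ^ j) (by positivity) h2]
        rw [mul_left_comm, ← ENNReal.ofReal_mul (by positivity)]
        refine mul_le_mul_right (ENNReal.ofReal_le_ofReal (le_of_eq ?_)) _
        have e1 : R / 2 ^ (j + 1) = R / 2 ^ j / 2 := by rw [pow_succ, div_div]
        have e2 : R * (1 / 2) ^ j = R / 2 ^ j := by rw [one_div, inv_pow, div_eq_mul_inv]
        have hx : R / 2 ^ j ≠ 0 := by positivity
        rw [e1, mul_assoc, e2]
        generalize R / 2 ^ j = X at hx
        simp only [inv_pow, div_pow]
        field_simp
        ring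
    _ = A * ENNReal.ofReal (2 ^ (p + 1) * R) := by
        rw [ENNReal.tsum_mul_left, tsum_ofReal_half_pow _ (by positivity)]
        congr 2; ring

/-! ### Composition of the kernel of order `n - 1` with itself. -/

/-- Volume of the unit ball. -/
noncomputable def ballVol (n : ℕ) : ℝ≥0∞ := volume (Metric.ball (0 : E n) 1)

theorem ballVol_ne_top : ballVol n ≠ ⊤ := measure_ball_lt_top.ne

theorem ballVol_ne_zero : ballVol n ≠ 0 := (Metric.measure_ball_pos _ _ one_pos).ne'

theorem volume_closedBall_eq (x : E n) {r : ℝ} (hr : 0 ≤ r) :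
    volume (Metric.closedBall x r) = ballVol n * ENNReal.ofReal (r ^ n) := by
  rw [Measure.addHaar_closedBall _ _ hr, mul_comm, finrank_euclideanSpace_fin, ballVol]

theorem volume_ball_eq (x : E n) {r : ℝ} (hr : 0 < r) :
    volume (Metric.ball x r) = ballVol n * ENNReal.ofReal (r ^ n) := by
  rw [Measure.addHaar_ball_of_pos _ _ hr, mul_comm, finrank_euclideanSpace_fin, ballVol]

theorem lintegral_powKer_volume_closedBall_le (hn : 1 ≤ n) (x : E n) {R : ℝ} (hR : 0 < R) :
    ∫⁻ y in Metric.closedBall x R, powKer (n - 1) (y - x) ≤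
      ballVol n * ENNReal.ofReal (2 ^ n * R) := by
  have := lintegral_powKer_closedBall_le (m := volume) (p := n - 1) (x := x)
    (ballVol_ne_top (n := n)) hR fun r hr _ => by
      rw [Nat.sub_add_cancel hn, volume_closedBall_eq x hr.le]
  rwa [Nat.sub_add_cancel hn] at this

/-- Outward dyadic annuli: the squared kernel decays like `ρ^(2-2n)` against volume `ρ^n`, which is
summable because `n > 2`. -/
theorem lintegral_powKer_sq_compl_closedBall_le (hn : 3 ≤ n) (x : E n) {R : ℝ} (hR : 0 < R) :
    ∫⁻ y in (Metric.closedBall x R)ᶜ, powKer (n - 1) (y - x) ^ 2 ≤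
      ballVol n * ENNReal.ofReal (2 ^ (n + 1) * R⁻¹ ^ (n - 2)) := by
  obtain ⟨k, rfl⟩ : ∃ k, n = k + 3 := ⟨n - 3, by omega⟩
  let s : ℕ → Set (E (k + 3)) := fun j =>
    Metric.closedBall x (R * 2 ^ (j + 1)) \ Metric.closedBall x (R * 2 ^ j)
  have hsub : (Metric.closedBall x R)ᶜ ⊆ ⋃ j, s j := by
    intro y hy
    rw [mem_compl_iff, Metric.mem_closedBall, not_le] at hy
    refine mem_iUnion.mpr ?_
    have hex : ∃ j : ℕ, dist y x ≤ R * 2 ^ (j + 1) := by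
      obtain ⟨j, hj⟩ := pow_unbounded_of_one_lt (dist y x / R) (one_lt_two (α := ℝ))
      refine ⟨j, ?_⟩
      rw [div_lt_iff₀ hR] at hj
      rw [pow_succ]
      nlinarith [pow_pos (two_pos (α := ℝ)) j]
    classical
    refine ⟨Nat.find hex, Nat.find_spec hex, ?_⟩
    rw [Metric.mem_closedBall, not_le]
    rcases Nat.eq_zero_or_pos (Nat.find hex) with h0 | h0
    · rw [h0]; simpa using hy
    · have := Nat.find_min hex (Nat.sub_lt h0 one_pos)
      rw [Nat.sub_add_cancel (by omega), not_le] at this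
      exact this
  have hpow : ∀ z : E (k + 3), powKer (k + 3 - 1) z ^ 2 = powKer (2 * (k + 2)) z := by
    intro z; unfold powKer; rw [← pow_mul]; congr 1; omega
  simp only [hpow]
  calc ∫⁻ y in (Metric.closedBall x R)ᶜ, powKer (2 * (k + 2)) (y - x)
      ≤ ∫⁻ y in ⋃ j, s j, powKer (2 * (k + 2)) (y - x) := lintegral_mono_set hsub
    _ ≤ ∑' j, ∫⁻ y in s j, powKer (2 * (k + 2)) (y - x) := lintegral_iUnion_le _ _
    _ ≤ ∑' j : ℕ, ballVol (k + 3) *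
          ENNReal.ofReal (2 ^ (k + 3) * R⁻¹ ^ (k + 1) * (1 / 2) ^ j) := by
        refine ENNReal.tsum_le_tsum fun j => ?_
        refine (setLIntegral_powKer_compl_closedBall_le _ _ x (r := R * 2 ^ j) (by positivity)
          (subset_refl _)).trans ?_
        rw [volume_closedBall_eq x (by positivity), mul_left_comm,
          ← ENNReal.ofReal_mul (by positivity)]
        refine mul_le_mul_right (ENNReal.ofReal_le_ofReal ?_) _
        have e : (R * 2 ^ j)⁻¹ ^ (2 * (k + 2)) * (R * 2 ^ (j + 1)) ^ (k + 3) =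
            2 ^ (k + 3) * R⁻¹ ^ (k + 1) * ((1 / 2) ^ j) ^ (k + 1) := by
          have : (R * 2 ^ (j + 1)) = 2 * (R * 2 ^ j) := by ring
          rw [this, mul_pow 2, mul_left_comm, mul_assoc]
          congr 1
          rw [← mul_pow, one_div, inv_pow 2, ← mul_inv]
          have hx : R * 2 ^ j ≠ 0 := by positivity
          generalize R * 2 ^ j = X at hx
          rw [show 2 * (k + 2) = (k + 1) + (k + 3) by ring, pow_add, mul_assoc, ← mul_pow _ X,
            inv_mul_cancel₀ hx, one_pow, mul_one]
        rw [e]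
        gcongr
        -- The true ratio `2^(-(k+1))` is weakened to `1/2`, so that one geometric sum serves all
        -- dimensions.
        exact pow_le_of_le_one (by positivity) (pow_le_one₀ (by norm_num) (by norm_num)) (by omega)
    _ = _ := by
        rw [ENNReal.tsum_mul_left, tsum_ofReal_half_pow _ (by positivity)]
        congr 2
        have : k + 3 - 2 = k + 1 := by omega
        rw [this]; ring

/-- On the half-space of points nearer to `x'`, the distance to `x` is at least `d / 2`. Within
distance `d` of `x'` the factor at `x` is pulled out and the other integrates to `O(d)`; further
away the product is at most the square of the kernel at `x'`. Both parts are of order `d^(2-n)`. -/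
theorem lintegral_powKer_mul_half_le (hn : 3 ≤ n) {x x' : E n} (hx : x ≠ x') :
    ∫⁻ z in {z | ‖z - x'‖ ≤ ‖z - x‖}, powKer (n - 1) (z - x) * powKer (n - 1) (z - x') ≤
      ballVol n * 2 ^ (2 * n + 1) * powKer (n - 2) (x - x') := by
  have hd : 0 < ‖x - x'‖ := norm_pos_iff.mpr (sub_ne_zero.mpr hx)
  set d := ‖x - x'‖ with hd_def
  set A : Set (E n) := {z | ‖z - x'‖ ≤ ‖z - x‖}
  have hA : MeasurableSet A := (isClosed_le (by fun_prop) (by fun_prop)).measurableSet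
  have hfar : ∀ z ∈ A, d / 2 ≤ ‖z - x‖ := by
    intro z hz
    have h1 : d ≤ ‖z - x'‖ + ‖z - x‖ := by
      have : x - x' = (z - x') - (z - x) := by abel
      rw [hd_def, this]; exact norm_sub_le _ _
    have h2 : ‖z - x'‖ ≤ ‖z - x‖ := hz
    linarith
  have hball : MeasurableSet (Metric.closedBall x' d) := Metric.isClosed_closedBall.measurableSet
  rw [← lintegral_inter_add_sdiff _ A hball]
  have h1 : ∫⁻ z in A ∩ Metric.closedBall x' d, powKer (n - 1) (z - x) * powKer (n - 1) (z - x') ≤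
      ENNReal.ofReal ((d / 2)⁻¹ ^ (n - 1)) * (ballVol n * ENNReal.ofReal (2 ^ n * d)) := by
    calc _ ≤ ∫⁻ z in A ∩ Metric.closedBall x' d,
            ENNReal.ofReal ((d / 2)⁻¹ ^ (n - 1)) * powKer (n - 1) (z - x') := by
          refine setLIntegral_mono (by
            exact (measurable_powKer_sub _ _).const_mul _) ?_
          intro z hz
          gcongr
          exact powKer_le_of_le_norm _ (by positivity) (hfar z hz.1)
      _ ≤ ∫⁻ z in Metric.closedBall x' d,
            ENNReal.ofReal ((d / 2)⁻¹ ^ (n - 1)) * powKer (n - 1) (z - x') :=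
          lintegral_mono_set inter_subset_right
      _ ≤ _ := by
          rw [lintegral_const_mul _ (measurable_powKer_sub _ _)]
          gcongr
          exact lintegral_powKer_volume_closedBall_le (by omega) x' hd
  have h2 : ∫⁻ z in A \ Metric.closedBall x' d, powKer (n - 1) (z - x) * powKer (n - 1) (z - x') ≤
      ballVol n * ENNReal.ofReal (2 ^ (n + 1) * d⁻¹ ^ (n - 2)) := by
    calc _ ≤ ∫⁻ z in A \ Metric.closedBall x' d, powKer (n - 1) (z - x') ^ 2 := by
          refine setLIntegral_mono (by
            exact (measurable_powKer_sub _ _).pow_const _) ?_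
          intro z hz
          rw [sq]
          gcongr
          exact powKer_anti _ hz.1
      _ ≤ ∫⁻ z in (Metric.closedBall x' d)ᶜ, powKer (n - 1) (z - x') ^ 2 :=
          lintegral_mono_set fun z hz => hz.2
      _ ≤ _ := lintegral_powKer_sq_compl_closedBall_le hn x' hd
  refine (add_le_add h1 h2).trans ?_
  rw [powKer_eq _ (sub_ne_zero.mpr hx), ← hd_def]
  obtain ⟨k, rfl⟩ : ∃ k, n = k + 3 := ⟨n - 3, by omega⟩
  rw [mul_left_comm, ← mul_add, mul_assoc, ← ENNReal.ofReal_mul (by positivity),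
    ← ENNReal.ofReal_add (by positivity) (by positivity)]
  gcongr
  have : (2 : ℝ≥0∞) ^ (2 * (k + 3) + 1) = ENNReal.ofReal (2 ^ (2 * (k + 3) + 1)) := by
    rw [ENNReal.ofReal_pow zero_le_two]; norm_num
  rw [this, ← ENNReal.ofReal_mul (by positivity)]
  apply ENNReal.ofReal_le_ofReal
  have e1 : k + 3 - 1 = k + 2 := by omega
  have e2 : k + 3 - 2 = k + 1 := by omega
  rw [e1, e2]
  have e3 : (d / 2)⁻¹ ^ (k + 2) * (2 ^ (k + 3) * d) = 2 ^ (2 * k + 5) * d⁻¹ ^ (k + 1) := by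
    rw [div_eq_mul_inv, mul_inv, inv_inv, mul_pow, pow_succ d⁻¹ (k + 1)]
    field_simp
    ring
  rw [e3, ← add_mul]
  gcongr
  have e4 : (2 : ℝ) ^ (k + 3 + 1) ≤ 2 ^ (2 * k + 5) := pow_le_pow_right₀ one_le_two (by omega)
  have e5 : (2 : ℝ) ^ (2 * (k + 3) + 1) = 4 * 2 ^ (2 * k + 5) := by ring
  have := pow_pos (two_pos (α := ℝ)) (2 * k + 5)
  linarith

/-- The constant in the composition estimate of the kernel `‖z‖ ^ (1 - n)` with itself. -/
noncomputable def compConst (n : ℕ) : ℝ≥0∞ := ballVol n * 2 ^ (2 * n + 2)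

theorem compConst_ne_top : compConst n ≠ ⊤ :=
  ENNReal.mul_ne_top ballVol_ne_top (ENNReal.pow_ne_top ENNReal.ofNat_ne_top)

theorem compConst_ne_zero : compConst n ≠ 0 :=
  mul_ne_zero ballVol_ne_zero (pow_ne_zero _ two_ne_zero)

/-- The bisecting hyperplane of `x` and `x'` splits space into two halves that are symmetric in the
two points. When they coincide the right side is infinite, since `n - 2 ≠ 0`. -/
theorem lintegral_powKer_mul_le (hn : 3 ≤ n) (x x' : E n) :
    ∫⁻ z, powKer (n - 1) (z - x) * powKer (n - 1) (z - x') ≤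
      compConst n * powKer (n - 2) (x - x') := by
  by_cases hx : x = x'
  · subst hx
    rw [sub_self, powKer_zero (by omega), ENNReal.mul_top compConst_ne_zero]
    exact le_top
  set A : Set (E n) := {z | ‖z - x'‖ ≤ ‖z - x‖}
  have hA : MeasurableSet A := (isClosed_le (by fun_prop) (by fun_prop)).measurableSet
  rw [← lintegral_add_compl _ hA]
  have h1 := lintegral_powKer_mul_half_le hn hx
  have h2 := lintegral_powKer_mul_half_le hn (Ne.symm hx)
  have h3 : ∫⁻ z in Aᶜ, powKer (n - 1) (z - x) * powKer (n - 1) (z - x') ≤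
      ∫⁻ z in {z | ‖z - x‖ ≤ ‖z - x'‖}, powKer (n - 1) (z - x') * powKer (n - 1) (z - x) := by
    simp only [mul_comm (powKer (n - 1) (_ - x))]
    exact lintegral_mono_set fun z hz => (not_le.mp (show ¬ ‖z - x'‖ ≤ ‖z - x‖ from hz)).le
  refine (add_le_add h1 (h3.trans h2)).trans ?_
  rw [powKer_sub_comm _ x' x, ← two_mul, compConst]
  apply le_of_eq
  ring

/-! ### Square-integral bounds by duality and Schur's test. -/

theorem lintegral_mul_sq_le {α : Type*} [MeasurableSpace α] (μ : Measure α) {f g : α → ℝ≥0∞}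
    (hf : AEMeasurable f μ) (hg : AEMeasurable g μ) :
    (∫⁻ a, f a * g a ∂μ) ^ 2 ≤ (∫⁻ a, f a ^ 2 ∂μ) * ∫⁻ a, g a ^ 2 ∂μ := by
  have h := ENNReal.lintegral_mul_le_Lp_mul_Lq μ Real.HolderConjugate.two_two hf hg
  simp only [Pi.mul_apply, ENNReal.rpow_two] at h
  calc _ ≤ ((∫⁻ a, f a ^ 2 ∂μ) ^ (1 / 2 : ℝ) * (∫⁻ a, g a ^ 2 ∂μ) ^ (1 / 2 : ℝ)) ^ 2 := by gcongr
    _ = _ := by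
      rw [mul_pow, ← ENNReal.rpow_natCast, ← ENNReal.rpow_natCast, ← ENNReal.rpow_mul,
        ← ENNReal.rpow_mul]
      norm_num

/-- Closes the duality argument, where the quantity to be bounded reappears on the right; finiteness
is what allows it to be cancelled. -/
theorem le_of_sq_le_mul {I B : ℝ≥0∞} (hI : I ≠ ⊤) (h : I ^ 2 ≤ B * I) : I ≤ B := by
  by_cases h0 : I = 0
  · simp [h0]
  rw [sq] at h
  exact (ENNReal.mul_le_mul_iff_left h0 hI).1 h

theorem two_mul_mul_le_sq_add_sq (a b : ℝ≥0∞) : 2 * (a * b) ≤ a ^ 2 + b ^ 2 := by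
  by_cases ha : a = ⊤
  · simp [ha]
  by_cases hb : b = ⊤
  · simp [hb]
  lift a to ℝ≥0 using ha
  lift b to ℝ≥0 using hb
  norm_cast
  have := two_mul_le_add_sq (a : ℝ) b
  rw [← NNReal.coe_le_coe]
  push_cast
  linarith

/-- The kernel `‖y - x‖ ^ (-p)` truncated at distance `D`. -/
noncomputable def truncKer (p : ℕ) (D : ℝ≥0∞) (x y : E n) : ℝ≥0∞ :=
  {z : E n | ‖z‖ₑ ≤ D}.indicator (powKer p) (y - x)

theorem measurable_truncKer (p : ℕ) (D : ℝ≥0∞) :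
    Measurable fun q : E n × E n => truncKer p D q.1 q.2 :=
  ((measurable_powKer p).indicator (measurableSet_le measurable_enorm measurable_const)).comp
    (measurable_snd.sub measurable_fst)

theorem truncKer_comm (p : ℕ) (D : ℝ≥0∞) (x y : E n) :
    truncKer p D x y = truncKer p D y x := by
  unfold truncKer
  have h : ‖y - x‖ₑ = ‖x - y‖ₑ := by rw [← enorm_neg, neg_sub]
  by_cases hD : ‖x - y‖ₑ ≤ D
  · rw [indicator_of_mem (by exact h.trans_le hD), indicator_of_mem (by exact hD), powKer_sub_comm]
  · rw [indicator_of_notMem (by rwa [mem_ofPred_eq, h]), indicator_of_notMem (by exact hD)]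

theorem truncKer_top (p : ℕ) (x y : E n) : truncKer p ⊤ x y = powKer p (y - x) := by
  simp [truncKer]

/-- Balls of radius `D` about points more than `2 D` apart do not meet, so composition doubles the
range of the truncation. Keeping the range finite is what later makes short-range potentials small.
-/
theorem lintegral_truncKer_mul_le (hn : 3 ≤ n) (D : ℝ≥0∞) (x x' : E n) :
    ∫⁻ z, truncKer (n - 1) D x z * truncKer (n - 1) D x' z ≤
      compConst n * truncKer (n - 2) (2 * D) x x' := by
  by_cases h : ‖x' - x‖ₑ ≤ 2 * D
  · have h1 : truncKer (n - 2) (2 * D) x x' = powKer (n - 2) (x - x') := by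
      rw [truncKer, indicator_of_mem (by exact h), powKer_sub_comm]
    rw [h1]
    refine le_trans (lintegral_mono fun z => ?_) (lintegral_powKer_mul_le hn x x')
    exact mul_le_mul' (indicator_le_self _ _ _) (indicator_le_self _ _ _)
  · have h0 : ∀ z, truncKer (n - 1) D x z * truncKer (n - 1) D x' z = 0 := by
      intro z
      unfold truncKer
      by_cases h1 : ‖z - x‖ₑ ≤ D
      · have h2 : ¬ ‖z - x'‖ₑ ≤ D := by
          intro h2
          apply h
          have : x' - x = (z - x) - (z - x') := by abel
          rw [this, two_mul]
          exact (enorm_sub_le).trans (add_le_add h1 h2)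
        rw [indicator_of_notMem (a := z - x') (by exact h2), mul_zero]
      · rw [indicator_of_notMem (a := z - x) (by exact h1), zero_mul]
    simp [h0]

section Composition

variable {α β : Type*} [MeasurableSpace α] [MeasurableSpace β] {m : Measure α} [SFinite m]
  {ν : Measure β} [SFinite ν] {k : α → β → ℝ≥0∞} {r : α → α → ℝ≥0∞} {h : α → ℝ≥0∞} {c M : ℝ≥0∞}

/-- Expanding the square turns the norm of the adjoint potential of `h` into a quadratic form in the
composed kernel. All integrands are nonnegative, so Tonelli needs no integrability. -/
theorem lintegral_sq_eq_lintegral_lintegral (hk : Measurable (Function.uncurry k))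
    (hh : Measurable h) :
    ∫⁻ z, (∫⁻ x, h x * k x z ∂m) ^ 2 ∂ν =
      ∫⁻ x, ∫⁻ x', h x * h x' * (∫⁻ z, k x z * k x' z ∂ν) ∂m ∂m := by
  have e1 : ∀ z, (∫⁻ x, h x * k x z ∂m) ^ 2 =
      ∫⁻ x, ∫⁻ x', h x * h x' * (k x z * k x' z) ∂m ∂m := by
    intro z
    rw [sq, ← lintegral_mul_const _ (by fun_prop)]
    refine lintegral_congr fun x => ?_
    rw [← lintegral_const_mul _ (by fun_prop)]
    refine lintegral_congr fun x' => ?_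
    ring
  simp only [e1]
  rw [lintegral_lintegral_swap]
  · refine lintegral_congr fun x => ?_
    rw [lintegral_lintegral_swap]
    · refine lintegral_congr fun x' => ?_
      rw [lintegral_const_mul _ (by fun_prop)]
    · exact Measurable.aemeasurable (by fun_prop)
  · exact (Measurable.lintegral_prod_right' (f := fun q : (β × α) × α =>
      h q.1.2 * h q.2 * (k q.1.2 q.1.1 * k q.2 q.1.1)) (by fun_prop)).aemeasurable

/-- Schur's test: by `2 h h' ≤ h² + h'²` and symmetry of the kernel, a uniform bound on its row
integrals suffices. -/
theorem lintegral_lintegral_mul_le_of_symm (hr : Measurable (Function.uncurry r))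
    (hh : Measurable h) (hsymm : ∀ x x', r x x' = r x' x) (hM : ∀ x, ∫⁻ x', r x x' ∂m ≤ M) :
    ∫⁻ x, ∫⁻ x', h x * h x' * r x x' ∂m ∂m ≤ M * ∫⁻ x, h x ^ 2 ∂m := by
  have e3 : ∫⁻ x, ∫⁻ x', h x ^ 2 * r x x' ∂m ∂m ≤ M * ∫⁻ x, h x ^ 2 ∂m := by
    rw [← lintegral_const_mul _ (by fun_prop)]
    refine lintegral_mono fun x => ?_
    rw [lintegral_const_mul _ (by fun_prop), mul_comm]
    gcongr
    exact hM x
  have e4 : ∫⁻ x, ∫⁻ x', h x' ^ 2 * r x x' ∂m ∂m ≤ M * ∫⁻ x, h x ^ 2 ∂m := by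
    rw [lintegral_lintegral_swap (Measurable.aemeasurable (by fun_prop))]
    refine le_trans (le_of_eq ?_) e3
    refine lintegral_congr fun x => lintegral_congr fun x' => ?_
    rw [hsymm]
  have e5 : 2 * ∫⁻ x, ∫⁻ x', h x * h x' * r x x' ∂m ∂m ≤ 2 * (M * ∫⁻ x, h x ^ 2 ∂m) := by
    have m0 : Measurable fun q : α × α => h q.1 * h q.2 * r q.1 q.2 := by fun_prop
    have m1 : Measurable fun q : α × α => h q.1 ^ 2 * r q.1 q.2 := by fun_prop
    rw [← lintegral_const_mul _ m0.lintegral_prod_right', two_mul (M * _)]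
    refine le_trans ?_ (add_le_add e3 e4)
    rw [← lintegral_add_left m1.lintegral_prod_right']
    refine lintegral_mono fun x => ?_
    dsimp only
    rw [← lintegral_const_mul _ (by fun_prop), ← lintegral_add_left (by fun_prop)]
    refine lintegral_mono fun x' => ?_
    dsimp only
    rw [← mul_assoc, ← add_mul]
    gcongr
    exact two_mul_mul_le_sq_add_sq _ _
  exact (ENNReal.mul_le_mul_iff_right two_ne_zero ENNReal.ofNat_ne_top).1 e5

/-- Pairing `h` with its pointwise bound moves the kernel from `G` onto `h`. Cauchy–Schwarz then
leaves the norm of `G` times that of the adjoint potential of `h`, and the square of the latter is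
at most `c M ∫ h²`; one factor `∫ h²` cancels. -/
theorem lintegral_sq_le_of_le_kernel {G : β → ℝ≥0∞} {C : ℝ≥0∞}
    (hk : Measurable (Function.uncurry k)) (hr : Measurable (Function.uncurry r))
    (hh : Measurable h) (hG : Measurable G) (hsymm : ∀ x x', r x x' = r x' x)
    (hM : ∀ x, ∫⁻ x', r x x' ∂m ≤ M) (hc : c ≠ ⊤)
    (hkr : ∀ x x', ∫⁻ z, k x z * k x' z ∂ν ≤ c * r x x')
    (hC : C ≠ ⊤) (hle : ∀ᵐ x ∂m, h x ≤ C * ∫⁻ z, G z * k x z ∂ν)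
    (hfin : ∫⁻ x, h x ^ 2 ∂m ≠ ⊤) :
    ∫⁻ x, h x ^ 2 ∂m ≤ C ^ 2 * c * M * ∫⁻ z, G z ^ 2 ∂ν := by
  have s0 : ∫⁻ z, (∫⁻ x, h x * k x z ∂m) ^ 2 ∂ν ≤ c * M * ∫⁻ x, h x ^ 2 ∂m := by
    rw [lintegral_sq_eq_lintegral_lintegral hk hh]
    calc _ ≤ ∫⁻ x, ∫⁻ x', c * (h x * h x' * r x x') ∂m ∂m := by
          refine lintegral_mono fun x => lintegral_mono fun x' => ?_
          rw [mul_left_comm]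
          gcongr
          exact hkr x x'
      _ = c * ∫⁻ x, ∫⁻ x', h x * h x' * r x x' ∂m ∂m := by
          simp only [lintegral_const_mul' _ _ hc]
      _ ≤ _ := by
          rw [mul_assoc]
          gcongr
          exact lintegral_lintegral_mul_le_of_symm hr hh hsymm hM
  have s1 : ∫⁻ x, h x ^ 2 ∂m ≤ C * ∫⁻ z, G z * (∫⁻ x, h x * k x z ∂m) ∂ν := by
    calc ∫⁻ x, h x ^ 2 ∂m ≤ ∫⁻ x, C * (∫⁻ z, h x * (G z * k x z) ∂ν) ∂m := by
          refine lintegral_mono_ae ?_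
          filter_upwards [hle] with x hx
          rw [sq, lintegral_const_mul _ (by fun_prop), mul_left_comm]
          gcongr
      _ = C * ∫⁻ x, (∫⁻ z, h x * (G z * k x z) ∂ν) ∂m := lintegral_const_mul' _ _ hC
      _ = _ := by
          congr 1
          rw [lintegral_lintegral_swap (Measurable.aemeasurable (by fun_prop))]
          refine lintegral_congr fun z => ?_
          rw [← lintegral_const_mul _ (by fun_prop)]
          refine lintegral_congr fun x => ?_
          ring
  have mW : Measurable fun z => ∫⁻ x, h x * k x z ∂m :=
    Measurable.lintegral_prod_left' (f := fun q : α × β => h q.1 * k q.1 q.2) (by fun_prop)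
  have s2 := lintegral_mul_sq_le ν hG.aemeasurable mW.aemeasurable
  refine le_of_sq_le_mul hfin ?_
  calc (∫⁻ x, h x ^ 2 ∂m) ^ 2 ≤ (C * ∫⁻ z, G z * (∫⁻ x, h x * k x z ∂m) ∂ν) ^ 2 := by gcongr
    _ ≤ C ^ 2 * ((∫⁻ z, G z ^ 2 ∂ν) * (c * M * ∫⁻ x, h x ^ 2 ∂m)) := by
        rw [mul_pow]
        gcongr
        exact s2.trans (mul_le_mul_right s0 _)
    _ = _ := by ring

end Composition

/-- `L²` bound for potentials `x ↦ ∫ G(z) ‖z - x‖ ^ (1 - n) dz` with respect to a measure whose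
Riesz potential of order two is bounded. -/
theorem lintegral_sq_le_of_le_potential (hn : 3 ≤ n) (m : Measure (E n)) [SFinite m]
    {h G : E n → ℝ≥0∞} (hh : Measurable h) (hG : Measurable G) {C M : ℝ≥0∞} (hC : C ≠ ⊤)
    {D : ℝ≥0∞} (hle : ∀ᵐ x ∂m, h x ≤ C * ∫⁻ z, G z * truncKer (n - 1) D x z)
    (hM : ∀ x, ∫⁻ x', truncKer (n - 2) (2 * D) x x' ∂m ≤ M)
    (hfin : ∫⁻ x, h x ^ 2 ∂m ≠ ⊤) :
    ∫⁻ x, h x ^ 2 ∂m ≤ C ^ 2 * compConst n * M * ∫⁻ z, G z ^ 2 :=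
  lintegral_sq_le_of_le_kernel (measurable_truncKer _ _) (measurable_truncKer _ _) hh hG
    (truncKer_comm _ _) hM compConst_ne_top (lintegral_truncKer_mul_le hn D) hC hle hfin

/-! ### Pointwise bounds by potentials of the gradient. -/

theorem lintegral_Ioi_inv_pow_le (hn : 1 ≤ n) {a : ℝ} (ha : 0 < a) :
    ∫⁻ t in Ioi a, ENNReal.ofReal (t⁻¹ ^ (n + 1)) ≤ ENNReal.ofReal (a⁻¹ ^ n / n) := by
  have hlt : (-(n + 1 : ℝ)) < -1 := by
    have : (1 : ℝ) ≤ n := by exact_mod_cast hn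
    linarith
  have e : ∀ t ∈ Ioi a, t⁻¹ ^ (n + 1) = t ^ (-(n + 1 : ℝ)) := by
    intro t ht
    have h0 : 0 < t := ha.trans ht
    rw [Real.rpow_neg h0.le, inv_pow]
    congr 1
    exact_mod_cast (Real.rpow_natCast t (n + 1)).symm
  rw [setLIntegral_congr_fun measurableSet_Ioi fun t ht => by rw [e t ht],
    ← ofReal_integral_eq_lintegral_ofReal (integrableOn_Ioi_rpow_of_lt hlt ha) (by
      filter_upwards [self_mem_ae_restrict measurableSet_Ioi] with t ht
      exact Real.rpow_nonneg (ha.trans ht).le _), integral_Ioi_rpow_of_lt hlt ha]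
  apply ENNReal.ofReal_le_ofReal
  have h1 : -(n + 1 : ℝ) + 1 = -n := by ring
  rw [h1, Real.rpow_neg ha.le, Real.rpow_natCast, inv_pow, neg_div_neg_eq]

/-- The substitution `v = t w` has Jacobian `t^(-n)`, and `‖w‖ = ‖v‖ / t` supplies one more inverse
power. The indicator records the image of the ball, in a form convenient for integrating in `t` at
fixed `v`. -/
theorem lintegral_closedBall_comp_smul {H : E n → ℝ≥0∞} (hH : Measurable H) {D t : ℝ}
    (ht0 : 0 < t) :
    ∫⁻ w in Metric.closedBall 0 D, H (t • w) * ‖w‖ₑ =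
      ∫⁻ v, H v * ‖v‖ₑ *
        (Ici ‖v‖).indicator (fun _ => ENNReal.ofReal (t⁻¹ ^ (n + 1))) (t * D) := by
  set B : Set (E n) := Metric.closedBall 0 D
  have hB : MeasurableSet B := Metric.isClosed_closedBall.measurableSet
  set P : E n → ℝ≥0∞ := fun v => H v * ‖v‖ₑ *
    (Iic (t * D)).indicator (fun _ => ENNReal.ofReal t⁻¹) ‖v‖ with hP
  have mP : Measurable P := (hH.mul measurable_enorm).mul
    ((measurable_const.indicator measurableSet_Iic).comp measurable_norm)
  have hPt : ∫⁻ w in B, H (t • w) * ‖w‖ₑ = ∫⁻ w, P (t • w) := by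
    rw [← lintegral_indicator hB]
    refine lintegral_congr fun w => ?_
    have hmem : ‖t • w‖ ∈ Iic (t * D) ↔ w ∈ B := by
      rw [norm_smul, Real.norm_of_nonneg ht0.le, mem_Iic, mul_le_mul_iff_right₀ ht0]
      simp [B]
    rw [hP]
    by_cases hw : w ∈ B
    · dsimp only
      rw [indicator_of_mem hw, indicator_of_mem (hmem.2 hw), enorm_smul,
        ENNReal.ofReal_inv_of_pos ht0, Real.enorm_of_nonneg ht0.le, mul_assoc,
        mul_comm (ENNReal.ofReal t), mul_assoc, ENNReal.mul_inv_cancel, mul_one]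
      · simpa using ht0
      · simp
    · dsimp only
      rw [indicator_of_notMem hw, indicator_of_notMem (fun h => hw (hmem.1 h)), mul_zero]
  have hmap : ∫⁻ w, P (t • w) = ENNReal.ofReal (t⁻¹ ^ n) * ∫⁻ v, P v := by
    have := lintegral_map (μ := (volume : Measure (E n))) mP (measurable_const_smul t)
    rw [← this, Measure.map_addHaar_smul _ ht0.ne', lintegral_smul_measure, smul_eq_mul,
      finrank_euclideanSpace_fin, abs_of_nonneg (by positivity), inv_pow]
  rw [hPt, hmap, ← lintegral_const_mul _ mP]
  refine lintegral_congr fun v => ?_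
  rw [hP]
  by_cases hv : ‖v‖ ≤ t * D
  · rw [indicator_of_mem (show t * D ∈ Ici ‖v‖ from hv)]
    dsimp only
    rw [indicator_of_mem (show ‖v‖ ∈ Iic (t * D) from hv), pow_succ,
      ENNReal.ofReal_mul (by positivity)]
    ring
  · rw [indicator_of_notMem (show t * D ∉ Ici ‖v‖ from hv)]
    dsimp only
    rw [indicator_of_notMem (show ‖v‖ ∉ Iic (t * D) from hv)]
    simp

theorem measurable_indicator_inv_pow (D : ℝ) : Measurable fun q : ℝ × E n =>
    (Ici ‖q.2‖).indicator (fun _ => ENNReal.ofReal (q.1⁻¹ ^ (n + 1))) (q.1 * D) := by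
  simp only [indicator, mem_Ici]
  exact Measurable.ite (measurableSet_le (by fun_prop) (by fun_prop)) (by fun_prop)
    measurable_const

theorem mul_inv_div_pow_div (hn : 1 ≤ n) {v D : ℝ} (hv : 0 < v) :
    v * ((v / D)⁻¹ ^ n / n) = D ^ n / n * v⁻¹ ^ (n - 1) := by
  obtain ⟨k, rfl⟩ : ∃ k, n = k + 1 := ⟨n - 1, by omega⟩
  rw [Nat.add_sub_cancel, inv_div, div_pow, inv_pow]
  field_simp
  ring

/-- At fixed `v` only `t ≥ ‖v‖ / D` contributes. The `t`-integral is at most `D^n ‖v‖^(-n) / n`, and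
the factor `‖v‖` reduces the exponent to `n - 1`; for `‖v‖ > D` no `t < 1` remains. -/
theorem lintegral_Ioo_indicator_le (hn : 1 ≤ n) (a : ℝ≥0∞) {D : ℝ} (hD : 0 < D) (v : E n) :
    ∫⁻ t in Ioo (0 : ℝ) 1, a * ‖v‖ₑ *
      (Ici ‖v‖).indicator (fun _ => ENNReal.ofReal (t⁻¹ ^ (n + 1))) (t * D) ≤
    (Metric.closedBall 0 D).indicator
      (fun v => ENNReal.ofReal (D ^ n / n) * (a * powKer (n - 1) v)) v := by
  set B : Set (E n) := Metric.closedBall 0 D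
  by_cases hv0 : v = 0
  · rw [hv0, enorm_zero]
    simp only [mul_zero, zero_mul, lintegral_zero]
    exact bot_le
  have hvpos : 0 < ‖v‖ := norm_pos_iff.mpr hv0
  have mJv : Measurable fun t : ℝ =>
      (Ici ‖v‖).indicator (fun _ => ENNReal.ofReal (t⁻¹ ^ (n + 1))) (t * D) := by
    simp only [indicator, mem_Ici]
    exact Measurable.ite (measurableSet_le (by fun_prop) (by fun_prop)) (by fun_prop)
      measurable_const
  rw [lintegral_const_mul _ mJv]
  by_cases hv : v ∈ B
  · rw [indicator_of_mem hv]
    have hI : ∫⁻ t in Ioo (0 : ℝ) 1,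
        (Ici ‖v‖).indicator (fun _ => ENNReal.ofReal (t⁻¹ ^ (n + 1))) (t * D) ≤
        ENNReal.ofReal ((‖v‖ / D)⁻¹ ^ n / n) := by
      refine le_trans ?_ (lintegral_Ioi_inv_pow_le hn (div_pos hvpos hD))
      rw [← setLIntegral_congr Ioi_ae_eq_Ici.symm, ← lintegral_indicator measurableSet_Ici]
      refine (setLIntegral_le_lintegral _ _).trans (lintegral_mono fun t => ?_)
      dsimp only
      by_cases ht : ‖v‖ ≤ t * D
      · rw [indicator_of_mem (by exact ht),
          indicator_of_mem (by rw [mem_Ici, div_le_iff₀ hD]; exact ht)]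
      · rw [indicator_of_notMem (by exact ht)]
        exact bot_le
    calc _ ≤ a * ‖v‖ₑ * ENNReal.ofReal ((‖v‖ / D)⁻¹ ^ n / n) := mul_le_mul_right hI _
      _ = _ := by
        have e5 : ‖v‖ₑ * ENNReal.ofReal ((‖v‖ / D)⁻¹ ^ n / n) =
            ENNReal.ofReal (D ^ n / n) * powKer (n - 1) v := by
          rw [powKer_eq _ hv0, ← ofReal_norm, ← ENNReal.ofReal_mul (by positivity),
            ← ENNReal.ofReal_mul (by positivity)]
          rw [mul_inv_div_pow_div hn hvpos]
        rw [mul_assoc, e5]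
        ring
  · rw [indicator_of_notMem hv]
    have hI : ∫⁻ t in Ioo (0 : ℝ) 1,
        (Ici ‖v‖).indicator (fun _ => ENNReal.ofReal (t⁻¹ ^ (n + 1))) (t * D) = 0 := by
      refine setLIntegral_eq_zero measurableSet_Ioo fun t ht => ?_
      refine indicator_of_notMem ?_ _
      have : D < ‖v‖ := by simpa [B] using hv
      rw [mem_Ici, not_le]
      nlinarith [ht.2]
    refine le_of_eq ?_
    rw [hI, mul_zero]

/-- Averages line integrals over all end points in a ball. Dilations about `x` and Tonelli replace
polar coordinates. -/
theorem lintegral_segment_le (hn : 1 ≤ n) {G : E n → ℝ≥0∞} (hG : Measurable G) (x : E n) {D : ℝ}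
    (hD : 0 < D) :
    ∫⁻ y in Metric.closedBall x D, ∫⁻ t in Ioo (0 : ℝ) 1, G (x + t • (y - x)) * ‖y - x‖ₑ ≤
      ENNReal.ofReal (D ^ n / n) *
        ∫⁻ z, G z * truncKer (n - 1) (ENNReal.ofReal D) x z := by
  set H : E n → ℝ≥0∞ := fun w => G (x + w) with hH_def
  have hH : Measurable H := hG.comp (measurable_const_add x)
  set B : Set (E n) := Metric.closedBall 0 D
  have hB : MeasurableSet B := Metric.isClosed_closedBall.measurableSet
  have e1 : ∫⁻ y in Metric.closedBall x D, ∫⁻ t in Ioo (0 : ℝ) 1, G (x + t • (y - x)) * ‖y - x‖ₑ =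
      ∫⁻ w in B, ∫⁻ t in Ioo (0 : ℝ) 1, H (t • w) * ‖w‖ₑ := by
    rw [← lintegral_indicator Metric.isClosed_closedBall.measurableSet, ← lintegral_indicator hB,
      ← lintegral_add_left_eq_self _ x]
    refine lintegral_congr fun w => ?_
    have hmem : x + w ∈ Metric.closedBall x D ↔ w ∈ B := by
      simp [B, dist_eq_norm]
    by_cases hw : w ∈ B
    · rw [indicator_of_mem (hmem.2 hw), indicator_of_mem hw]
      simp only [add_sub_cancel_left, hH_def]
    · rw [indicator_of_notMem (fun h => hw (hmem.1 h)), indicator_of_notMem hw]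
  have e2 : ∫⁻ z, G z * truncKer (n - 1) (ENNReal.ofReal D) x z =
      ∫⁻ w in B, H w * powKer (n - 1) w := by
    rw [← lintegral_indicator hB, ← lintegral_add_left_eq_self _ x]
    refine lintegral_congr fun w => ?_
    have hmem : ‖w‖ₑ ≤ ENNReal.ofReal D ↔ w ∈ B := by
      rw [← ofReal_norm, ENNReal.ofReal_le_ofReal_iff hD.le]
      simp [B]
    rw [truncKer, add_sub_cancel_left]
    by_cases hw : w ∈ B
    · rw [indicator_of_mem (by exact hmem.2 hw), indicator_of_mem hw]
    · rw [indicator_of_notMem (a := w) (s := {z : E n | ‖z‖ₑ ≤ ENNReal.ofReal D})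
        (fun h => hw (hmem.1 h)), indicator_of_notMem hw, mul_zero]
  have mJ := measurable_indicator_inv_pow (n := n) D
  have e3 : ∫⁻ w in B, ∫⁻ t in Ioo (0 : ℝ) 1, H (t • w) * ‖w‖ₑ =
      ∫⁻ t in Ioo (0 : ℝ) 1, ∫⁻ v, H v * ‖v‖ₑ *
        (Ici ‖v‖).indicator (fun _ => ENNReal.ofReal (t⁻¹ ^ (n + 1))) (t * D) := by
    rw [lintegral_lintegral_swap (Measurable.aemeasurable (by fun_prop))]
    exact setLIntegral_congr_fun measurableSet_Ioo fun t ht =>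
      lintegral_closedBall_comp_smul hH ht.1
  have e4 : ∫⁻ t in Ioo (0 : ℝ) 1, ∫⁻ v, H v * ‖v‖ₑ *
        (Ici ‖v‖).indicator (fun _ => ENNReal.ofReal (t⁻¹ ^ (n + 1))) (t * D) =
      ∫⁻ v, ∫⁻ t in Ioo (0 : ℝ) 1, H v * ‖v‖ₑ *
        (Ici ‖v‖).indicator (fun _ => ENNReal.ofReal (t⁻¹ ^ (n + 1))) (t * D) :=
    lintegral_lintegral_swap (((hH.mul measurable_enorm).comp measurable_snd).mul mJ).aemeasurable
  rw [e1, e2, e3, e4, ← lintegral_const_mul' _ _ ENNReal.ofReal_ne_top, ← lintegral_indicator hB]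
  refine lintegral_mono fun v => (lintegral_Ioo_indicator_le hn (H v) hD v).trans (le_of_eq ?_)
  by_cases hv : v ∈ B
  · rw [indicator_of_mem hv, indicator_of_mem hv]
  · rw [indicator_of_notMem hv, indicator_of_notMem hv]

/-- The fundamental theorem of calculus along a segment. -/
theorem enorm_sub_le_lintegral_segment {φ : E n → ℝ} (hφ : ContDiff ℝ 1 φ) (x y : E n) :
    ‖φ x - φ y‖ₑ ≤ ∫⁻ t in Ioo (0 : ℝ) 1, ‖∇ φ (x + t • (y - x))‖ₑ * ‖y - x‖ₑ := by
  have hder : ∀ t ∈ uIcc (0 : ℝ) 1, HasDerivAt (fun t : ℝ => φ (x + t • (y - x)))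
      (fderiv ℝ φ (x + t • (y - x)) (y - x)) t := by
    intro t _
    have h1 : HasFDerivAt φ (fderiv ℝ φ (x + t • (y - x))) (x + t • (y - x)) :=
      (hφ.differentiable one_ne_zero _).hasFDerivAt
    have h2 : HasDerivAt (fun t : ℝ => x + t • (y - x)) (y - x) t := by
      simpa using ((hasDerivAt_id t).smul_const (y - x)).const_add x
    exact h1.comp_hasDerivAt t h2
  have hcont : Continuous fun t : ℝ => fderiv ℝ φ (x + t • (y - x)) (y - x) := by
    have := hφ.continuous_fderiv one_ne_zero
    fun_prop
  have hint := intervalIntegral.integral_eq_sub_of_hasDerivAt hder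
    (hcont.intervalIntegrable _ _)
  simp only [one_smul, zero_smul, add_zero, add_sub_cancel] at hint
  rw [← enorm_neg, neg_sub, ← hint, intervalIntegral.integral_of_le zero_le_one,
    integral_Ioc_eq_integral_Ioo]
  refine (enorm_integral_le_lintegral_enorm _).trans ?_
  refine lintegral_mono fun t => ?_
  refine (ContinuousLinearMap.le_opENorm _ _).trans (le_of_eq ?_)
  congr 1
  rw [gradient, LinearIsometryEquiv.enorm_map]

theorem continuous_gradient {φ : E n → ℝ} (hφ : ContDiff ℝ 1 φ) : Continuous (∇ φ) :=
  (InnerProductSpace.toDual ℝ (E n)).symm.continuous.comp (hφ.continuous_fderiv one_ne_zero)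

/-- Deviation of a function from its average over a set that is joined to the point `x` by segments
in `U`. -/
theorem enorm_sub_average_le (hn : 1 ≤ n) {φ : E n → ℝ} (hφ : ContDiff ℝ 1 φ) {x : E n} {D : ℝ}
    (hD : 0 < D) {Q U : Set (E n)} (hU : MeasurableSet U) (hQ : MeasurableSet Q)
    (hQD : Q ⊆ Metric.closedBall x D)
    (hseg : ∀ y ∈ Q, ∀ t ∈ Ioo (0 : ℝ) 1, x + t • (y - x) ∈ U) (hQ0 : volume Q ≠ 0) :
    ‖φ x - ⨍ y in Q, φ y‖ₑ ≤ (volume Q)⁻¹ * ENNReal.ofReal (D ^ n / n) *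
      ∫⁻ z, U.indicator (fun z => ‖∇ φ z‖ₑ) z * truncKer (n - 1) (ENNReal.ofReal D) x z := by
  have hQtop : volume Q ≠ ⊤ :=
    ((measure_mono hQD).trans_lt measure_closedBall_lt_top).ne
  have hint : IntegrableOn φ Q :=
    (hφ.continuous.locallyIntegrable.integrableOn_isCompact
      (isCompact_closedBall x D)).mono_set hQD
  have hG : Measurable (U.indicator fun z => ‖∇ φ z‖ₑ) :=
    ((continuous_gradient hφ).measurable.enorm).indicator hU
  have havg : φ x - ⨍ y in Q, φ y = ⨍ y in Q, (φ x - φ y) := by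
    simp only [setAverage_eq]
    have hci : IntegrableOn (fun _ : E n => φ x) Q := integrableOn_const hQtop
    rw [integral_sub hci hint, smul_sub, setIntegral_const, smul_smul,
      measureReal_def, inv_mul_cancel₀ (ENNReal.toReal_ne_zero.mpr ⟨hQ0, hQtop⟩), one_smul]
  rw [havg, setAverage_eq, enorm_smul, mul_assoc]
  have hinv : ‖(volume.real Q)⁻¹‖ₑ = (volume Q)⁻¹ := by
    have hp : 0 < volume.real Q := ENNReal.toReal_pos hQ0 hQtop
    rw [Real.enorm_of_nonneg (by positivity), ENNReal.ofReal_inv_of_pos hp, measureReal_def,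
      ENNReal.ofReal_toReal hQtop]
  rw [hinv]
  gcongr
  refine le_trans ?_ (lintegral_segment_le hn hG x hD)
  calc ‖∫ y in Q, (φ x - φ y)‖ₑ ≤ ∫⁻ y in Q, ‖φ x - φ y‖ₑ := enorm_integral_le_lintegral_enorm _
    _ ≤ ∫⁻ y in Q, ∫⁻ t in Ioo (0 : ℝ) 1,
          U.indicator (fun z => ‖∇ φ z‖ₑ) (x + t • (y - x)) * ‖y - x‖ₑ := by
        refine setLIntegral_mono' hQ fun y hy => ?_
        refine (enorm_sub_le_lintegral_segment hφ x y).trans ?_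
        refine setLIntegral_mono' measurableSet_Ioo fun t ht => ?_
        rw [indicator_of_mem (hseg y hy t ht)]
    _ ≤ _ := lintegral_mono_set hQD

/-- The constant in the pointwise bound of a function outside a convex set by a potential. -/
noncomputable def potConst (n : ℕ) : ℝ≥0∞ := (ballVol n)⁻¹ * ENNReal.ofReal (3 ^ n / n)

theorem potConst_ne_top : potConst n ≠ ⊤ :=
  ENNReal.mul_ne_top (ENNReal.inv_ne_top.mpr ballVol_ne_zero) ENNReal.ofReal_ne_top

/-- A supporting half-space of an open convex set at a point outside of it. -/
theorem exists_unit_normal {Ω : Set (E n)} (ho : IsOpen Ω) (hc : Convex ℝ Ω) (hne : Ω.Nonempty)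
    {x : E n} (hx : x ∉ Ω) : ∃ ν : E n, ‖ν‖ = 1 ∧ ∀ y ∈ closure Ω, inner ℝ ν (y - x) ≤ 0 := by
  obtain ⟨f, hf⟩ := geometric_hahn_banach_open_point hc ho hx
  set v := (InnerProductSpace.toDual ℝ (E n)).symm f with hv
  have hfv : ∀ y, f y = inner ℝ v y := fun y => by simp [hv]
  have hv0 : v ≠ 0 := by
    intro h0
    obtain ⟨a, ha⟩ := hne
    have := hf a ha
    simp [hfv, h0] at this
  have hvpos : 0 < ‖v‖ := norm_pos_iff.mpr hv0
  refine ⟨‖v‖⁻¹ • v, by rw [norm_smul, norm_inv, norm_norm, inv_mul_cancel₀ hvpos.ne'], ?_⟩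
  have hcl : closure Ω ⊆ {y | inner ℝ v (y - x) ≤ 0} := by
    refine closure_minimal (fun y hy => ?_) (isClosed_le (by fun_prop) continuous_const)
    have := hf y hy
    rw [hfv, hfv] at this
    rw [mem_ofPred_eq, inner_sub_right]
    linarith
  intro y hy
  rw [inner_smul_left]
  exact mul_nonpos_of_nonneg_of_nonpos (by simp) (hcl hy)

theorem isOpen_ext (Ω : Set (E n)) : IsOpen (ext Ω) := isClosed_closure.isOpen_compl

/-- The ball of radius `t / 2` about `x + t ν`, with `ν` an outer normal at `x`, lies beyond the
support of `φ`, so the average subtracted from `φ x` is zero. Convexity makes the ball visible from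
`x` through the exterior. -/
theorem enorm_le_potential (hn : 1 ≤ n) {Ω : Set (E n)} (ho : IsOpen Ω) (hc : Convex ℝ Ω)
    (hne : Ω.Nonempty) {φ : E n → ℝ} (hφ : ContDiff ℝ 1 φ) (hs : HasCompactSupport φ)
    {x : E n} (hx : x ∉ Ω) :
    ‖φ x‖ₑ ≤ potConst n *
      ∫⁻ z, (ext Ω).indicator (fun z => ‖∇ φ z‖ₑ) z * truncKer (n - 1) ⊤ x z := by
  obtain ⟨ν, hν, hsep⟩ := exists_unit_normal ho hc hne hx
  obtain ⟨R, hR⟩ := hs.isCompact.isBounded.subset_closedBall (0 : E n)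
  -- Points of the ball below are at distance at least `t / 2` from `x`, hence have norm at least
  -- `|R| + 1` and lie off the support.
  set t : ℝ := 2 * (|R| + ‖x‖ + 1) with ht_def
  have ht : 0 < t := by positivity
  set Q : Set (E n) := Metric.ball (x + t • ν) (t / 2)
  have hQdist : ∀ y ∈ Q, ‖(y - x) - t • ν‖ < t / 2 := by
    intro y hy
    rw [sub_sub, ← dist_eq_norm]
    exact hy
  have hnt : ‖t • ν‖ = t := by rw [norm_smul, hν, mul_one, Real.norm_of_nonneg ht.le]
  have hzero : ∀ y ∈ Q, φ y = 0 := by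
    intro y hy
    have h1 := hQdist y hy
    have h2 : t / 2 ≤ ‖y - x‖ := by
      have := norm_sub_norm_le (t • ν) (y - x)
      rw [norm_sub_rev (t • ν), hnt] at this
      linarith
    have h3 := norm_sub_le y x
    refine image_eq_zero_of_notMem_tsupport fun hy' => ?_
    have h4 := hR hy'
    rw [Metric.mem_closedBall, dist_zero_right] at h4
    have := le_abs_self R
    linarith
  have hvol : volume Q = ballVol n * ENNReal.ofReal ((t / 2) ^ n) :=
    volume_ball_eq _ (by positivity)
  have hQ0 : volume Q ≠ 0 := (Metric.measure_ball_pos _ _ (by positivity)).ne'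
  have hmain := enorm_sub_average_le hn hφ (x := x) (D := 3 * (t / 2)) (Q := Q) (U := ext Ω)
    (by positivity) (isOpen_ext Ω).measurableSet measurableSet_ball
    (by
      intro y hy
      have h1 := hQdist y hy
      have h2 := norm_sub_norm_le (y - x) (t • ν)
      rw [Metric.mem_closedBall, dist_eq_norm]
      linarith)
    (by
      -- The component of `y - x` along `ν` exceeds `t / 2`, so every point of the open segment is
      -- strictly beyond the supporting hyperplane.
      intro y hy s hs' hcl
      have h1 := hsep _ hcl
      rw [add_sub_cancel_left, inner_smul_right] at h1
      have h2 : inner ℝ ν (y - x) = t + inner ℝ ν ((y - x) - t • ν) := by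
        rw [inner_sub_right ν (y - x), inner_smul_right, real_inner_self_eq_norm_sq, hν]
        ring
      have h3 := abs_real_inner_le_norm ν ((y - x) - t • ν)
      rw [hν, one_mul] at h3
      have h4 := hQdist y hy
      have h5 := neg_abs_le (inner ℝ ν ((y - x) - t • ν))
      nlinarith [hs'.1])
    hQ0
  rw [setAverage_eq, setIntegral_eq_zero_of_forall_eq_zero hzero, smul_zero, sub_zero] at hmain
  refine hmain.trans ?_
  -- The ball and the length of the segments both scale with `t`, so the constant depends neither on
  -- `φ` nor on `Ω`.
  have hconst : (volume Q)⁻¹ * ENNReal.ofReal ((3 * (t / 2)) ^ n / n) = potConst n := by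
    have hp : 0 < (t / 2) ^ n := by positivity
    rw [hvol, potConst, ENNReal.mul_inv (Or.inl ballVol_ne_zero) (Or.inl ballVol_ne_top),
      mul_assoc, ← ENNReal.ofReal_inv_of_pos hp, ← ENNReal.ofReal_mul (by positivity)]
    congr 2
    rw [mul_pow]
    field_simp
  rw [hconst]
  gcongr with z
  rw [truncKer_top]
  exact indicator_le_self _ _ _

/-! ### Maximisers for compact quadratic quotients. -/

section Hilbert

variable {X Y : Type*} [NormedAddCommGroup X] [InnerProductSpace ℝ X] [CompleteSpace X]
  [NormedAddCommGroup Y] [InnerProductSpace ℝ Y] [CompleteSpace Y]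

/-- A compact operator attains its norm, at a singular vector. -/
theorem exists_singular_vector (T : X →L[ℝ] Y) (hT : IsCompactOperator T) (h0 : T ≠ 0) :
    0 < ‖T‖ ∧ ∃ x : X, x ≠ 0 ∧ ∀ y, inner ℝ (T x) (T y) = ‖T‖ ^ 2 * inner ℝ x y := by
  have hτ : 0 < ‖T‖ := norm_pos_iff.mpr h0
  have hex : ∀ k : ℕ, ∃ x : X, ‖x‖ < 1 ∧ ‖T‖ - ‖T‖ / (k + 2) < ‖T x‖ := by
    intro k
    refine T.exists_lt_apply_of_lt_opNorm (r := ‖T‖ - ‖T‖ / (k + 2)) ?_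
    have : 0 < ‖T‖ / (k + 2 : ℝ) := by positivity
    linarith
  choose x hx1 hx2 using hex
  obtain ⟨K, hK, hKsub⟩ := IsCompactOperator.image_closedBall_subset_compact (f := (T : X →ₗ[ℝ] Y)) hT 1
  obtain ⟨y, -, φ, hφ, hy⟩ := hK.tendsto_subseq (x := fun k => T (x k))
    (fun k => hKsub ⟨x k, by simpa using (hx1 k).le, rfl⟩)
  have hlow : Tendsto (fun k : ℕ => ‖T‖ - ‖T‖ / (k + 2 : ℝ)) atTop (𝓝 ‖T‖) := by
    have h1 : Tendsto (fun k : ℕ => ‖T‖ / (k + 2 : ℝ)) atTop (𝓝 0) :=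
      tendsto_const_nhds.div_atTop
        (tendsto_atTop_add_const_right _ _ tendsto_natCast_atTop_atTop)
    simpa using tendsto_const_nhds.sub h1
  have hnorm : Tendsto (fun k => ‖T (x k)‖) atTop (𝓝 ‖T‖) := by
    refine tendsto_of_tendsto_of_tendsto_of_le_of_le hlow tendsto_const_nhds
      (fun k => (hx2 k).le) (fun k => ?_)
    have := T.le_opNorm (x k)
    nlinarith [hx1 k]
  have hsub : Tendsto (fun k => T (x (φ k))) atTop (𝓝 y) := hy
  have hynorm : ‖y‖ = ‖T‖ := tendsto_nhds_unique hsub.norm (hnorm.comp hφ.tendsto_atTop)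
  -- Expanding the square bounds it by `‖T‖² (‖T‖² - ‖T x‖²)`, which tends to zero along a
  -- maximising sequence. Since `T* T x` converges by compactness, so does `x`, strongly and without
  -- weak limits.
  have hdiff : Tendsto (fun k => ‖T‖ ^ 2 • x (φ k) - T.adjoint (T (x (φ k)))) atTop (𝓝 0) := by
    rw [tendsto_zero_iff_norm_tendsto_zero]
    have hb : Tendsto (fun k => ‖T‖ ^ 2 * (‖T‖ ^ 2 - ‖T (x (φ k))‖ ^ 2)) atTop (𝓝 0) := by
      have := ((tendsto_const_nhds (x := ‖T‖ ^ 2)).sub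
        ((hnorm.comp hφ.tendsto_atTop).pow 2)).const_mul (‖T‖ ^ 2)
      simpa using this
    have hsq : Tendsto (fun k => ‖‖T‖ ^ 2 • x (φ k) - T.adjoint (T (x (φ k)))‖ ^ 2)
        atTop (𝓝 0) := by
      refine squeeze_zero (fun k => by positivity) (fun k => ?_) hb
      rw [@norm_sub_sq ℝ, norm_smul, inner_smul_left, T.adjoint_inner_right,
        real_inner_self_eq_norm_sq]
      have h1 : ‖T.adjoint (T (x (φ k)))‖ ≤ ‖T‖ * ‖T (x (φ k))‖ := by
        have := T.adjoint.le_opNorm (T (x (φ k)))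
        rwa [LinearIsometryEquiv.norm_map] at this
      have h2 := hx1 (φ k)
      have h3 := norm_nonneg (x (φ k))
      have h4 : ‖T.adjoint (T (x (φ k)))‖ ^ 2 ≤ ‖T‖ ^ 2 * ‖T (x (φ k))‖ ^ 2 := by
        rw [← mul_pow]; gcongr
      have h5 : (‖T‖ ^ 2) ^ 2 * ‖x (φ k)‖ ^ 2 ≤ (‖T‖ ^ 2) ^ 2 := by
        have : ‖x (φ k)‖ ^ 2 ≤ 1 := by nlinarith
        nlinarith [sq_nonneg (‖T‖ ^ 2)]
      simp only [norm_pow, norm_norm, conj_trivial, RCLike.re_to_real]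
      rw [mul_pow]
      nlinarith
    have := hsq.sqrt
    simpa using this
  have hxlim : Tendsto (fun k => x (φ k)) atTop (𝓝 ((‖T‖ ^ 2)⁻¹ • T.adjoint y)) := by
    have h1 : Tendsto (fun k => (‖T‖ ^ 2)⁻¹ • ((‖T‖ ^ 2 • x (φ k) - T.adjoint (T (x (φ k)))) +
        T.adjoint (T (x (φ k))))) atTop (𝓝 ((‖T‖ ^ 2)⁻¹ • (0 + T.adjoint y))) :=
      (hdiff.add ((T.adjoint.continuous.tendsto y).comp hsub)).const_smul _
    rw [zero_add] at h1
    refine h1.congr fun k => ?_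
    rw [sub_add_cancel, smul_smul, inv_mul_cancel₀ (by positivity), one_smul]
  set z := (‖T‖ ^ 2)⁻¹ • T.adjoint y with hz
  have hTz : T z = y := tendsto_nhds_unique ((T.continuous.tendsto z).comp hxlim) hsub
  refine ⟨hτ, z, ?_, fun v => ?_⟩
  · intro hz0
    rw [hz0, map_zero] at hTz
    rw [← hTz, norm_zero] at hynorm
    exact hτ.ne hynorm
  · rw [hTz, ← T.adjoint_inner_left, hz, inner_smul_left]
    simp only [conj_trivial]
    rw [← mul_assoc, mul_inv_cancel₀ (by positivity), one_mul]

omit [CompleteSpace X] in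
theorem isCompactOperator_of_finite_rank_approx (T : X →L[ℝ] Y)
    (h : ∀ ε > 0, ∃ (ι : Type) (_ : Fintype ι) (l : ι → (X →L[ℝ] ℝ)) (w : ι → Y),
      ‖T - ∑ i, (l i).smulRight (w i)‖ ≤ ε) : IsCompactOperator T := by
  refine isClosed_setOfPred_isCompactOperator.closure_subset
    (Metric.mem_closure_iff.mpr fun ε hε => ?_)
  obtain ⟨N, _, l, w, hlw⟩ := h (ε / 2) (by positivity)
  refine ⟨_, ?_, by rw [dist_eq_norm]; exact hlw.trans_lt (by linarith)⟩
  rw [mem_ofPred_eq]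
  have hc : ∀ i, IsCompactOperator ((l i).smulRight (w i)) := by
    intro i
    have h1 : IsCompactOperator (l i) := isCompactOperator_of_locallyCompactSpace_dom (l i)
    exact h1.clm_comp (ContinuousLinearMap.toSpanSingleton ℝ (w i))
  have hmem : ∑ i, (l i).smulRight (w i) ∈ compactOperator (RingHom.id ℝ) X Y :=
    Submodule.sum_mem _ fun i _ => hc i
  exact hmem

variable {D : Type*} [AddCommGroup D] [Module ℝ D]

/-- Existence of a maximiser of the quotient `‖f d‖ / ‖e d‖` in the completion, for a form `f` that
is compact relative to `e`. -/
theorem exists_maximiser (e : D →ₗ[ℝ] X) (f : D →ₗ[ℝ] Y) (hf : ∃ d, f d ≠ 0)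
    {C : ℝ} (hC : 0 ≤ C) (hfe : ∀ d, ‖f d‖ ≤ C * ‖e d‖)
    (happ : ∀ ε > 0, ∃ (ι : Type) (_ : Fintype ι) (l : ι → (D →ₗ[ℝ] ℝ)) (w : ι → Y),
      (∀ i, ∃ c, ∀ d, ‖l i d‖ ≤ c * ‖e d‖) ∧ ∀ d, ‖f d - ∑ i, l i d • w i‖ ≤ ε * ‖e d‖) :
    ∃ τ : ℝ, 0 < τ ∧ τ ≤ C ∧ (∀ d, ‖f d‖ ≤ τ * ‖e d‖) ∧
      ∃ (d : ℕ → D) (G : X) (F : Y), Tendsto (fun k => e (d k)) atTop (𝓝 G) ∧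
        Tendsto (fun k => f (d k)) atTop (𝓝 F) ∧ G ≠ 0 ∧
        ∀ d', inner ℝ F (f d') = τ ^ 2 * inner ℝ G (e d') := by
  -- The closure of the range serves as the completion of `D` in the energy norm.
  let X' := (LinearMap.range e).topologicalClosure
  have : CompleteSpace X' :=
    (LinearMap.range e).isClosed_topologicalClosure.completeSpace_coe
  let e' : D →ₗ[ℝ] X' := e.codRestrict X' fun d =>
    (LinearMap.range e).le_topologicalClosure ⟨d, rfl⟩
  have hcoe : ∀ d, (e' d : X) = e d := fun d => rfl
  have hnorm : ∀ d, ‖e' d‖ = ‖e d‖ := fun d => rfl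
  have hdense : DenseRange e' := by
    intro x
    rw [Topology.IsInducing.subtypeVal.closure_eq_preimage_closure_image]
    have h1 : (x : X) ∈ closure (LinearMap.range e : Set X) := x.2
    rw [mem_preimage]
    convert! h1 using 2
    ext y
    constructor
    · rintro ⟨_, ⟨d, rfl⟩, rfl⟩
      exact ⟨d, rfl⟩
    · rintro ⟨d, rfl⟩
      exact ⟨e' d, ⟨d, rfl⟩, rfl⟩
  -- The bound `hfe` makes `f` factor through `e`, even where `e` has a kernel.
  let T : X' →L[ℝ] Y := f.extendOfNorm e'
  have hT : ∀ d, T (e' d) = f d := LinearMap.extendOfNorm_eq hdense ⟨C, hfe⟩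
  have hT0 : T ≠ 0 := by
    obtain ⟨d, hd⟩ := hf
    intro h0
    apply hd
    rw [← hT, h0, zero_apply]
  have hTc : IsCompactOperator T := by
    refine isCompactOperator_of_finite_rank_approx T fun ε hε => ?_
    obtain ⟨N, hN, l, w, hl, hlw⟩ := happ ε hε
    refine ⟨N, hN, fun i => (l i).extendOfNorm e', w, ?_⟩
    refine ContinuousLinearMap.opNorm_le_bound _ hε.le fun x => ?_
    refine hdense.induction_on (p := fun x => ‖(T - ∑ i,
      ((l i).extendOfNorm e').smulRight (w i)) x‖ ≤ ε * ‖x‖) x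
      (isClosed_le (by fun_prop) (by fun_prop)) fun d => ?_
    simp only [sub_apply, sum_apply,
      ContinuousLinearMap.smulRight_apply, hT, hnorm,
      fun i => LinearMap.extendOfNorm_eq hdense (hl i) d]
    exact hlw d
  obtain ⟨hTpos, x, hx0, hx⟩ := exists_singular_vector T hTc hT0
  obtain ⟨u, hu, hux⟩ := mem_closure_iff_seq_limit.mp (hdense x)
  choose d hd using hu
  refine ⟨‖T‖, hTpos, LinearMap.opNorm_extendOfNorm_le hdense hC hfe,
    fun d => ?_, d, x, T x, ?_, ?_, ?_, fun d' => ?_⟩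
  · rw [← hT, ← hnorm]
    exact T.le_opNorm _
  · have := (continuous_subtype_val.tendsto x).comp hux
    refine this.congr fun k => ?_
    rw [Function.comp, ← hd k]
    rfl
  · have := (T.continuous.tendsto x).comp hux
    refine this.congr fun k => ?_
    rw [Function.comp, ← hd k, hT]
  · simpa using hx0
  · rw [← hT, hx]
    rfl

end Hilbert

/-! ### Area of convex surfaces. -/

theorem euclideanHausdorffMeasure_image_le {X Y : Type*} [MetricSpace X] [MeasurableSpace X]
    [BorelSpace X] [MetricSpace Y] [MeasurableSpace Y] [BorelSpace Y] (d : ℕ) {f : X → Y}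
    {s : Set X} (hf : LipschitzOnWith 1 f s) : μHE[d] (f '' s) ≤ μHE[d] s := by
  simp only [Measure.euclideanHausdorffMeasure_def, Measure.smul_apply]
  gcongr
  simpa using hf.hausdorffMeasure_image_le (d := d) (by positivity)

/-- A closed box with sides parallel to the axes. -/
def box {n : ℕ} (a b : Fin n → ℝ) : Set (E n) := {y | ∀ i, y i ∈ Icc (a i) (b i)}

variable {k : ℕ}

/-- Insertion of the coordinate `c` at position `i`. -/
noncomputable def insertCoord (i : Fin (k + 1)) (c : ℝ) (z : E k) : E (k + 1) :=
  WithLp.toLp 2 (i.insertNth c z)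

@[simp] theorem insertCoord_same (i : Fin (k + 1)) (c : ℝ) (z : E k) :
    insertCoord i c z i = c := by simp [insertCoord]

@[simp] theorem insertCoord_succAbove (i : Fin (k + 1)) (c : ℝ) (z : E k) (j : Fin k) :
    insertCoord i c z (i.succAbove j) = z j := by simp [insertCoord]

theorem isometry_insertCoord (i : Fin (k + 1)) (c : ℝ) : Isometry (insertCoord i c) := by
  refine Isometry.of_dist_eq fun z w => ?_
  rw [EuclideanSpace.dist_eq, EuclideanSpace.dist_eq, Fin.sum_univ_succAbove _ i]
  simp

theorem volume_box (a b : Fin k → ℝ) :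
    volume (box a b : Set (E k)) = ∏ j, ENNReal.ofReal (b j - a j) := by
  have h : (box a b : Set (E k)) = WithLp.ofLp ⁻¹' Icc a b := by
    ext y
    simp only [box, mem_ofPred_eq, mem_preimage, mem_Icc, Pi.le_def]
    exact ⟨fun h => ⟨fun i => (h i).1, fun i => (h i).2⟩, fun h i => ⟨h.1 i, h.2 i⟩⟩
  rw [h, (PiLp.volume_preserving_ofLp (Fin k)).measure_preimage
    measurableSet_Icc.nullMeasurableSet, Real.volume_Icc_pi]

theorem measure_face_le (a b : Fin (k + 1) → ℝ) (i : Fin (k + 1)) (c : ℝ) :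
    μHE[k] {y ∈ (box a b : Set (E (k + 1))) | y i = c} ≤
      ∏ j : Fin k, ENNReal.ofReal (b (i.succAbove j) - a (i.succAbove j)) := by
  have hsub : {y ∈ (box a b : Set (E (k + 1))) | y i = c} ⊆
      insertCoord i c '' box (fun j => a (i.succAbove j)) (fun j => b (i.succAbove j)) := by
    rintro y ⟨hy, hyc⟩
    refine ⟨WithLp.toLp 2 fun j => y (i.succAbove j), fun j => hy _, ?_⟩
    ext j
    rcases Fin.eq_self_or_eq_succAbove i j with rfl | ⟨j, rfl⟩
    · simp [hyc]
    · simp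
  refine (measure_mono hsub).trans ?_
  rw [(isometry_insertCoord i c).euclideanHausdorffMeasure_image, ← volume_box,
    EuclideanSpace.euclideanHausdorffMeasure_eq_volume]

/-- The ray from a point of the box leaves the box through a face. -/
theorem exists_exit {a b : Fin n → ℝ} {x ν : E n} (hx : x ∈ box a b) (hν : ν ≠ 0) :
    ∃ t : ℝ, 0 ≤ t ∧ x + t • ν ∈ box a b ∧
      ∃ i, (x + t • ν) i = a i ∨ (x + t • ν) i = b i := by
  obtain ⟨i₀, hi₀⟩ : ∃ i, ν i ≠ 0 := by
    by_contra! h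
    exact hν (by ext i; simpa using h i)
  set A : Set ℝ := {t | 0 ≤ t ∧ x + t • ν ∈ box a b} with hA
  have hcl : IsClosed A := by
    have : A = Ici 0 ∩ ⋂ i, {t : ℝ | (x + t • ν) i ∈ Icc (a i) (b i)} := by
      ext t; simp [hA, box]
    rw [this]
    refine isClosed_Ici.inter (isClosed_iInter fun i => ?_)
    exact isClosed_Icc.preimage (by simp only [PiLp.add_apply, PiLp.smul_apply]; fun_prop)
  have hbd : ∀ t ∈ A, t ≤ (|a i₀| + |b i₀| + |x i₀|) / |ν i₀| := by
    rintro t ⟨ht0, ht⟩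
    rw [le_div_iff₀ (abs_pos.mpr hi₀)]
    have h1 := ht i₀
    simp only [PiLp.add_apply, PiLp.smul_apply, smul_eq_mul, mem_Icc] at h1
    rw [← abs_of_nonneg ht0, ← abs_mul, abs_le]
    have := neg_abs_le (a i₀); have := le_abs_self (b i₀); have := neg_abs_le (x i₀)
    have := le_abs_self (x i₀); have := abs_nonneg (a i₀); have := abs_nonneg (b i₀)
    constructor <;> linarith
  have hne : A.Nonempty := ⟨0, le_rfl, by simpa using hx⟩
  have hbdd : BddAbove A := ⟨_, hbd⟩
  have htA := hcl.csSup_mem hne hbdd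
  set t := sSup A
  refine ⟨t, htA.1, htA.2, ?_⟩
  -- If at the last time in the box every coordinate were strictly inside its interval, the ray
  -- could be continued within the box.
  by_contra! hno
  have hopen : ∀ᶠ s in 𝓝 t, ∀ i, (x + s • ν) i ∈ Icc (a i) (b i) := by
    rw [eventually_all]
    intro i
    have hc : ContinuousAt (fun s : ℝ => (x + s • ν) i) t := by
      simp only [PiLp.add_apply, PiLp.smul_apply]; fun_prop
    refine hc.eventually_mem (Icc_mem_nhds ?_ ?_)
    · exact lt_of_le_of_ne (htA.2 i).1 (hno i).1.symm
    · exact lt_of_le_of_ne (htA.2 i).2 (hno i).2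
  obtain ⟨s, hs, hst⟩ :=
    ((hopen.filter_mono nhdsWithin_le_nhds).and (self_mem_nhdsWithin (s := Ioi t))).exists
  exact absurd (le_csSup hbdd ⟨htA.1.trans hst.le, hs⟩) (not_le.mpr hst)

theorem frontier_notMem {Ω : Set (E n)} (ho : IsOpen Ω) {x : E n} (hx : x ∈ frontier Ω) :
    x ∉ Ω := by
  rw [ho.frontier_eq] at hx
  exact hx.2

/-- The part of the boundary of a convex set in a box has no more area than the faces of the box. -/
theorem measure_frontier_inter_box_le {Ω : Set (E (k + 1))} (ho : IsOpen Ω) (hc : Convex ℝ Ω)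
    (hne : Ω.Nonempty) (a b : Fin (k + 1) → ℝ) :
    μHE[k] (frontier Ω ∩ box a b) ≤
      2 * ∑ i : Fin (k + 1), ∏ j : Fin k,
        ENNReal.ofReal (b (i.succAbove j) - a (i.succAbove j)) := by
  set A := frontier Ω ∩ box a b with hA
  -- Each boundary point is pushed along an outer normal until it leaves the box. The inner product
  -- condition is the supporting hyperplane inequality at `x`.
  have hex : ∀ x : E (k + 1), ∃ y : E (k + 1), x ∈ A → (y ∈ box a b ∧ (∃ i, y i = a i ∨ y i = b i) ∧
      ∀ x' ∈ A, 0 ≤ inner ℝ (y - x) (x - x')) := by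
    intro x
    by_cases hx : x ∈ A
    · obtain ⟨ν, hν, hsep⟩ := exists_unit_normal ho hc hne (frontier_notMem ho hx.1)
      have hν0 : ν ≠ 0 := by rintro rfl; simp at hν
      obtain ⟨t, ht, hbox, hi⟩ := exists_exit hx.2 hν0
      refine ⟨x + t • ν, fun _ => ⟨hbox, hi, fun x' hx' => ?_⟩⟩
      rw [add_sub_cancel_left, inner_smul_left, ← neg_sub x' x, inner_neg_right]
      have := hsep x' (frontier_subset_closure hx'.1)
      simp only [conj_trivial]
      nlinarith
    · exact ⟨0, fun h => absurd h hx⟩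
  choose g hg using hex
  -- The two supporting inequalities add up to `⟨g x - g x', x - x'⟩ ≥ |x - x'|²`. Hence the push is
  -- expanding, its inverse is 1-Lipschitz, and the faces have at least the area of `A`.
  have hexp : ∀ x ∈ A, ∀ x' ∈ A, dist x x' ≤ dist (g x) (g x') := by
    intro x hx x' hx'
    have h1 := (hg x hx).2.2 x' hx'
    have h2 := (hg x' hx').2.2 x hx
    have h3 : inner ℝ (g x - g x') (x - x') = inner ℝ (x - x') (x - x') +
        inner ℝ (g x - x) (x - x') + inner ℝ (g x' - x') (x' - x) := by
      have : g x - g x' = (x - x') + (g x - x) - (g x' - x') := by abel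
      have h' : inner ℝ (g x' - x') (x - x') = -inner ℝ (g x' - x') (x' - x) := by
        rw [← inner_neg_right, neg_sub]
      rw [this, inner_sub_left, inner_add_left, h']
      ring
    rw [real_inner_self_eq_norm_sq] at h3
    have h4 := real_inner_le_norm (g x - g x') (x - x')
    rw [dist_eq_norm, dist_eq_norm]
    by_contra! hlt
    nlinarith [norm_nonneg (g x - g x')]
  have hinj : InjOn g A := by
    intro x hx x' hx' h
    have := hexp x hx x' hx'
    rw [h, dist_self] at this
    exact dist_le_zero.mp this
  set F : Set (E (k + 1)) := ⋃ i, ({y ∈ box a b | y i = a i} ∪ {y ∈ box a b | y i = b i})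
  have hmaps : g '' A ⊆ F := by
    rintro _ ⟨x, hx, rfl⟩
    obtain ⟨hbox, ⟨i, hi⟩, -⟩ := hg x hx
    exact mem_iUnion.mpr ⟨i, hi.imp (fun h => ⟨hbox, h⟩) fun h => ⟨hbox, h⟩⟩
  have hlip : LipschitzOnWith 1 (Function.invFunOn g A) (g '' A) := by
    refine LipschitzOnWith.of_dist_le_mul ?_
    rintro _ ⟨x, hx, rfl⟩ _ ⟨x', hx', rfl⟩
    rw [hinj.leftInvOn_invFunOn hx, hinj.leftInvOn_invFunOn hx', NNReal.coe_one, one_mul]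
    exact hexp x hx x' hx'
  calc μHE[k] A = μHE[k] (Function.invFunOn g A '' (g '' A)) := by
        rw [hinj.leftInvOn_invFunOn.image_image]
    _ ≤ μHE[k] (g '' A) := euclideanHausdorffMeasure_image_le k hlip
    _ ≤ μHE[k] F := measure_mono hmaps
    _ ≤ ∑ i, μHE[k] ({y ∈ box a b | y i = a i} ∪ {y ∈ box a b | y i = b i}) :=
        measure_iUnion_fintype_le _ _
    _ ≤ ∑ i : Fin (k + 1), 2 * ∏ j : Fin k,
          ENNReal.ofReal (b (i.succAbove j) - a (i.succAbove j)) := by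
        refine Finset.sum_le_sum fun i _ => ?_
        rw [two_mul]
        exact (measure_union_le _ _).trans
          (add_le_add (measure_face_le a b i _) (measure_face_le a b i _))
    _ = _ := by rw [Finset.mul_sum]

theorem surfaceMeasure_succ (Ω : Set (E (k + 1))) (A : Set (E (k + 1))) (hA : MeasurableSet A) :
    surfaceMeasure Ω A = μHE[k] (frontier Ω ∩ A) := by
  rw [surfaceMeasure, Measure.restrict_apply hA, inter_comm, Nat.add_sub_cancel]

theorem abs_apply_le_norm (z : E n) (i : Fin n) : |z i| ≤ ‖z‖ := by
  simpa using PiLp.norm_apply_le z i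

theorem closedBall_subset_box (x : E n) (r : ℝ) :
    Metric.closedBall x r ⊆ box (fun i => x i - r) (fun i => x i + r) := by
  intro y hy i
  have h := abs_apply_le_norm (y - x) i
  rw [Metric.mem_closedBall, dist_eq_norm] at hy
  rw [PiLp.sub_apply] at h
  have := abs_le.mp (h.trans hy)
  exact ⟨by linarith [this.1], by linarith [this.2]⟩

/-- The constant in the upper area growth of convex surfaces. -/
noncomputable def areaConst (n : ℕ) : ℝ≥0∞ := 2 * n * 2 ^ n

theorem areaConst_ne_top : areaConst n ≠ ⊤ :=
  ENNReal.mul_ne_top (ENNReal.mul_ne_top ENNReal.ofNat_ne_top (ENNReal.natCast_ne_top n))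
    (ENNReal.pow_ne_top ENNReal.ofNat_ne_top)

/-- The ball lies in a cube of side `2 r`, whose `n` pairs of faces have total area `2 n (2
r)^(n-1)`. The bound is uniform over convex sets. -/
theorem surfaceMeasure_closedBall_le (hn : 1 ≤ n) {Ω : Set (E n)} (ho : IsOpen Ω)
    (hc : Convex ℝ Ω) (hne : Ω.Nonempty) (x : E n) {r : ℝ} (hr : 0 ≤ r) :
    surfaceMeasure Ω (Metric.closedBall x r) ≤ areaConst n * ENNReal.ofReal (r ^ (n - 1)) := by
  obtain ⟨k, rfl⟩ : ∃ k, n = k + 1 := ⟨n - 1, by omega⟩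
  rw [surfaceMeasure_succ _ _ Metric.isClosed_closedBall.measurableSet]
  refine (measure_mono (inter_subset_inter_right _ (closedBall_subset_box x r))).trans ?_
  refine (measure_frontier_inter_box_le ho hc hne _ _).trans ?_
  have h : ∀ i : Fin (k + 1), ∏ j : Fin k, ENNReal.ofReal
      (x (i.succAbove j) + r - (x (i.succAbove j) - r)) = 2 ^ k * ENNReal.ofReal (r ^ k) := by
    intro i
    have : ∀ j : Fin k, x (i.succAbove j) + r - (x (i.succAbove j) - r) = 2 * r := fun j => by ring
    simp only [this, Finset.prod_const, Finset.card_univ, Fintype.card_fin]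
    rw [ENNReal.ofReal_mul zero_le_two, mul_pow, ENNReal.ofReal_pow hr]
    simp
  simp only [h, Finset.sum_const, Finset.card_univ, Fintype.card_fin, nsmul_eq_mul, areaConst,
    Nat.add_sub_cancel]
  rw [← mul_assoc, ← mul_assoc]
  gcongr
  · exact one_le_two
  · omega

/-- Area growth of the boundary of a convex set in a tube of radius `b` about the first axis. -/
theorem surfaceMeasure_closedBall_le_of_tube (hn : 2 ≤ n) {Ω : Set (E n)} (ho : IsOpen Ω)
    (hc : Convex ℝ Ω) (hne : Ω.Nonempty) {i₀ : Fin n} {b : ℝ} (hb : 0 ≤ b)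
    (htube : ∀ y ∈ Ω, ∀ i ≠ i₀, |y i| ≤ b) (x : E n) {r : ℝ} (hr : b ≤ r) :
    surfaceMeasure Ω (Metric.closedBall x r) ≤
      areaConst n * ENNReal.ofReal (b ^ (n - 2) * r) := by
  obtain ⟨k, rfl⟩ : ∃ k, n = k + 2 := ⟨n - 2, by omega⟩
  rw [surfaceMeasure_succ _ _ Metric.isClosed_closedBall.measurableSet]
  -- Only the direction `i₀` needs the full side `2 r`; the tube confines the other coordinates to
  -- an interval of length `2 b`.
  set a' : Fin (k + 2) → ℝ := fun i => if i = i₀ then x i - r else -b with ha'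
  set b' : Fin (k + 2) → ℝ := fun i => if i = i₀ then x i + r else b with hb'
  have hsub : frontier Ω ∩ Metric.closedBall x r ⊆ frontier Ω ∩ box a' b' := by
    rintro y ⟨hy, hyx⟩
    refine ⟨hy, fun i => ?_⟩
    by_cases hi : i = i₀
    · simp only [ha', hb', hi, if_true]
      exact closedBall_subset_box x r hyx i₀
    · simp only [ha', hb', hi, if_false]
      have hcl : closure Ω ⊆ {y : E (k + 2) | |y i| ≤ b} :=
        closure_minimal (fun y hy => htube y hy i hi)
          (isClosed_le (by fun_prop) continuous_const)
      exact abs_le.mp (hcl (frontier_subset_closure hy))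
  refine (measure_mono hsub).trans ?_
  refine (measure_frontier_inter_box_le ho hc hne _ _).trans ?_
  have h : ∀ i : Fin (k + 2), ∏ j : Fin (k + 1), ENNReal.ofReal
      (b' (i.succAbove j) - a' (i.succAbove j)) ≤ 2 ^ (k + 1) * ENNReal.ofReal (b ^ k * r) := by
    intro i
    have hr0 : 0 ≤ r := hb.trans hr
    have hle : ∀ j j₀ : Fin (k + 1), (j ≠ j₀ → i.succAbove j ≠ i₀) →
        ENNReal.ofReal (b' (i.succAbove j) - a' (i.succAbove j)) ≤
        ENNReal.ofReal (2 * if j = j₀ then r else b) := by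
      intro j j₀ hj
      apply ENNReal.ofReal_le_ofReal
      by_cases h1 : i.succAbove j = i₀
      · have h2 : j = j₀ := by by_contra h; exact hj h h1
        simp only [ha', hb']
        rw [if_pos h1, if_pos h1, if_pos h2]
        linarith
      · simp only [ha', hb', h1, if_false]
        split_ifs <;> linarith
    -- `j₀` is the long side of the face. A face orthogonal to the axis has none, and then any index
    -- will do, because `b ≤ r`.
    obtain ⟨j₀, hj₀⟩ : ∃ j₀ : Fin (k + 1), ∀ j, j ≠ j₀ → i.succAbove j ≠ i₀ := by
      rcases Fin.eq_self_or_eq_succAbove i i₀ with h | ⟨j₀, h⟩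
      · exact ⟨0, fun j _ => by rw [h]; exact Fin.succAbove_ne i j⟩
      · exact ⟨j₀, fun j hj h' => hj (Fin.succAbove_right_injective (h'.trans h))⟩
    refine (Finset.prod_le_prod' fun j _ => hle j j₀ (hj₀ j)).trans (le_of_eq ?_)
    rw [Fin.prod_univ_succAbove _ j₀]
    simp only [if_true, Fin.succAbove_ne, if_false, Finset.prod_const, Finset.card_univ,
      Fintype.card_fin]
    rw [ENNReal.ofReal_mul zero_le_two, ENNReal.ofReal_mul zero_le_two,
      ENNReal.ofReal_mul (by positivity), ENNReal.ofReal_pow hb, mul_pow, pow_succ]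
    simp only [ENNReal.ofReal_ofNat]
    ring
  calc _ ≤ 2 * ∑ i : Fin (k + 2), 2 ^ (k + 1) * ENNReal.ofReal (b ^ k * r) := by
        gcongr with i
        exact h i
    _ ≤ _ := by
        simp only [Finset.sum_const, Finset.card_univ, Fintype.card_fin, nsmul_eq_mul, areaConst,
          Nat.add_sub_cancel]
        rw [← mul_assoc, ← mul_assoc]
        gcongr
        · exact one_le_two
        · omega

theorem inter_frontier_nonempty_of_isPreconnected {X : Type*} [TopologicalSpace X] {s t : Set X}
    (hs : IsPreconnected s) (ht : IsOpen t) (h1 : (s ∩ t).Nonempty) (h2 : (s ∩ tᶜ).Nonempty) :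
    (s ∩ frontier t).Nonempty := by
  by_contra hno
  rw [not_nonempty_iff_eq_empty] at hno
  have hcl : s ∩ tᶜ ⊆ (closure t)ᶜ := by
    rintro x ⟨hx, hxt⟩ hxc
    have : x ∈ s ∩ frontier t := ⟨hx, by rw [ht.frontier_eq]; exact ⟨hxc, hxt⟩⟩
    rw [hno] at this
    exact this
  obtain ⟨x, -, hx, hx'⟩ := hs t (closure t)ᶜ ht isClosed_closure.isOpen_compl
    (fun x hx => by
      by_cases hxt : x ∈ t
      · exact Or.inl hxt
      · exact Or.inr (hcl ⟨hx, hxt⟩)) h1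
    (h2.mono fun x hx => ⟨hx.1, hcl hx⟩)
  exact hx' (subset_closure hx)

/-- Every line parallel to the first axis through the inscribed ball leaves the bounded set `Ω`, so
it meets the frontier. Hence the 1-Lipschitz projection of the frontier covers an `(n -
1)`-dimensional ball. -/
theorem surfaceMeasure_univ_pos (hn : 1 ≤ n) {Ω : Set (E n)} (ho : IsOpen Ω)
    (hb : Bornology.IsBounded Ω) {b : ℝ} (hb0 : 0 < b) (hball : Metric.ball 0 b ⊆ Ω) :
    surfaceMeasure Ω univ ≠ 0 := by
  obtain ⟨k, rfl⟩ : ∃ k, n = k + 1 := ⟨n - 1, by omega⟩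
  rw [surfaceMeasure_succ _ _ MeasurableSet.univ, inter_univ]
  set p : E (k + 1) → E k := fun y => WithLp.toLp 2 fun j => y ((0 : Fin (k + 1)).succAbove j)
  have hp : LipschitzOnWith 1 p (frontier Ω) := by
    refine LipschitzOnWith.of_dist_le_mul fun y _ z _ => ?_
    rw [NNReal.coe_one, one_mul, EuclideanSpace.dist_eq, EuclideanSpace.dist_eq,
      Fin.sum_univ_succAbove _ (0 : Fin (k + 1))]
    apply Real.sqrt_le_sqrt
    simp only [p]
    exact le_add_of_nonneg_left (by positivity)
  have hsub : Metric.ball 0 b ⊆ p '' frontier Ω := by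
    intro z hz
    have hline : Continuous fun s : ℝ => insertCoord (0 : Fin (k + 1)) s z := by
      have : (fun s : ℝ => insertCoord (0 : Fin (k + 1)) s z) =
          fun s => insertCoord 0 0 z + s • EuclideanSpace.single 0 1 := by
        ext s j
        rcases Fin.eq_self_or_eq_succAbove 0 j with rfl | ⟨j, rfl⟩
        · simp
        · rw [PiLp.add_apply, insertCoord_succAbove, insertCoord_succAbove]
          simp
      rw [this]
      fun_prop
    have hconn : IsPreconnected (range fun s : ℝ => insertCoord (0 : Fin (k + 1)) s z) :=
      isPreconnected_range hline
    obtain ⟨R, hR⟩ := hb.subset_closedBall (0 : E (k + 1))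
    obtain ⟨y, ⟨s, rfl⟩, hy⟩ := inter_frontier_nonempty_of_isPreconnected hconn ho ⟨insertCoord 0 0 z, ⟨0, rfl⟩, hball (by
        rw [Metric.mem_ball, dist_zero_right] at hz ⊢
        convert! hz using 1
        rw [EuclideanSpace.norm_eq, EuclideanSpace.norm_eq, Fin.sum_univ_succAbove _ 0]
        simp only [insertCoord_succAbove, insertCoord_same]
        simp)⟩
      ⟨insertCoord 0 (|R| + 1) z, ⟨|R| + 1, rfl⟩, fun hmem => by
        have h1 := hR hmem
        rw [Metric.mem_closedBall, dist_zero_right] at h1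
        have h2 := abs_apply_le_norm (insertCoord 0 (|R| + 1) z) 0
        rw [insertCoord_same, abs_of_nonneg (by positivity)] at h2
        linarith [le_abs_self R]⟩
    refine ⟨_, hy, ?_⟩
    ext j
    exact insertCoord_succAbove 0 s z j
  have hpos : 0 < volume (Metric.ball (0 : E k) b) := Metric.measure_ball_pos _ _ hb0
  rw [← EuclideanSpace.euclideanHausdorffMeasure_eq_volume] at hpos
  exact (hpos.trans_le ((measure_mono hsub).trans (euclideanHausdorffMeasure_image_le k hp))).ne'

/-! ### The trace inequality. -/

theorem eLpNorm_two_sq {α F : Type*} [MeasurableSpace α] [NormedAddCommGroup F] (f : α → F)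
    (m : Measure α) : eLpNorm f 2 m ^ 2 = ∫⁻ x, ‖f x‖ₑ ^ 2 ∂m := by
  have h := eLpNorm_nnreal_pow_eq_lintegral (f := f) (μ := m) (p := 2) two_ne_zero
  simpa using h

theorem eLpNorm_two_le_of_lintegral_le {α β F F' : Type*} [MeasurableSpace α] [MeasurableSpace β]
    [NormedAddCommGroup F] [NormedAddCommGroup F'] {f : α → F} {g : β → F'} {m : Measure α}
    {ν : Measure β} {c : ℝ≥0∞}
    (h : ∫⁻ x, ‖f x‖ₑ ^ 2 ∂m ≤ c ^ 2 * ∫⁻ x, ‖g x‖ₑ ^ 2 ∂ν) :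
    eLpNorm f 2 m ≤ c * eLpNorm g 2 ν := by
  rw [← eLpNorm_two_sq, ← eLpNorm_two_sq, ← mul_pow] at h
  exact (ENNReal.pow_le_pow_left_iff two_ne_zero).mp h

theorem lintegral_truncKer_ofReal (p : ℕ) (m : Measure (E n)) (x : E n) {D : ℝ} (hD : 0 ≤ D) :
    ∫⁻ y, truncKer p (ENNReal.ofReal D) x y ∂m =
      ∫⁻ y in Metric.closedBall x D, powKer p (y - x) ∂m := by
  rw [← lintegral_indicator Metric.isClosed_closedBall.measurableSet]
  refine lintegral_congr fun y => ?_
  have hmem : ‖y - x‖ₑ ≤ ENNReal.ofReal D ↔ y ∈ Metric.closedBall x D := by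
    rw [← ofReal_norm, ENNReal.ofReal_le_ofReal_iff hD, Metric.mem_closedBall, dist_eq_norm]
  by_cases h : y ∈ Metric.closedBall x D
  · rw [indicator_of_mem h, truncKer, indicator_of_mem (by exact hmem.2 h)]
  · rw [indicator_of_notMem h, truncKer]
    exact indicator_of_notMem (s := {z : E n | ‖z‖ₑ ≤ ENNReal.ofReal D})
      (fun h' => h (hmem.1 h')) (powKer p)

/-- Growth is needed only at small scales: outside the unit ball the kernel is at most one and the
total mass takes over. -/
theorem lintegral_powKer_le_of_growth (hn : 2 ≤ n) {m : Measure (E n)} {A : ℝ≥0∞} (hA : A ≠ ⊤)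
    (h : ∀ x r, 0 < r → r ≤ 1 → m (Metric.closedBall x r) ≤ A * ENNReal.ofReal (r ^ (n - 1)))
    (x : E n) :
    ∫⁻ y, powKer (n - 2) (y - x) ∂m ≤ A * 2 ^ (n - 1) + m univ := by
  rw [← lintegral_add_compl _ (Metric.isClosed_closedBall (x := x) (ε := 1)).measurableSet]
  have e : n - 2 + 1 = n - 1 := by omega
  gcongr
  · have := lintegral_powKer_closedBall_le (m := m) (p := n - 2) hA one_pos (x := x)
      (by rw [e]; exact h x)
    rw [e, mul_one, ENNReal.ofReal_pow zero_le_two] at this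
    simpa using this
  · have := setLIntegral_powKer_compl_closedBall_le (n - 2) m x one_pos
      (s := (Metric.closedBall x 1)ᶜ) (t := univ) (by rw [compl_eq_univ_sdiff])
    simpa using this

/-- Potential form of the trace inequality, for a measure not charging the convex set. -/
theorem trace_inequality (hn : 3 ≤ n) {Ω : Set (E n)} (ho : IsOpen Ω) (hc : Convex ℝ Ω)
    (hne : Ω.Nonempty) {m : Measure (E n)} [IsFiniteMeasure m] (hm : m Ω = 0) {M : ℝ≥0∞}
    (hM : ∀ x, ∫⁻ y, powKer (n - 2) (y - x) ∂m ≤ M) {φ : E n → ℝ} (hφ : IsTestFunction φ) :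
    ∫⁻ x, ‖φ x‖ₑ ^ 2 ∂m ≤
      potConst n ^ 2 * compConst n * M * ∫⁻ z in ext Ω, ‖∇ φ z‖ₑ ^ 2 := by
  have hφ1 : ContDiff ℝ 1 φ := hφ.1.of_le (by exact_mod_cast le_top)
  have hG : Measurable ((ext Ω).indicator fun z => ‖∇ φ z‖ₑ) :=
    ((continuous_gradient hφ1).measurable.enorm).indicator (isOpen_ext Ω).measurableSet
  -- Finiteness, known a priori for test functions, is what the cancellation in the duality argument
  -- requires.
  have hfin : ∫⁻ x, ‖φ x‖ₑ ^ 2 ∂m ≠ ⊤ := by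
    rw [← eLpNorm_two_sq]
    exact ENNReal.pow_ne_top
      (hφ1.continuous.memLp_of_hasCompactSupport hφ.2 (p := 2) (μ := m)).eLpNorm_ne_top
  have := lintegral_sq_le_of_le_potential hn m (h := fun x => ‖φ x‖ₑ)
    hφ1.continuous.measurable.enorm hG potConst_ne_top (D := ⊤) (M := M)
    (by
      filter_upwards [compl_mem_ae_iff.mpr hm] with x hx
      exact enorm_le_potential (by omega) ho hc hne hφ1 hφ.2 hx)
    (by
      intro x
      rw [ENNReal.mul_top two_ne_zero]
      simp only [truncKer_top]
      exact hM x) hfin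
  refine this.trans (le_of_eq ?_)
  congr 1
  rw [← lintegral_indicator (isOpen_ext Ω).measurableSet]
  refine lintegral_congr fun z => ?_
  by_cases hz : z ∈ ext Ω
  · rw [indicator_of_mem hz, indicator_of_mem hz]
  · rw [indicator_of_notMem hz, indicator_of_notMem hz]; simp

/-! ### Exterior cones and averages near the boundary. -/

/-- Points in a cone issuing from `x` away from a ball inside the convex set lie outside. -/
theorem segment_subset_ext {Ω : Set (E n)} (ho : IsOpen Ω) (hc : Convex ℝ Ω) {b : ℝ}
    (hball : Metric.ball 0 b ⊆ Ω) {x y : E n} (hx : x ∉ Ω) {s : ℝ} (hs : 0 < s)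
    (hy : ‖y - (1 + s) • x‖ < s * b) {t : ℝ} (ht : 0 < t) : x + t • (y - x) ∈ ext Ω := by
  intro hcl
  -- `z` continues the segment from `y` beyond `x` into the inscribed ball. Were a point on the
  -- other side of `x` in the closure, `x` would lie strictly between it and an interior point,
  -- hence in `Ω`.
  set z : E n := x - s⁻¹ • (y - x) with hz
  have hzΩ : z ∈ interior Ω := by
    rw [ho.interior_eq]
    apply hball
    have e : z = -(s⁻¹ • (y - (1 + s) • x)) := by
      rw [hz, add_smul, one_smul, ← sub_sub, smul_sub s⁻¹ (y - x), smul_smul,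
        inv_mul_cancel₀ hs.ne', one_smul]
      abel
    rw [Metric.mem_ball, dist_zero_right, e, norm_neg, norm_smul, Real.norm_of_nonneg (by positivity),
      inv_mul_lt_iff₀ hs]
    exact hy
  apply hx
  have := hc.openSegment_interior_closure_subset_interior hzΩ hcl
  rw [ho.interior_eq] at this
  apply this
  have hts : 0 < 1 + t * s := by positivity
  refine ⟨t * s / (1 + t * s), 1 / (1 + t * s), by positivity, by positivity, ?_, ?_⟩
  · field_simp; ring
  · rw [hz]
    have h1 : t * s / (1 + t * s) + 1 / (1 + t * s) = 1 := by field_simp; ring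
    have h2 : t * s / (1 + t * s) * s⁻¹ = 1 / (1 + t * s) * t := by field_simp
    have h3 : ∀ p q r : E n, p - r + (q + r) = p + q := by intro p q r; abel
    rw [smul_sub, smul_add, smul_smul, smul_smul, h2, h3, ← add_smul, h1, one_smul]

theorem surfaceMeasure_compl_frontier (Ω : Set (E n)) : surfaceMeasure Ω (frontier Ω)ᶜ = 0 := by
  rw [surfaceMeasure, Measure.restrict_apply isClosed_frontier.measurableSet.compl]
  simp

theorem ae_mem_frontier (Ω : Set (E n)) : ∀ᵐ x ∂(surfaceMeasure Ω), x ∈ frontier Ω :=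
  surfaceMeasure_compl_frontier Ω

theorem isFiniteMeasure_surfaceMeasure (hn : 1 ≤ n) {Ω : Set (E n)} (ho : IsOpen Ω)
    (hc : Convex ℝ Ω) (hne : Ω.Nonempty) (hb : Bornology.IsBounded Ω) :
    IsFiniteMeasure (surfaceMeasure Ω) := by
  obtain ⟨R, hR⟩ := hb.closure.subset_closedBall (0 : E n)
  constructor
  have h1 : surfaceMeasure Ω univ ≤ surfaceMeasure Ω (Metric.closedBall 0 |R|) := by
    refine measure_mono_ae ?_
    filter_upwards [ae_mem_frontier Ω] with x hx _
    exact Metric.closedBall_subset_closedBall (le_abs_self R) (hR (frontier_subset_closure hx))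
  refine (h1.trans (surfaceMeasure_closedBall_le hn ho hc hne 0 (abs_nonneg R))).trans_lt ?_
  exact (ENNReal.mul_ne_top areaConst_ne_top ENNReal.ofReal_ne_top).lt_top

theorem surfaceMeasure_self (Ω : Set (E n)) (ho : IsOpen Ω) : surfaceMeasure Ω Ω = 0 := by
  have h : Ω ⊆ (frontier Ω)ᶜ := fun x hx hx' => frontier_notMem ho hx' hx
  exact measure_mono_null h (surfaceMeasure_compl_frontier Ω)

/-- The average of a function over a ball near the boundary point `x`, outside the convex set. -/
noncomputable def coneAvg (b s : ℝ) (x : E n) (φ : E n → ℝ) : ℝ :=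
  ⨍ y in Metric.ball ((1 + s) • x) (s * b / 2), φ y

/-- The short-range counterpart of the trace inequality, and the source of compactness. Only
segments of length at most `s (a + b)` occur, so the truncated potential of the surface measure is
`O(s)`. The simple function `p` reduces the comparison to finitely many averages. -/
theorem lintegral_sub_coneAvg_le (hn : 3 ≤ n) {Ω : Set (E n)} (ho : IsOpen Ω) (hc : Convex ℝ Ω)
    {a b : ℝ} (hb : 0 < b) (ha : 0 < a) (hball : Metric.ball 0 b ⊆ Ω)
    (hbd : Ω ⊆ Metric.closedBall 0 a) {s : ℝ} (hs : 0 < s) (hs1 : s ≤ 1)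
    {p : SimpleFunc (E n) (E n)} (hp : ∀ x ∈ frontier Ω, dist (p x) x ≤ s * b / 4)
    {φ : E n → ℝ} (hφ : IsTestFunction φ) :
    ∫⁻ x, ‖φ x - coneAvg b s (p x) φ‖ₑ ^ 2 ∂(surfaceMeasure Ω) ≤
      ((ballVol n)⁻¹ * ENNReal.ofReal ((2 * (a + b) / b) ^ n / n)) ^ 2 * compConst n *
        (areaConst n * ENNReal.ofReal (2 ^ (n - 1) * (2 * (s * (a + b))))) *
          ∫⁻ z in ext Ω, ‖∇ φ z‖ₑ ^ 2 := by
  have hne : Ω.Nonempty := ⟨0, hball (by simpa using hb)⟩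
  have hφ1 : ContDiff ℝ 1 φ := hφ.1.of_le (by exact_mod_cast le_top)
  have hD : 0 < s * (a + b) := by positivity
  have hG : Measurable ((ext Ω).indicator fun z => ‖∇ φ z‖ₑ) :=
    ((continuous_gradient hφ1).measurable.enorm).indicator (isOpen_ext Ω).measurableSet
  have hgrow : ∀ (x : E n) (r : ℝ), 0 < r →
      surfaceMeasure Ω (Metric.closedBall x r) ≤ areaConst n * ENNReal.ofReal (r ^ (n - 1)) :=
    fun x r hr => surfaceMeasure_closedBall_le (by omega) ho hc hne x hr.le
  have : IsFiniteMeasure (surfaceMeasure Ω) :=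
    isFiniteMeasure_surfaceMeasure (by omega) ho hc hne
      (Metric.isBounded_closedBall.subset hbd)
  have hh : Measurable fun x => ‖φ x - coneAvg b s (p x) φ‖ₑ :=
    (hφ1.continuous.measurable.sub (p.map fun y => coneAvg b s y φ).measurable).enorm
  have hfin : ∫⁻ x, ‖φ x - coneAvg b s (p x) φ‖ₑ ^ 2 ∂(surfaceMeasure Ω) ≠ ⊤ := by
    rw [← eLpNorm_two_sq]
    have h1 : MemLp φ 2 (surfaceMeasure Ω) := hφ1.continuous.memLp_of_hasCompactSupport hφ.2
    have h2 : MemLp (p.map fun y => coneAvg b s y φ) 2 (surfaceMeasure Ω) :=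
      SimpleFunc.memLp_of_isFiniteMeasure _ _ _
    exact ENNReal.pow_ne_top (h1.sub h2).eLpNorm_ne_top
  -- Both the averaging ball and the segment length are proportional to `s`, so the prefactor is
  -- independent of `s`.
  have hconst : ∀ q : E n, (volume (Metric.ball q (s * b / 2)))⁻¹ *
      ENNReal.ofReal ((s * (a + b)) ^ n / n) =
      (ballVol n)⁻¹ * ENNReal.ofReal ((2 * (a + b) / b) ^ n / n) := by
    intro q
    have hp0 : 0 < (s * b / 2) ^ n := by positivity
    rw [volume_ball_eq _ (by positivity), ENNReal.mul_inv (Or.inl ballVol_ne_zero)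
      (Or.inl ballVol_ne_top), mul_assoc, ← ENNReal.ofReal_inv_of_pos hp0,
      ← ENNReal.ofReal_mul (by positivity)]
    congr 2
    rw [← mul_div_assoc, ← inv_pow, ← mul_pow]
    congr 2
    field_simp
  have hcl : frontier Ω ⊆ Metric.closedBall 0 a :=
    frontier_subset_closure.trans (closure_minimal hbd Metric.isClosed_closedBall)
  have hmain := lintegral_sq_le_of_le_potential hn (surfaceMeasure Ω) hh hG
    (C := (ballVol n)⁻¹ * ENNReal.ofReal ((2 * (a + b) / b) ^ n / n))
    (M := areaConst n * ENNReal.ofReal (2 ^ (n - 1) * (2 * (s * (a + b)))))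
    (D := ENNReal.ofReal (s * (a + b)))
    (ENNReal.mul_ne_top (ENNReal.inv_ne_top.mpr ballVol_ne_zero) ENNReal.ofReal_ne_top)
    (by
      filter_upwards [ae_mem_frontier Ω] with x hx
      have hpx := hp x hx
      have hxa : ‖x‖ ≤ a := by simpa using hcl hx
      -- The quantisation moves the centre by at most `(1 + s) s b / 4 ≤ s b / 2`, by `s ≤ 1`; with
      -- the radius `s b / 2` the total stays below `s b`.
      have hnear : ∀ y ∈ Metric.ball ((1 + s) • p x) (s * b / 2),
          ‖y - (1 + s) • x‖ < s * b := by
        intro y hy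
        rw [Metric.mem_ball, dist_eq_norm] at hy
        rw [dist_eq_norm] at hpx
        have e : y - (1 + s) • x = (y - (1 + s) • p x) + (1 + s) • (p x - x) := by
          rw [smul_sub]; abel
        rw [e]
        refine (norm_add_le _ _).trans_lt ?_
        rw [norm_smul, Real.norm_of_nonneg (by positivity)]
        nlinarith [norm_nonneg (p x - x), mul_pos hs hb]
      rw [← hconst ((1 + s) • p x)]
      refine enorm_sub_average_le (by omega) hφ1 hD (isOpen_ext Ω).measurableSet
        measurableSet_ball (fun y hy => ?_) (fun y hy t ht => ?_)
        (Metric.measure_ball_pos _ _ (by positivity)).ne'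
      · rw [Metric.mem_closedBall, dist_eq_norm]
        have e : y - x = (y - (1 + s) • x) + s • x := by
          rw [add_smul, one_smul]; abel
        rw [e]
        refine (norm_add_le _ _).trans ?_
        rw [norm_smul, Real.norm_of_nonneg hs.le]
        nlinarith [hnear y hy]
      · exact segment_subset_ext ho hc hball (frontier_notMem ho hx) hs (hnear y hy) ht.1)
    (by
      intro x
      have e1 : 2 * ENNReal.ofReal (s * (a + b)) = ENNReal.ofReal (2 * (s * (a + b))) := by
        rw [ENNReal.ofReal_mul zero_le_two, ENNReal.ofReal_ofNat]
      have e2 : n - 2 + 1 = n - 1 := by omega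
      rw [e1, lintegral_truncKer_ofReal _ _ _ (by positivity)]
      have := lintegral_powKer_closedBall_le (m := surfaceMeasure Ω) (p := n - 2) (x := x)
        areaConst_ne_top (R := 2 * (s * (a + b))) (by positivity)
        (fun r hr _ => by rw [e2]; exact hgrow x r hr)
      rwa [e2] at this) hfin
  refine hmain.trans (le_of_eq ?_)
  congr 1
  rw [← lintegral_indicator (isOpen_ext Ω).measurableSet]
  refine lintegral_congr fun z => ?_
  by_cases hz : z ∈ ext Ω
  · rw [indicator_of_mem hz, indicator_of_mem hz]
  · rw [indicator_of_notMem hz, indicator_of_notMem hz]; simp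

/-! ### Test functions as a vector space with boundary and Dirichlet norms. -/

namespace IsTestFunction

variable {φ ψ : E n → ℝ}

theorem contDiff_one (hφ : IsTestFunction φ) : ContDiff ℝ 1 φ :=
  hφ.1.of_le (by exact_mod_cast le_top)

theorem differentiable (hφ : IsTestFunction φ) : Differentiable ℝ φ :=
  hφ.contDiff_one.differentiable one_ne_zero

theorem add (hφ : IsTestFunction φ) (hψ : IsTestFunction ψ) : IsTestFunction (φ + ψ) :=
  ⟨hφ.1.add hψ.1, hφ.2.add hψ.2⟩

theorem smul (c : ℝ) (hφ : IsTestFunction φ) : IsTestFunction (c • φ) :=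
  ⟨hφ.1.const_smul c, hφ.2.smul_left (f := fun _ => c)⟩

theorem zero : IsTestFunction (0 : E n → ℝ) := ⟨contDiff_const, HasCompactSupport.zero⟩

theorem continuous (hφ : IsTestFunction φ) : Continuous φ := hφ.1.continuous

theorem memLp (hφ : IsTestFunction φ) (m : Measure (E n)) [IsFiniteMeasureOnCompacts m]
    (p : ℝ≥0∞) : MemLp φ p m :=
  hφ.continuous.memLp_of_hasCompactSupport hφ.2

theorem integrable (hφ : IsTestFunction φ) (m : Measure (E n)) [IsFiniteMeasureOnCompacts m] :
    Integrable φ m :=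
  memLp_one_iff_integrable.mp (hφ.memLp m 1)

theorem hasCompactSupport_gradient (hφ : IsTestFunction φ) : HasCompactSupport (∇ φ) :=
  (hφ.2.fderiv ℝ).comp_left (g := (InnerProductSpace.toDual ℝ (E n)).symm) (map_zero _)

theorem memLp_gradient (hφ : IsTestFunction φ) (m : Measure (E n)) [IsFiniteMeasureOnCompacts m]
    (p : ℝ≥0∞) : MemLp (∇ φ) p m :=
  (continuous_gradient hφ.contDiff_one).memLp_of_hasCompactSupport hφ.hasCompactSupport_gradient

theorem gradient_add (hφ : IsTestFunction φ) (hψ : IsTestFunction ψ) :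
    ∇ (φ + ψ) = ∇ φ + ∇ ψ := by
  ext1 x
  simp only [gradient, Pi.add_apply]
  rw [fderiv_add (hφ.differentiable x) (hψ.differentiable x), map_add]

theorem gradient_smul (c : ℝ) (hφ : IsTestFunction φ) : ∇ (c • φ) = c • ∇ φ := by
  ext1 x
  simp only [gradient, Pi.smul_apply]
  rw [fderiv_const_smul (hφ.differentiable x), map_smulₛₗ]
  simp

end IsTestFunction

/-- The space of test functions. -/
def testFunctions (n : ℕ) : Submodule ℝ (E n → ℝ) where
  carrier := {φ | IsTestFunction φ}
  add_mem' := IsTestFunction.add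
  zero_mem' := IsTestFunction.zero
  smul_mem' c _ h := h.smul c

/-- Test functions as elements of `L²(m)`. -/
noncomputable def restrictL2 (m : Measure (E n)) [IsFiniteMeasureOnCompacts m] :
    testFunctions n →ₗ[ℝ] Lp ℝ 2 m where
  toFun φ := (φ.2.memLp m 2).toLp φ.1
  map_add' _ _ := MemLp.toLp_add _ _
  map_smul' _ _ := MemLp.toLp_const_smul _ _

/-- Gradients of test functions as elements of `L²(m)`. -/
noncomputable def gradientL2 (m : Measure (E n)) [IsFiniteMeasureOnCompacts m] :
    testFunctions n →ₗ[ℝ] Lp (E n) 2 m where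
  toFun φ := (φ.2.memLp_gradient m 2).toLp (∇ φ.1)
  map_add' φ ψ := by
    rw [← MemLp.toLp_add]
    exact MemLp.toLp_congr _ _ (by rw [← IsTestFunction.gradient_add φ.2 ψ.2]; rfl)
  map_smul' c φ := by
    rw [RingHom.id_apply, ← MemLp.toLp_const_smul]
    exact MemLp.toLp_congr _ _ (by rw [← IsTestFunction.gradient_smul c φ.2]; rfl)

theorem norm_restrictL2 (m : Measure (E n)) [IsFiniteMeasureOnCompacts m]
    (φ : testFunctions n) : ‖restrictL2 m φ‖ = (eLpNorm φ.1 2 m).toReal :=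
  Lp.norm_toLp φ.1 (φ.2.memLp m 2)

theorem norm_gradientL2 (m : Measure (E n)) [IsFiniteMeasureOnCompacts m]
    (φ : testFunctions n) : ‖gradientL2 m φ‖ = (eLpNorm (∇ φ.1) 2 m).toReal :=
  Lp.norm_toLp (∇ φ.1) (φ.2.memLp_gradient m 2)

theorem toReal_eLpNorm_le {α β F F' : Type*} [MeasurableSpace α] [MeasurableSpace β]
    [NormedAddCommGroup F] [NormedAddCommGroup F'] {f : α → F} {g : β → F'} {m : Measure α}
    {ν : Measure β} {c : ℝ} (hc : 0 ≤ c) (hg : MemLp g 2 ν)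
    (h : ∫⁻ x, ‖f x‖ₑ ^ 2 ∂m ≤ ENNReal.ofReal (c ^ 2) * ∫⁻ x, ‖g x‖ₑ ^ 2 ∂ν) :
    (eLpNorm f 2 m).toReal ≤ c * (eLpNorm g 2 ν).toReal := by
  rw [ENNReal.ofReal_pow hc] at h
  have h1 := eLpNorm_two_le_of_lintegral_le h
  have h2 := ENNReal.toReal_mono (ENNReal.mul_ne_top ENNReal.ofReal_ne_top hg.eLpNorm_ne_top) h1
  rwa [ENNReal.toReal_mul, ENNReal.toReal_ofReal hc] at h2

/-- Lowering the exponent from `n` to `n - 1` for `r ≤ 1` gives Lebesgue measure the growth of a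
surface, so the same trace inequality yields local bounds. -/
theorem volume_restrict_closedBall_growth (hn : 1 ≤ n) (Q : Set (E n)) (x : E n) (r : ℝ)
    (hr : 0 < r) (hr1 : r ≤ 1) :
    volume.restrict Q (Metric.closedBall x r) ≤ ballVol n * ENNReal.ofReal (r ^ (n - 1)) := by
  refine (Measure.restrict_apply_le _ _).trans ?_
  rw [volume_closedBall_eq x hr.le]
  refine mul_le_mul_right (ENNReal.ofReal_le_ofReal ?_) _
  exact pow_le_pow_of_le_one hr.le hr1 (by omega)

/-! ### Compactness of the trace and existence of extremals. -/

/-- Local `L²` bound of test functions outside a convex set by the Dirichlet norm. -/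
theorem exists_setLIntegral_sq_le (hn : 3 ≤ n) {Ω : Set (E n)} (ho : IsOpen Ω) (hc : Convex ℝ Ω)
    (hne : Ω.Nonempty) {Q : Set (E n)} (hQ : Bornology.IsBounded Q)
    (hQΩ : Disjoint Q Ω) :
    ∃ c : ℝ, 0 ≤ c ∧ ∀ φ : E n → ℝ, IsTestFunction φ →
      ∫⁻ x in Q, ‖φ x‖ₑ ^ 2 ≤ ENNReal.ofReal (c ^ 2) * ∫⁻ z in ext Ω, ‖∇ φ z‖ₑ ^ 2 := by
  have hfin : volume Q < ⊤ := hQ.measure_lt_top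
  have : IsFiniteMeasure (volume.restrict Q) := ⟨by simpa using hfin⟩
  have h0 : volume.restrict Q Ω = 0 := by
    rw [Measure.restrict_apply ho.measurableSet, inter_comm, hQΩ.inter_eq, measure_empty]
  have hM := lintegral_powKer_le_of_growth (by omega) (m := volume.restrict Q) ballVol_ne_top
    (volume_restrict_closedBall_growth (by omega) Q)
  set B : ℝ≥0∞ := potConst n ^ 2 * compConst n *
    (ballVol n * 2 ^ (n - 1) + volume.restrict Q univ)
  have hB : B ≠ ⊤ := by
    refine ENNReal.mul_ne_top (ENNReal.mul_ne_top (ENNReal.pow_ne_top potConst_ne_top)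
      compConst_ne_top) (ENNReal.add_ne_top.mpr ⟨ENNReal.mul_ne_top ballVol_ne_top
        (ENNReal.pow_ne_top ENNReal.ofNat_ne_top), measure_ne_top _ _⟩)
  refine ⟨√B.toReal, Real.sqrt_nonneg _, fun φ hφ => ?_⟩
  rw [Real.sq_sqrt ENNReal.toReal_nonneg, ENNReal.ofReal_toReal hB]
  exact trace_inequality hn ho hc hne h0 hM hφ

theorem enorm_setAverage_le (Q : Set (E n)) {φ : E n → ℝ} (hφ : Measurable φ)
    (hQ0 : volume Q ≠ 0) (hQ : volume Q ≠ ⊤) :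
    ‖⨍ y in Q, φ y‖ₑ ^ 2 ≤ (volume Q)⁻¹ * ∫⁻ x in Q, ‖φ x‖ₑ ^ 2 := by
  have hinv : ‖(volume.real Q)⁻¹‖ₑ = (volume Q)⁻¹ := by
    have hp : 0 < volume.real Q := ENNReal.toReal_pos hQ0 hQ
    rw [Real.enorm_of_nonneg (by positivity), ENNReal.ofReal_inv_of_pos hp, measureReal_def,
      ENNReal.ofReal_toReal hQ]
  have h1 := lintegral_mul_sq_le (volume.restrict Q) hφ.enorm.aemeasurable
    (measurable_const (a := (1 : ℝ≥0∞))).aemeasurable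
  simp only [mul_one, one_pow, lintegral_const, Measure.restrict_apply_univ, one_mul] at h1
  rw [setAverage_eq, enorm_smul, hinv, mul_pow]
  calc (volume Q)⁻¹ ^ 2 * ‖∫ y in Q, φ y‖ₑ ^ 2
      ≤ (volume Q)⁻¹ ^ 2 * ((∫⁻ x in Q, ‖φ x‖ₑ ^ 2) * volume Q) := by
        gcongr
        exact le_trans (by gcongr; exact enorm_integral_le_lintegral_enorm _) h1
    _ = _ := by
        rw [sq, mul_comm _ (volume Q), mul_mul_mul_comm, ENNReal.inv_mul_cancel hQ0 hQ, one_mul]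

/-- The functional `coneAvg` on test functions. -/
noncomputable def coneAvgFunctional (b s : ℝ) (x : E n) : testFunctions n →ₗ[ℝ] ℝ where
  toFun φ := coneAvg b s x φ.1
  map_add' φ ψ := by
    simp only [coneAvg, setAverage_eq]
    rw [← smul_add, ← integral_add]
    · rfl
    · exact (φ.2.integrable volume).integrableOn
    · exact (ψ.2.integrable volume).integrableOn
  map_smul' c φ := by
    simp only [coneAvg, setAverage_eq, RingHom.id_apply]
    rw [smul_comm c]
    congr 1
    exact integral_smul c _

/-- The averaging ball lies in the exterior, where the local bound applies. Continuity in the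
Dirichlet norm lets the finite rank approximants extend to the energy space. -/
theorem exists_norm_coneAvg_le (hn : 3 ≤ n) {Ω : Set (E n)} (ho : IsOpen Ω) (hc : Convex ℝ Ω)
    {b s : ℝ} (hb : 0 < b) (hs : 0 < s) (hball : Metric.ball 0 b ⊆ Ω) {x : E n} (hx : x ∉ Ω) :
    ∃ c, ∀ φ, ‖coneAvgFunctional b s x φ‖ ≤ c * ‖gradientL2 (volume.restrict (ext Ω)) φ‖ := by
  have hne : Ω.Nonempty := ⟨0, hball (by simpa using hb)⟩
  set Q := Metric.ball ((1 + s) • x) (s * b / 2)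
  have hQext : Q ⊆ ext Ω := by
    intro y hy
    rw [Metric.mem_ball, dist_eq_norm] at hy
    have := segment_subset_ext ho hc hball hx hs (y := y) (by nlinarith [mul_pos hs hb]) one_pos
    rwa [one_smul, add_sub_cancel] at this
  obtain ⟨c, hc0, hcb⟩ := exists_setLIntegral_sq_le hn ho hc hne (Q := Q) Metric.isBounded_ball
    (Set.disjoint_left.mpr fun y hy hyΩ => hQext hy (subset_closure hyΩ))
  have hQ0 : volume Q ≠ 0 := (Metric.measure_ball_pos _ _ (by positivity)).ne'
  have hQ : volume Q ≠ ⊤ := measure_ball_lt_top.ne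
  set v := (volume Q)⁻¹.toReal
  refine ⟨√(v * c ^ 2), fun φ => ?_⟩
  rw [norm_gradientL2]
  have key := (enorm_setAverage_le Q φ.2.continuous.measurable hQ0 hQ).trans
    (mul_le_mul_right (hcb φ.1 φ.2) _)
  have hv : (volume Q)⁻¹ = ENNReal.ofReal v :=
    (ENNReal.ofReal_toReal (ENNReal.inv_ne_top.mpr hQ0)).symm
  rw [hv, ← mul_assoc, ← ENNReal.ofReal_mul ENNReal.toReal_nonneg, ← eLpNorm_two_sq,
    ← Real.sq_sqrt (x := v * c ^ 2) (by positivity), ENNReal.ofReal_pow (Real.sqrt_nonneg _),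
    ← mul_pow] at key
  have h2 := (ENNReal.pow_le_pow_left_iff two_ne_zero).mp key
  have h3 := ENNReal.toReal_mono (ENNReal.mul_ne_top ENNReal.ofReal_ne_top
    (φ.2.memLp_gradient _ 2).eLpNorm_ne_top) h2
  rwa [ENNReal.toReal_mul, ENNReal.toReal_ofReal (Real.sqrt_nonneg _), toReal_enorm] at h3

/-- A compact set is finely quantised by a simple function with values in the set. -/
theorem exists_simpleFunc_dist_le {K : Set (E n)} (hK : IsCompact K) (hne : K.Nonempty) {r : ℝ}
    (hr : 0 < r) : ∃ p : SimpleFunc (E n) (E n), (∀ x, p x ∈ K) ∧ ∀ x ∈ K, dist (p x) x ≤ r := by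
  have : Nonempty K := hne.to_subtype
  let e : ℕ → E n := fun k => (TopologicalSpace.denseSeq K k : E n)
  have hcover : K ⊆ ⋃ k, Metric.ball (e k) r := by
    intro x hx
    obtain ⟨k, hk⟩ := (TopologicalSpace.denseRange_denseSeq K).exists_dist_lt ⟨x, hx⟩ hr
    exact mem_iUnion.mpr ⟨k, hk⟩
  obtain ⟨t, ht⟩ := hK.elim_finite_subcover _ (fun _ => Metric.isOpen_ball) hcover
  obtain ⟨N, hN⟩ := t.exists_nat_subset_range
  refine ⟨SimpleFunc.nearestPt e N, fun x => Subtype.coe_prop _, fun x hx => ?_⟩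
  obtain ⟨k, hk, hxk⟩ := mem_iUnion₂.mp (ht hx)
  have h1 := SimpleFunc.edist_nearestPt_le e x (Finset.mem_range.mp (hN hk)).le
  rw [edist_dist, edist_dist, ENNReal.ofReal_le_ofReal_iff dist_nonneg] at h1
  rw [Metric.mem_ball, dist_comm] at hxk
  exact h1.trans hxk.le

theorem exists_isTestFunction_eq_one (R : ℝ) :
    ∃ φ : E n → ℝ, IsTestFunction φ ∧ ∀ x ∈ Metric.closedBall 0 R, φ x = 1 := by
  let f : ContDiffBump (0 : E n) := ⟨|R| + 1, |R| + 2, by positivity, by linarith⟩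
  refine ⟨f, ⟨f.contDiff, f.hasCompactSupport⟩, fun x hx => f.one_of_mem_closedBall ?_⟩
  exact Metric.closedBall_subset_closedBall (by linarith [le_abs_self R] : R ≤ |R| + 1) hx

/-- `L²(∂Ω)` restriction of test functions is approximated by finite rank operators. -/
theorem exists_finite_rank_approx (hn : 3 ≤ n) {Ω : Set (E n)} (ho : IsOpen Ω)
    (hc : Convex ℝ Ω) {a b : ℝ} (hb : 0 < b) (ha : 0 < a) (hball : Metric.ball 0 b ⊆ Ω)
    (hbd : Ω ⊆ Metric.closedBall 0 a) [IsFiniteMeasure (surfaceMeasure Ω)] {ε : ℝ} (hε : 0 < ε) :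
    ∃ (ι : Type) (_ : Fintype ι) (l : ι → (testFunctions n →ₗ[ℝ] ℝ))
      (w : ι → Lp ℝ 2 (surfaceMeasure Ω)),
      (∀ i, ∃ c, ∀ φ, ‖l i φ‖ ≤ c * ‖gradientL2 (volume.restrict (ext Ω)) φ‖) ∧
        ∀ φ, ‖restrictL2 (surfaceMeasure Ω) φ - ∑ i, l i φ • w i‖ ≤
          ε * ‖gradientL2 (volume.restrict (ext Ω)) φ‖ := by
  classical
  have hbdd : Bornology.IsBounded Ω := Metric.isBounded_closedBall.subset hbd
  set A : ℝ≥0∞ := ((ballVol n)⁻¹ * ENNReal.ofReal ((2 * (a + b) / b) ^ n / n)) ^ 2 * compConst n *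
    areaConst n with hA
  have hAtop : A ≠ ⊤ := ENNReal.mul_ne_top (ENNReal.mul_ne_top (ENNReal.pow_ne_top
    (ENNReal.mul_ne_top (ENNReal.inv_ne_top.mpr ballVol_ne_zero) ENNReal.ofReal_ne_top))
      compConst_ne_top) areaConst_ne_top
  -- The squared error is linear in `s`, so `s` of order `ε²` suffices; `B + 1` avoids dividing by
  -- zero.
  obtain ⟨s, hs, hs1, hsε⟩ : ∃ s : ℝ, 0 < s ∧ s ≤ 1 ∧
      A.toReal * (2 ^ (n - 1) * (2 * (s * (a + b)))) ≤ ε ^ 2 := by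
    set B := A.toReal * (2 ^ (n - 1) * (2 * (a + b)))
    have hB : 0 ≤ B := by positivity
    refine ⟨min 1 (ε ^ 2 / (B + 1)), lt_min one_pos (by positivity), min_le_left _ _, ?_⟩
    calc _ = B * min 1 (ε ^ 2 / (B + 1)) := by ring
      _ ≤ (B + 1) * (ε ^ 2 / (B + 1)) :=
        mul_le_mul (by linarith) (min_le_right _ _) (by positivity) (by positivity)
      _ = ε ^ 2 := by field_simp
  have hfr : (frontier Ω).Nonempty := by
    by_contra h
    have h1 := surfaceMeasure_univ_pos (by omega) ho hbdd hb hball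
    rw [not_nonempty_iff_eq_empty] at h
    exact h1 (by simp [surfaceMeasure, h])
  have hcpt : IsCompact (frontier Ω) :=
    Metric.isCompact_of_isClosed_isBounded isClosed_frontier
      (hbdd.closure.subset frontier_subset_closure)
  obtain ⟨p, hpm, hpd⟩ := exists_simpleFunc_dist_le hcpt hfr (r := s * b / 4) (by positivity)
  -- Indicators of the fibres of `p`: at almost every `x` the finite sum then reduces to the single
  -- average attached to `p x`.
  obtain ⟨w, hw⟩ : ∃ w : p.range → Lp ℝ 2 (surfaceMeasure Ω),
      ∀ y, w y =ᵐ[surfaceMeasure Ω] (p ⁻¹' {y.1}).indicator fun _ => (1 : ℝ) :=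
    ⟨fun y => indicatorConstLp 2 (p.measurableSet_fiber y.1) (measure_ne_top _ _) (1 : ℝ),
      fun y => indicatorConstLp_coeFn⟩
  refine ⟨p.range, inferInstance, fun y => coneAvgFunctional b s y.1, w, ?_, ?_⟩
  · rintro ⟨y, hy⟩
    obtain ⟨x, rfl⟩ := SimpleFunc.mem_range.mp hy
    exact exists_norm_coneAvg_le hn ho hc hb hs hball (frontier_notMem ho (hpm x))
  · intro φ
    rw [norm_gradientL2, Lp.norm_def]
    have hae : ⇑(restrictL2 (surfaceMeasure Ω) φ - ∑ y : p.range,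
        coneAvgFunctional b s y.1 φ • w y)
        =ᵐ[surfaceMeasure Ω] fun x => φ.1 x - coneAvg b s (p x) φ.1 := by
      have h1 : ∀ᵐ x ∂(surfaceMeasure Ω), ∀ y : p.range, (coneAvgFunctional b s y.1 φ • w y) x =
          coneAvg b s y.1 φ.1 * (p ⁻¹' {y.1}).indicator (fun _ => (1 : ℝ)) x := by
        refine ae_all_iff.mpr fun y => ?_
        filter_upwards [Lp.coeFn_smul (coneAvgFunctional b s y.1 φ) (w y), hw y] with x h2 h3
        rw [h2, Pi.smul_apply, h3]
        rfl
      filter_upwards [Lp.coeFn_sub (restrictL2 (surfaceMeasure Ω) φ)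
        (∑ y : p.range, coneAvgFunctional b s y.1 φ • w y),
        Lp.coeFn_finsetSum Finset.univ fun y : p.range => coneAvgFunctional b s y.1 φ • w y,
        (φ.2.memLp (surfaceMeasure Ω) 2).coeFn_toLp, h1] with x h2 h3 h4 h5
      rw [h2, Pi.sub_apply, h3, Finset.sum_apply]
      congr 1
      rw [Finset.sum_congr rfl fun y _ => h5 y,
        Finset.sum_eq_single (⟨p x, p.mem_range_self x⟩ : p.range)]
      · rw [indicator_of_mem (by rfl), mul_one]
      · intro y _ hy
        rw [indicator_of_notMem, mul_zero]
        exact fun h => hy (Subtype.ext h.symm)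
      · exact fun h => absurd (Finset.mem_univ _) h
    rw [eLpNorm_congr_ae hae]
    refine toReal_eLpNorm_le hε.le (φ.2.memLp_gradient _ 2) ?_
    refine (lintegral_sub_coneAvg_le hn ho hc hb ha hball hbd hs hs1 hpd φ.2).trans ?_
    gcongr
    rw [← mul_assoc, ← hA, ← ENNReal.ofReal_toReal hAtop, ← ENNReal.ofReal_mul (by positivity)]
    exact ENNReal.ofReal_le_ofReal hsε

/-- Existence of the extremals of the trace inequality, which weakly solve the Steklov problem. -/
theorem exists_extremal (hn : 3 ≤ n) {Ω : Set (E n)} (ho : IsOpen Ω)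
    (hc : Convex ℝ Ω) {a b : ℝ} (hb : 0 < b) (ha : 0 < a) (hball : Metric.ball 0 b ⊆ Ω)
    (hbd : Ω ⊆ Metric.closedBall 0 a) {M : ℝ≥0∞} (hMtop : M ≠ ⊤)
    (hM : ∀ x, ∫⁻ y, powKer (n - 2) (y - x) ∂(surfaceMeasure Ω) ≤ M) :
    ∃ τ : ℝ, 0 < τ ∧ ENNReal.ofReal (τ ^ 2) ≤ potConst n ^ 2 * compConst n * M ∧
      (∀ φ : E n → ℝ, IsTestFunction φ → eLpNorm φ 2 (surfaceMeasure Ω) ≤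
        ENNReal.ofReal τ * eLpNorm (∇ φ) 2 (volume.restrict (ext Ω))) ∧
      ∃ (g : ℕ → E n → ℝ) (G : E n → E n) (f : E n → ℝ),
        (∀ k, IsTestFunction (g k)) ∧ MemLp G 2 (volume.restrict (ext Ω)) ∧
        MemLp f 2 (surfaceMeasure Ω) ∧
        Tendsto (fun k => eLpNorm (∇ (g k) - G) 2 (volume.restrict (ext Ω))) atTop (𝓝 0) ∧
        Tendsto (fun k => eLpNorm (g k - f) 2 (surfaceMeasure Ω)) atTop (𝓝 0) ∧
        (¬ G =ᵐ[volume.restrict (ext Ω)] 0) ∧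
        ∀ φ : E n → ℝ, IsTestFunction φ → ∫ x, f x * φ x ∂(surfaceMeasure Ω) =
          τ ^ 2 * ∫ x in ext Ω, inner ℝ (G x) (∇ φ x) := by
  have hbdd : Bornology.IsBounded Ω := Metric.isBounded_closedBall.subset hbd
  have hne : Ω.Nonempty := ⟨0, hball (by simpa using hb)⟩
  have : IsFiniteMeasure (surfaceMeasure Ω) :=
    isFiniteMeasure_surfaceMeasure (by omega) ho hc hne hbdd
  set B : ℝ≥0∞ := potConst n ^ 2 * compConst n * M with hBdef
  have hB : B ≠ ⊤ := ENNReal.mul_ne_top (ENNReal.mul_ne_top (ENNReal.pow_ne_top potConst_ne_top)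
    compConst_ne_top) hMtop
  have hfe : ∀ φ, ‖restrictL2 (surfaceMeasure Ω) φ‖ ≤
      √B.toReal * ‖gradientL2 (volume.restrict (ext Ω)) φ‖ := by
    intro φ
    rw [norm_restrictL2, norm_gradientL2]
    refine toReal_eLpNorm_le (Real.sqrt_nonneg _) (φ.2.memLp_gradient _ 2) ?_
    rw [Real.sq_sqrt ENNReal.toReal_nonneg, ENNReal.ofReal_toReal hB]
    exact trace_inequality hn ho hc hne (surfaceMeasure_self Ω ho) hM φ.2
  -- A cutoff equal to one on the frontier has nonzero trace, because the surface has positive area.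
  have hf : ∃ φ, restrictL2 (surfaceMeasure Ω) φ ≠ 0 := by
    obtain ⟨φ, hφ, hφ1⟩ := exists_isTestFunction_eq_one (n := n) a
    refine ⟨⟨φ, hφ⟩, fun h => ?_⟩
    have h1 : φ =ᵐ[surfaceMeasure Ω] 0 :=
      (hφ.memLp (surfaceMeasure Ω) 2).coeFn_toLp.symm.trans
        (((Lp.ext_iff).mp h).trans (Lp.coeFn_zero _ _ _))
    refine surfaceMeasure_univ_pos (by omega) ho hbdd hb hball ?_
    rw [Measure.measure_univ_eq_zero, ← ae_eq_bot, ← eventually_false_iff_eq_bot]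
    filter_upwards [h1, ae_mem_frontier Ω] with x hx hx'
    have : x ∈ Metric.closedBall 0 a :=
      (closure_minimal hbd Metric.isClosed_closedBall) (frontier_subset_closure hx')
    rw [hφ1 x this] at hx
    exact one_ne_zero hx
  obtain ⟨τ, hτ, hτC, hτle, g, G, f, hg, hgf, hG, heq⟩ :=
    exists_maximiser (gradientL2 (volume.restrict (ext Ω))) (restrictL2 (surfaceMeasure Ω)) hf
      (Real.sqrt_nonneg _) hfe fun ε hε => exists_finite_rank_approx hn ho hc hb ha hball hbd hε
  refine ⟨τ, hτ, ?_, ?_, fun k => (g k).1, G, f, fun k => (g k).2, Lp.memLp G, Lp.memLp f,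
    ?_, ?_, ?_, ?_⟩
  · rw [← ENNReal.ofReal_toReal hB]
    refine ENNReal.ofReal_le_ofReal ?_
    calc τ ^ 2 ≤ √B.toReal ^ 2 := by gcongr
      _ = _ := Real.sq_sqrt ENNReal.toReal_nonneg
  · intro φ hφ
    have h1 := hτle ⟨φ, hφ⟩
    rw [norm_restrictL2, norm_gradientL2] at h1
    rw [← ENNReal.ofReal_toReal (hφ.memLp (surfaceMeasure Ω) 2).eLpNorm_ne_top,
      ← ENNReal.ofReal_toReal (hφ.memLp_gradient (volume.restrict (ext Ω)) 2).eLpNorm_ne_top,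
      ← ENNReal.ofReal_mul hτ.le]
    exact ENNReal.ofReal_le_ofReal h1
  · rw [Lp.tendsto_Lp_iff_tendsto_eLpNorm'] at hg
    refine hg.congr fun k => eLpNorm_congr_ae ?_
    exact ((g k).2.memLp_gradient _ 2).coeFn_toLp.sub EventuallyEq.rfl
  · rw [Lp.tendsto_Lp_iff_tendsto_eLpNorm'] at hgf
    refine hgf.congr fun k => eLpNorm_congr_ae ?_
    exact ((g k).2.memLp _ 2).coeFn_toLp.sub EventuallyEq.rfl
  · exact fun h => hG ((Lp.eq_zero_iff_ae_eq_zero).mpr h)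
  · intro φ hφ
    have h1 := heq ⟨φ, hφ⟩
    rw [L2.inner_def, L2.inner_def] at h1
    have h2 : ∫ x, f x * φ x ∂(surfaceMeasure Ω) =
        ∫ x, inner ℝ (f x) (restrictL2 (surfaceMeasure Ω) ⟨φ, hφ⟩ x) ∂(surfaceMeasure Ω) := by
      refine integral_congr_ae ?_
      filter_upwards [(hφ.memLp (surfaceMeasure Ω) 2).coeFn_toLp] with x hx
      rw [show restrictL2 (surfaceMeasure Ω) ⟨φ, hφ⟩ x = φ x from hx]
      simp [mul_comm]
    rw [h2, h1]
    congr 1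
    refine integral_congr_ae ?_
    filter_upwards [(hφ.memLp_gradient (volume.restrict (ext Ω)) 2).coeFn_toLp] with x hx
    rw [show gradientL2 (volume.restrict (ext Ω)) ⟨φ, hφ⟩ x = ∇ φ x from hx]

/-! ### Partial derivatives and the Laplacian in coordinates. -/

/-- The `i`-th partial derivative. -/
noncomputable def pd (i : Fin n) (f : E n → ℝ) (x : E n) : ℝ :=
  fderiv ℝ f x (EuclideanSpace.single i 1)

/-- The Laplacian in coordinates. -/
noncomputable def lap (f : E n → ℝ) (x : E n) : ℝ := ∑ i, pd i (pd i f) x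

theorem pd_congr {f g : E n → ℝ} {x : E n} (h : f =ᶠ[𝓝 x] g) (i : Fin n) : pd i f x = pd i g x := by
  rw [pd, pd, h.fderiv_eq]

theorem pd_eventuallyEq {f g : E n → ℝ} {x : E n} (h : f =ᶠ[𝓝 x] g) (i : Fin n) :
    pd i f =ᶠ[𝓝 x] pd i g :=
  h.eventuallyEq_nhds.mono fun _ hy => pd_congr hy i

theorem lap_congr {f g : E n → ℝ} {x : E n} (h : f =ᶠ[𝓝 x] g) : lap f x = lap g x :=
  Finset.sum_congr rfl fun i _ => pd_congr (pd_eventuallyEq h i) i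

theorem contDiff_pd {f : E n → ℝ} (hf : ContDiff ℝ ∞ f) (i : Fin n) : ContDiff ℝ ∞ (pd i f) :=
  (hf.fderiv_right (m := ∞) (by simp)).clm_apply contDiff_const

theorem contDiff_lap {f : E n → ℝ} (hf : ContDiff ℝ ∞ f) : ContDiff ℝ ∞ (lap f) :=
  ContDiff.sum fun i _ => contDiff_pd (contDiff_pd hf i) i

theorem differentiable_of_smooth {f : E n → ℝ} (hf : ContDiff ℝ ∞ f) : Differentiable ℝ f :=
  hf.differentiable (by simp)

theorem laplacian_eq_lap {f : E n → ℝ} {x : E n} (hf : ContDiffAt ℝ 2 f x) :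
    Laplacian.laplacian f x = lap f x := by
  rw [InnerProductSpace.laplacian_eq_iteratedFDeriv_orthonormalBasis f
    (EuclideanSpace.basisFun (Fin n) ℝ)]
  refine Finset.sum_congr rfl fun i _ => ?_
  rw [iteratedFDeriv_two_apply]
  have hd : DifferentiableAt ℝ (fderiv ℝ f) x :=
    (hf.fderiv_right (m := 1) (by norm_num)).differentiableAt one_ne_zero
  have : pd i f = fun y => fderiv ℝ f y (EuclideanSpace.single i 1) := rfl
  rw [pd, this, fderiv_clm_apply hd (differentiableAt_const _)]
  simp

theorem gradient_apply (f : E n → ℝ) (x : E n) (i : Fin n) : ∇ f x i = pd i f x := by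
  have h : inner ℝ (∇ f x) (EuclideanSpace.single i (1 : ℝ)) = pd i f x := by
    rw [gradient, InnerProductSpace.toDual_symm_apply, pd]
  rw [← h, EuclideanSpace.inner_single_right]
  simp

theorem inner_eq_sum (v w : E n) : inner ℝ v w = ∑ i, v i * w i := by
  simp [PiLp.inner_apply, mul_comm]

theorem pd_mul {f g : E n → ℝ} (hf : Differentiable ℝ f) (hg : Differentiable ℝ g) (i : Fin n)
    (x : E n) : pd i (fun y => f y * g y) x = f x * pd i g x + g x * pd i f x := by
  rw [pd, fderiv_fun_mul (hf x) (hg x)]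
  simp [pd]

theorem pd_add {f g : E n → ℝ} (hf : Differentiable ℝ f) (hg : Differentiable ℝ g) (i : Fin n)
    (x : E n) : pd i (fun y => f y + g y) x = pd i f x + pd i g x := by
  rw [pd, fderiv_fun_add (hf x) (hg x)]
  simp [pd]

theorem pd_sub {f g : E n → ℝ} (hf : Differentiable ℝ f) (hg : Differentiable ℝ g) (i : Fin n)
    (x : E n) : pd i (fun y => f y - g y) x = pd i f x - pd i g x := by
  rw [pd, fderiv_fun_sub (hf x) (hg x)]
  simp [pd]

theorem pd_const_mul {f : E n → ℝ} (hf : Differentiable ℝ f) (c : ℝ) (i : Fin n)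
    (x : E n) : pd i (fun y => c * f y) x = c * pd i f x := by
  rw [pd, fderiv_const_mul (hf x)]
  simp [pd]

theorem lap_mul {f g : E n → ℝ} (hf : ContDiff ℝ ∞ f) (hg : ContDiff ℝ ∞ g) (x : E n) :
    lap (fun y => f y * g y) x =
      f x * lap g x + (2 * ∑ i, pd i f x * pd i g x + g x * lap f x) := by
  have hf' := differentiable_of_smooth hf
  have hg' := differentiable_of_smooth hg
  simp only [lap, Finset.mul_sum, ← Finset.sum_add_distrib]
  refine Finset.sum_congr rfl fun i _ => ?_
  have e : pd i (fun y => f y * g y) = fun y => f y * pd i g y + g y * pd i f y :=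
    funext fun y => pd_mul hf' hg' i y
  have hfi := differentiable_of_smooth (contDiff_pd hf i)
  have hgi := differentiable_of_smooth (contDiff_pd hg i)
  rw [e, pd_add (f := fun y => f y * pd i g y) (g := fun y => g y * pd i f y) (hf'.mul hgi)
    (hg'.mul hfi), pd_mul hf' hgi, pd_mul hg' hfi]
  ring

theorem lap_sub {f g : E n → ℝ} (hf : ContDiff ℝ ∞ f) (hg : ContDiff ℝ ∞ g) (x : E n) :
    lap (fun y => f y - g y) x = lap f x - lap g x := by
  simp only [lap, ← Finset.sum_sub_distrib]
  refine Finset.sum_congr rfl fun i _ => ?_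
  have e : pd i (fun y => f y - g y) = fun y => pd i f y - pd i g y :=
    funext fun y => pd_sub (differentiable_of_smooth hf) (differentiable_of_smooth hg) i y
  rw [e, pd_sub (differentiable_of_smooth (contDiff_pd hf i))
    (differentiable_of_smooth (contDiff_pd hg i))]

theorem lap_const_mul {f : E n → ℝ} (hf : ContDiff ℝ ∞ f) (c : ℝ) (x : E n) :
    lap (fun y => c * f y) x = c * lap f x := by
  simp only [lap, Finset.mul_sum]
  refine Finset.sum_congr rfl fun i _ => ?_
  have e : pd i (fun y => c * f y) = fun y => c * pd i f y :=
    funext fun y => pd_const_mul (differentiable_of_smooth hf) c i y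
  rw [e, pd_const_mul (differentiable_of_smooth (contDiff_pd hf i))]

/-- Chain rule for `y ↦ x + a y`. -/
theorem pd_comp_affine {f : E n → ℝ} (hf : Differentiable ℝ f) (x : E n) (a : ℝ) (i : Fin n)
    (y : E n) : pd i (fun y => f (x + a • y)) y = a * pd i f (x + a • y) := by
  have h : HasFDerivAt (fun y : E n => x + a • y) (a • ContinuousLinearMap.id ℝ (E n)) y :=
    ((hasFDerivAt_id y).const_smul a).const_add x
  have h2 := (hf (x + a • y)).hasFDerivAt.comp y h
  have h3 : fderiv ℝ (fun y => f (x + a • y)) y = _ := h2.fderiv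
  rw [pd, h3]
  simp [pd]

theorem lap_comp_affine {f : E n → ℝ} (hf : ContDiff ℝ ∞ f) (x : E n) (a : ℝ) (y : E n) :
    lap (fun y => f (x + a • y)) y = a ^ 2 * lap f (x + a • y) := by
  simp only [lap, Finset.mul_sum]
  refine Finset.sum_congr rfl fun i _ => ?_
  have e : pd i (fun y => f (x + a • y)) = fun y => a * pd i f (x + a • y) :=
    funext fun y => pd_comp_affine (differentiable_of_smooth hf) x a i y
  have h := differentiable_of_smooth (contDiff_pd hf i)
  rw [e, pd_const_mul (f := fun y => pd i f (x + a • y)) (h.comp (by fun_prop : Differentiable ℝ fun y : E n => x + a • y)),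
    pd_comp_affine h]
  ring

theorem tsupport_pd_subset (f : E n → ℝ) (i : Fin n) : tsupport (pd i f) ⊆ tsupport f := by
  refine closure_minimal (fun x hx => ?_) isClosed_closure
  by_contra h
  refine hx ?_
  rw [notMem_tsupport_iff_eventuallyEq] at h
  rw [pd_congr h]
  simp [pd]

theorem tsupport_lap_subset (f : E n → ℝ) : tsupport (lap f) ⊆ tsupport f := by
  refine closure_minimal (fun x hx => ?_) isClosed_closure
  by_contra h
  refine hx (Finset.sum_eq_zero fun i _ => ?_)
  have h1 : x ∉ tsupport (pd i (pd i f)) := fun h' =>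
    h (tsupport_pd_subset _ i (tsupport_pd_subset _ i h'))
  exact image_eq_zero_of_notMem_tsupport h1

theorem IsTestFunction.pd {f : E n → ℝ} (hf : IsTestFunction f) (i : Fin n) :
    IsTestFunction (pd i f) :=
  ⟨contDiff_pd hf.1 i, hf.2.of_isClosed_subset isClosed_closure (tsupport_pd_subset f i)⟩

theorem IsTestFunction.lap {f : E n → ℝ} (hf : IsTestFunction f) : IsTestFunction (lap f) :=
  ⟨contDiff_lap hf.1, hf.2.of_isClosed_subset isClosed_closure (tsupport_lap_subset f)⟩

/-! ### A smoothed fundamental solution. -/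

/-- A smooth step, `0` on `(-∞, 1/4]` and `1` on `[1, ∞)`. -/
noncomputable def step (t : ℝ) : ℝ := Real.smoothTransition ((t - 1 / 4) / (3 / 4))

theorem contDiff_step : ContDiff ℝ ∞ step :=
  Real.smoothTransition.contDiff.comp (by fun_prop)

theorem step_of_le {t : ℝ} (ht : t ≤ 1 / 4) : step t = 0 :=
  Real.smoothTransition.zero_of_nonpos (by linarith)

theorem step_of_ge {t : ℝ} (ht : 1 ≤ t) : step t = 1 :=
  Real.smoothTransition.one_of_one_le (by linarith)

theorem deriv_step_nonneg (t : ℝ) : 0 ≤ deriv step t :=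
  (Real.smoothTransition.monotone.comp fun a b h => by
    show (a - 1 / 4) / (3 / 4) ≤ (b - 1 / 4) / (3 / 4)
    linarith).deriv_nonneg

/-- A smooth function on the line equal to `(k - 1) t ^ (-k)` for `t ≥ 1`, vanishing near
`(-∞, 0]`. -/
noncomputable def profileDeriv (k t : ℝ) : ℝ := (k - 1) * (step t * t ^ (-k))

theorem contDiff_profileDeriv (k : ℝ) : ContDiff ℝ ∞ (profileDeriv k) := by
  refine contDiff_const.mul (contDiff_iff_contDiffAt.mpr fun t => ?_)
  rcases lt_or_ge t (1 / 4) with ht | ht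
  · refine (contDiffAt_const (c := (0 : ℝ))).congr_of_eventuallyEq ?_
    filter_upwards [gt_mem_nhds ht] with s hs
    rw [step_of_le hs.le, zero_mul]
  · exact contDiff_step.contDiffAt.mul (Real.contDiffAt_rpow_const_of_ne (by linarith))

/-- In the variable `t = |z|²` the radial Laplacian is `4 t F'' + 2 n F'`. With `k = n / 2` the
contributions of the power cancel, leaving only the derivative of the step, which has one sign and
vanishes for `t > 1`. -/
theorem four_mul_deriv_profileDeriv (k : ℝ) {t : ℝ} (ht : 0 ≤ t) :
    4 * t * deriv (profileDeriv k) t + 4 * k * profileDeriv k t =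
      4 * (k - 1) * (t * t ^ (-k)) * deriv step t := by
  rcases ht.eq_or_lt with rfl | ht
  · simp [profileDeriv, step_of_le]
  have h1 : HasDerivAt step (deriv step t) t :=
    (contDiff_step.differentiable (by simp) t).hasDerivAt
  have h2 : HasDerivAt (fun s : ℝ => s ^ (-k)) (-k * t ^ (-k - 1)) t :=
    Real.hasDerivAt_rpow_const (Or.inl ht.ne')
  have h3 := ((h1.mul h2).const_mul (k - 1)).deriv
  have h4 : deriv (profileDeriv k) t = _ := h3
  have h5 : t * t ^ (-k - 1) = t ^ (-k) := by
    rw [Real.rpow_sub_one ht.ne']; field_simp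
  rw [h4, profileDeriv]
  linear_combination 4 * (k - 1) * step t * (-k) * h5

/-- The radial profile of the smoothed fundamental solution, as a function of `|z|²`. -/
noncomputable def profile (k t : ℝ) : ℝ := 1 - ∫ s in (1 : ℝ)..t, profileDeriv k s

theorem hasDerivAt_profile (k t : ℝ) : HasDerivAt (profile k) (-profileDeriv k t) t := by
  have h := (contDiff_profileDeriv k).continuous
  exact (intervalIntegral.integral_hasDerivAt_right (h.intervalIntegrable _ _)
    (h.stronglyMeasurableAtFilter _ _) h.continuousAt).const_sub 1

theorem deriv_profile (k : ℝ) : deriv (profile k) = fun t => -profileDeriv k t :=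
  funext fun t => (hasDerivAt_profile k t).deriv

theorem contDiff_profile (k : ℝ) : ContDiff ℝ ∞ (profile k) := by
  refine contDiff_infty_iff_deriv.mpr ⟨fun t => (hasDerivAt_profile k t).differentiableAt, ?_⟩
  rw [deriv_profile]
  exact (contDiff_profileDeriv k).neg

theorem profile_of_ge (k : ℝ) {t : ℝ} (ht : 1 ≤ t) : profile k t = t ^ (1 - k) := by
  have h : ∫ s in (1 : ℝ)..t, profileDeriv k s = -t ^ (1 - k) - -(1 : ℝ) ^ (1 - k) := by
    refine intervalIntegral.integral_eq_sub_of_hasDerivAt (f := fun s : ℝ => -s ^ (1 - k))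
      (fun s hs => ?_) ((contDiff_profileDeriv k).continuous.intervalIntegrable _ _)
    rw [uIcc_of_le ht] at hs
    have := (Real.hasDerivAt_rpow_const (x := s) (p := 1 - k)
      (Or.inl (by linarith [hs.1]))).neg
    convert! this using 1
    rw [profileDeriv, step_of_ge hs.1]
    ring_nf
  rw [profile, h, Real.one_rpow]
  ring

theorem pd_radial {F : ℝ → ℝ} (hF : Differentiable ℝ F) (i : Fin n) (z : E n) :
    pd i (fun y => F (‖y‖ ^ 2)) z = 2 * (z i * deriv F (‖z‖ ^ 2)) := by
  have h1 := (hF (‖z‖ ^ 2)).hasDerivAt.comp_hasFDerivAt z (hasStrictFDerivAt_norm_sq z).hasFDerivAt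
  have h3 : fderiv ℝ (fun y : E n => F (‖y‖ ^ 2)) z = _ := h1.fderiv
  rw [pd, h3]
  simp [EuclideanSpace.inner_single_right]
  ring

theorem lap_radial {F : ℝ → ℝ} (hF : ContDiff ℝ ∞ F) (z : E n) :
    lap (fun y => F (‖y‖ ^ 2)) z =
      4 * ‖z‖ ^ 2 * deriv (deriv F) (‖z‖ ^ 2) + 2 * n * deriv F (‖z‖ ^ 2) := by
  have hF' : ContDiff ℝ ∞ (deriv F) := (contDiff_infty_iff_deriv.mp hF).2
  have hd := hF'.differentiable (by simp)
  have hco : ∀ i : Fin n, Differentiable ℝ fun y : E n => y i := fun i => by fun_prop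
  have hn2 : Differentiable ℝ fun y : E n => deriv F (‖y‖ ^ 2) :=
    hd.comp ((contDiff_norm_sq ℝ (n := 1)).differentiable one_ne_zero)
  have hpc : ∀ i : Fin n, pd i (fun y : E n => y i) z = 1 := by
    intro i
    have : HasFDerivAt (fun y : E n => y i) (EuclideanSpace.proj i : E n →L[ℝ] ℝ) z :=
      (EuclideanSpace.proj i : E n →L[ℝ] ℝ).hasFDerivAt
    rw [pd, this.fderiv]
    simp
  have key : ∀ i : Fin n, pd i (pd i fun y => F (‖y‖ ^ 2)) z =
      4 * z i ^ 2 * deriv (deriv F) (‖z‖ ^ 2) + 2 * deriv F (‖z‖ ^ 2) := by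
    intro i
    have e : pd i (fun y : E n => F (‖y‖ ^ 2)) = fun y => 2 * (y i * deriv F (‖y‖ ^ 2)) :=
      funext fun y => pd_radial (hF.differentiable (by simp)) i y
    rw [e, pd_const_mul (f := fun y : E n => y i * deriv F (‖y‖ ^ 2)) ((hco i).mul hn2),
      pd_mul (hco i) hn2, pd_radial hd, hpc]
    ring
  rw [lap, Finset.sum_congr rfl fun i _ => key i, Finset.sum_add_distrib, ← Finset.sum_mul,
    ← Finset.mul_sum, ← EuclideanSpace.real_norm_sq_eq]
  simp
  ring

/-- `Φ` is a smoothing, inside the unit ball, of the fundamental solution of the Laplacian. -/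
structure IsSmoothedFundamentalSolution (Φ : E n → ℝ) (c : ℝ) : Prop where
  smooth : ContDiff ℝ ∞ Φ
  pos : 0 ≤ c
  eq_of_one_le : ∀ z, 1 ≤ ‖z‖ → Φ z = c * ‖z‖⁻¹ ^ (n - 2)
  pd_le : ∀ i z, 1 ≤ ‖z‖ → |pd i Φ z| ≤ c * n * ‖z‖⁻¹ ^ (n - 1)
  lap_eq_zero : ∀ z, 1 < ‖z‖ → lap Φ z = 0
  integral_lap : ∫ z, lap Φ z = -1

/-- With `k = n / 2` the profile gives `‖z‖^(2-n)` outside the unit ball. Minus its Laplacian is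
nonnegative, compactly supported and not identically zero, so its integral can be normalised to one,
and no flux through spheres has to be computed. -/
theorem exists_isSmoothedFundamentalSolution (hn : 3 ≤ n) :
    ∃ (Φ : E n → ℝ) (c : ℝ), IsSmoothedFundamentalSolution Φ c := by
  set k : ℝ := n / 2 with hk
  have hn' : (3 : ℝ) ≤ n := by exact_mod_cast hn
  have hk1 : 0 < k - 1 := by rw [hk]; linarith
  set Φ₀ : E n → ℝ := fun z => profile k (‖z‖ ^ 2) with hΦ₀
  have hsm : ContDiff ℝ ∞ Φ₀ := (contDiff_profile k).comp (contDiff_norm_sq ℝ)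
  have hlap : ∀ z, lap Φ₀ z =
      -(4 * (k - 1) * (‖z‖ ^ 2 * (‖z‖ ^ 2) ^ (-k)) * deriv step (‖z‖ ^ 2)) := by
    intro z
    have hd : deriv (deriv (profile k)) = fun t => -deriv (profileDeriv k) t := by
      rw [deriv_profile]
      exact funext fun t => deriv.fun_neg
    rw [hΦ₀, lap_radial (contDiff_profile k), hd, deriv_profile,
      ← four_mul_deriv_profileDeriv k (by positivity), hk]
    ring
  have hzero : ∀ z, 1 < ‖z‖ → lap Φ₀ z = 0 := by
    intro z hz
    have : deriv step (‖z‖ ^ 2) = 0 := by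
      have h1 : step =ᶠ[𝓝 (‖z‖ ^ 2)] fun _ => 1 := by
        filter_upwards [lt_mem_nhds (show (1 : ℝ) < ‖z‖ ^ 2 by nlinarith)] with s hs
        exact step_of_ge hs.le
      rw [h1.deriv_eq]
      simp
    rw [hlap, this]
    simp
  have hnonneg : ∀ z, 0 ≤ -lap Φ₀ z := by
    intro z
    have := deriv_step_nonneg (‖z‖ ^ 2)
    rw [hlap, neg_neg]
    positivity
  have hcs : HasCompactSupport fun z => -lap Φ₀ z := by
    refine HasCompactSupport.intro (isCompact_closedBall (0 : E n) 1) fun z hz => ?_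
    rw [hzero z (by simpa using hz), neg_zero]
  -- The mean value theorem provides a radius at which the step has positive derivative; this makes
  -- the integral strictly positive.
  obtain ⟨t, ⟨ht0, ht1⟩, ht⟩ := exists_deriv_eq_slope step (show (1 / 4 : ℝ) < 1 by norm_num)
    contDiff_step.continuous.continuousOn
    ((contDiff_step.differentiable (by simp)).differentiableOn)
  rw [step_of_ge le_rfl, step_of_le le_rfl] at ht
  have hpos : 0 < ∫ z, -lap Φ₀ z := by
    refine (contDiff_lap hsm).continuous.neg.integral_pos_of_hasCompactSupport_nonneg_nonzero
      hcs hnonneg (x := EuclideanSpace.single ⟨0, by omega⟩ (√t)) ?_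
    have hnorm : ‖(EuclideanSpace.single ⟨0, by omega⟩ (√t) : E n)‖ ^ 2 = t := by
      rw [PiLp.norm_single, Real.norm_of_nonneg (Real.sqrt_nonneg _),
        Real.sq_sqrt (by linarith)]
    rw [hlap, hnorm, ht, neg_neg]
    have : 0 < t := by linarith
    positivity
  set c := (∫ z, -lap Φ₀ z)⁻¹ with hc
  have hc0 : 0 < c := inv_pos.mpr hpos
  refine ⟨fun z => c * Φ₀ z, c, contDiff_const.mul hsm, hc0.le, fun z hz => ?_,
    fun i z hz => ?_, fun z hz => ?_, ?_⟩
  · have hz0 : 0 < ‖z‖ := by linarith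
    simp only [hΦ₀]
    rw [profile_of_ge k (by nlinarith), ← Real.rpow_natCast ‖z‖ 2, ← Real.rpow_mul hz0.le,
      ← Real.rpow_natCast, Real.inv_rpow hz0.le, ← Real.rpow_neg hz0.le, hk,
      Nat.cast_sub (by omega)]
    congr 2
    push_cast
    ring
  · have hz0 : 0 < ‖z‖ := by linarith
    rw [pd_const_mul (differentiable_of_smooth hsm),
      pd_radial ((contDiff_profile k).differentiable (by simp)), deriv_profile]
    simp only [profileDeriv]
    rw [step_of_ge (by nlinarith), abs_mul, abs_of_pos hc0, mul_assoc]
    gcongr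
    have h1 : (‖z‖ ^ 2) ^ (-k) * ‖z‖ = ‖z‖⁻¹ ^ (n - 1) := by
      rw [← Real.rpow_natCast ‖z‖ 2, ← Real.rpow_mul hz0.le,
        ← Real.rpow_natCast, Real.inv_rpow hz0.le, ← Real.rpow_neg hz0.le, hk,
        Nat.cast_sub (by omega), ← Real.rpow_add_one hz0.ne']
      congr 1
      push_cast
      ring
    have h2 : |z i| ≤ ‖z‖ := abs_apply_le_norm z i
    have h3 : 0 ≤ (‖z‖ ^ 2) ^ (-k) := by positivity
    rw [abs_mul, abs_mul, abs_neg, abs_mul, one_mul, abs_of_pos hk1, abs_of_nonneg h3, abs_two]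
    calc 2 * (|z i| * ((k - 1) * (‖z‖ ^ 2) ^ (-k)))
        ≤ 2 * (‖z‖ * ((k - 1) * (‖z‖ ^ 2) ^ (-k))) := by gcongr
      _ = (2 * (k - 1)) * ‖z‖⁻¹ ^ (n - 1) := by rw [← h1]; ring
      _ ≤ n * ‖z‖⁻¹ ^ (n - 1) := by gcongr; rw [hk]; linarith
  · rw [lap_const_mul hsm, hzero z hz, mul_zero]
  · have : lap (fun z => c * Φ₀ z) = fun z => c * lap Φ₀ z :=
      funext fun z => lap_const_mul hsm c z
    rw [this, integral_const_mul, hc, integral_neg]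
    rw [integral_neg, neg_pos] at hpos
    rw [inv_neg, neg_mul, inv_mul_cancel₀ hpos.ne]

theorem pd_comp_sub {f : E n → ℝ} (hf : Differentiable ℝ f) (x : E n) (i : Fin n) (y : E n) :
    pd i (fun y => f (x - y)) y = -pd i f (x - y) := by
  have := pd_comp_affine hf x (-1) i y
  simpa [← sub_eq_add_neg] using this

theorem lap_comp_sub {f : E n → ℝ} (hf : ContDiff ℝ ∞ f) (x y : E n) :
    lap (fun y => f (x - y)) y = lap f (x - y) := by
  have := lap_comp_affine hf x (-1) y
  simpa [← sub_eq_add_neg] using this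

theorem IsTestFunction.comp_sub {f : E n → ℝ} (hf : IsTestFunction f) (x : E n) :
    IsTestFunction fun y => f (x - y) :=
  ⟨hf.1.comp (contDiff_const.sub contDiff_id), hf.2.comp_homeomorph (Homeomorph.subLeft x)⟩

theorem IsTestFunction.integrable_mul {u g : E n → ℝ} (hg : IsTestFunction g)
    (hu : LocallyIntegrable u) : Integrable fun y => u y * g y :=
  hu.integrable_smul_right_of_hasCompactSupport hg.continuous hg.2

/-! ### Mollification and Weyl's lemma. -/

/-- Convolution of real functions. -/
noncomputable def conv (u g : E n → ℝ) (x : E n) : ℝ := ∫ y, u y * g (x - y)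

theorem contDiff_conv {u g : E n → ℝ} (hu : LocallyIntegrable u) (hg : IsTestFunction g) :
    ContDiff ℝ ∞ (conv u g) :=
  hg.2.contDiff_convolution_right (ContinuousLinearMap.mul ℝ ℝ) hu hg.1

theorem pd_conv {u g : E n → ℝ} (hu : LocallyIntegrable u) (hg : IsTestFunction g) (i : Fin n)
    (x : E n) : pd i (conv u g) x = conv u (pd i g) x := by
  have h : HasFDerivAt (conv u g) _ x :=
    hg.2.hasFDerivAt_convolution_right (ContinuousLinearMap.mul ℝ ℝ) hu hg.contDiff_one x
  rw [pd, h.fderiv, convolution_precompR_apply _ hu (hg.2.fderiv ℝ)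
    (hg.contDiff_one.continuous_fderiv one_ne_zero)]
  rfl

theorem lap_conv {u g : E n → ℝ} (hu : LocallyIntegrable u) (hg : IsTestFunction g)
    (x : E n) : lap (conv u g) x = conv u (lap g) x := by
  have h1 : ∀ i, pd i (pd i (conv u g)) x = conv u (pd i (pd i g)) x := by
    intro i
    have : pd i (conv u g) = conv u (pd i g) := funext fun y => pd_conv hu hg i y
    rw [this, pd_conv hu (hg.pd i)]
  rw [lap, Finset.sum_congr rfl fun i _ => h1 i]
  simp only [conv, lap, Finset.mul_sum]
  rw [integral_finsetSum]
  exact fun i _ => (((hg.pd i).pd i).comp_sub x).integrable_mul hu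

/-- The fundamental solution smoothed at scale `ε`. -/
noncomputable def scaledKernel (Φ : E n → ℝ) (ε : ℝ) (z : E n) : ℝ :=
  ε⁻¹ ^ (n - 2) * Φ (ε⁻¹ • z)

/-- The mollifier at scale `ε` given by the smoothed fundamental solution. -/
noncomputable def mollifier (Φ : E n → ℝ) (ε : ℝ) (z : E n) : ℝ :=
  -lap (scaledKernel Φ ε) z

theorem one_le_norm_inv_smul {ε : ℝ} (hε : 0 < ε) {z : E n} (hz : ε ≤ ‖z‖) : 1 ≤ ‖ε⁻¹ • z‖ := by
  rw [norm_smul, norm_inv, Real.norm_of_nonneg hε.le, ← div_eq_inv_mul]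
  rwa [one_le_div hε]

namespace IsSmoothedFundamentalSolution

variable {Φ : E n → ℝ} {c : ℝ}

theorem contDiff_scaledKernel (hΦ : IsSmoothedFundamentalSolution Φ c) (ε : ℝ) : ContDiff ℝ ∞ (scaledKernel Φ ε) :=
  contDiff_const.mul (hΦ.smooth.comp (contDiff_const_smul _))

theorem mollifier_eq (hΦ : IsSmoothedFundamentalSolution Φ c) (hn : 2 ≤ n) (ε : ℝ) (z : E n) :
    mollifier Φ ε z = -(ε⁻¹ ^ n * lap Φ (ε⁻¹ • z)) := by
  have h := lap_comp_affine hΦ.smooth 0 ε⁻¹ z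
  simp only [zero_add] at h
  have hs : ContDiff ℝ ∞ fun z : E n => Φ (ε⁻¹ • z) :=
    hΦ.smooth.comp (contDiff_const_smul _)
  have e : scaledKernel Φ ε = fun z => ε⁻¹ ^ (n - 2) * Φ (ε⁻¹ • z) := rfl
  rw [mollifier, e, lap_const_mul hs, h, ← mul_assoc, ← pow_add, Nat.sub_add_cancel hn]

theorem scaledKernel_eq (hΦ : IsSmoothedFundamentalSolution Φ c) {ε : ℝ} (hε : 0 < ε) {z : E n} (hz : ε ≤ ‖z‖) :
    scaledKernel Φ ε z = c * ‖z‖⁻¹ ^ (n - 2) := by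
  rw [scaledKernel, hΦ.eq_of_one_le _ (one_le_norm_inv_smul hε hz), norm_smul, norm_inv,
    Real.norm_of_nonneg hε.le, mul_inv, inv_inv, mul_pow, mul_left_comm, ← mul_assoc (ε⁻¹ ^ _),
    ← mul_pow, inv_mul_cancel₀ hε.ne', one_pow, one_mul]

theorem abs_pd_scaledKernel_le (hΦ : IsSmoothedFundamentalSolution Φ c) (hn : 2 ≤ n) {ε : ℝ} (hε : 0 < ε) {z : E n} (hz : ε ≤ ‖z‖)
    (i : Fin n) : |pd i (scaledKernel Φ ε) z| ≤ c * n * ‖z‖⁻¹ ^ (n - 1) := by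
  have h := pd_comp_affine (differentiable_of_smooth hΦ.smooth) 0 ε⁻¹ i z
  simp only [zero_add] at h
  have hs : Differentiable ℝ fun z : E n => Φ (ε⁻¹ • z) :=
    differentiable_of_smooth (hΦ.smooth.comp (contDiff_const_smul _))
  have e : scaledKernel Φ ε = fun z => ε⁻¹ ^ (n - 2) * Φ (ε⁻¹ • z) := rfl
  have h1 : n - 1 = n - 2 + 1 := by omega
  rw [e, pd_const_mul hs, h, ← mul_assoc, ← pow_succ, ← h1, abs_mul,
    abs_of_nonneg (by positivity)]
  refine (mul_le_mul_of_nonneg_left (hΦ.pd_le i _ (one_le_norm_inv_smul hε hz))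
    (by positivity)).trans_eq ?_
  rw [norm_smul, norm_inv, Real.norm_of_nonneg hε.le, mul_inv, inv_inv, mul_pow, mul_left_comm,
    ← mul_assoc (ε⁻¹ ^ _), ← mul_pow, inv_mul_cancel₀ hε.ne', one_pow, one_mul]

theorem mollifier_eq_zero (hΦ : IsSmoothedFundamentalSolution Φ c) (hn : 2 ≤ n) {ε : ℝ} (hε : 0 < ε) {z : E n} (hz : ε < ‖z‖) :
    mollifier Φ ε z = 0 := by
  rw [hΦ.mollifier_eq hn, hΦ.lap_eq_zero, mul_zero, neg_zero]
  rw [norm_smul, norm_inv, Real.norm_of_nonneg hε.le, ← div_eq_inv_mul]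
  rwa [one_lt_div hε]

theorem isTestFunction_mollifier (hΦ : IsSmoothedFundamentalSolution Φ c) (hn : 2 ≤ n) {ε : ℝ} (hε : 0 < ε) :
    IsTestFunction (mollifier Φ ε) := by
  refine ⟨(contDiff_lap (hΦ.contDiff_scaledKernel ε)).neg,
    HasCompactSupport.intro (isCompact_closedBall (0 : E n) ε) fun z hz => ?_⟩
  exact hΦ.mollifier_eq_zero hn hε (by simpa using hz)

theorem integral_mollifier (hΦ : IsSmoothedFundamentalSolution Φ c) (hn : 2 ≤ n) {ε : ℝ} (hε : 0 < ε) : ∫ z, mollifier Φ ε z = 1 := by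
  simp only [hΦ.mollifier_eq hn]
  rw [integral_neg, integral_const_mul, Measure.integral_comp_inv_smul_of_nonneg _ _ hε.le,
    hΦ.integral_lap, finrank_euclideanSpace_fin, smul_eq_mul, ← mul_assoc, ← mul_pow,
    inv_mul_cancel₀ hε.ne']
  simp

theorem exists_abs_mollifier_le (hΦ : IsSmoothedFundamentalSolution Φ c) (hn : 2 ≤ n) :
    ∃ K, ∀ ε, 0 < ε → ∀ z, |mollifier Φ ε z| ≤ K * ε⁻¹ ^ n := by
  have hcs : HasCompactSupport (lap Φ) :=
    HasCompactSupport.intro (isCompact_closedBall (0 : E n) 1)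
      fun z hz => hΦ.lap_eq_zero z (by simpa using hz)
  obtain ⟨K, hK⟩ := hcs.exists_bound_of_continuous (contDiff_lap hΦ.smooth).continuous
  refine ⟨K, fun ε hε z => ?_⟩
  rw [hΦ.mollifier_eq hn, abs_neg, abs_mul, abs_of_nonneg (by positivity : 0 ≤ ε⁻¹ ^ n), mul_comm]
  exact mul_le_mul_of_nonneg_right (hK _) (by positivity)

/-- Lebesgue differentiation: the kernels have unit mass, live in balls of radius `ε`, and are
bounded by a fixed multiple of the inverse volume of those balls. -/
theorem ae_tendsto_conv (hΦ : IsSmoothedFundamentalSolution Φ c) (hn : 2 ≤ n) {u : E n → ℝ} (hu : LocallyIntegrable u) :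
    ∀ᵐ x, Tendsto (fun ε => conv u (mollifier Φ ε) x) (𝓝[>] 0) (𝓝 (u x)) := by
  obtain ⟨K, hK⟩ := hΦ.exists_abs_mollifier_le hn
  filter_upwards [(Besicovitch.vitaliFamily (volume : Measure (E n))).ae_tendsto_average_norm_sub
    hu] with x hx
  have h := tendsto_integral_smul_of_tendsto_average_norm_sub
    (g := fun ε y => mollifier Φ ε (x - y)) (K * (ballVol n).toReal)
    (hx.comp (Besicovitch.tendsto_filterAt volume x)) ?_ ?_ ?_ ?_
  · simpa only [conv, smul_eq_mul, mul_comm] using h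
  · exact Eventually.of_forall fun ε => hu.integrableOn_isCompact (isCompact_closedBall _ _)
  · refine tendsto_const_nhds.congr' ?_
    filter_upwards [self_mem_nhdsWithin] with ε hε
    rw [integral_sub_left_eq_self (mollifier Φ ε), hΦ.integral_mollifier hn hε]
  · filter_upwards [self_mem_nhdsWithin] with ε hε y hy
    by_contra h
    refine hy (hΦ.mollifier_eq_zero hn hε ?_)
    rwa [Metric.mem_closedBall', dist_eq_norm, not_le] at h
  · filter_upwards [self_mem_nhdsWithin] with ε hε y
    have hε' : 0 < ε := hε
    have hb : 0 < (ballVol n).toReal := ENNReal.toReal_pos ballVol_ne_zero ballVol_ne_top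
    refine (hK ε hε _).trans_eq ?_
    rw [measureReal_def, volume_closedBall_eq x hε'.le, ENNReal.toReal_mul,
      ENNReal.toReal_ofReal (by positivity), inv_pow]
    field_simp

end IsSmoothedFundamentalSolution

namespace IsSmoothedFundamentalSolution

variable {Φ : E n → ℝ} {c : ℝ}

theorem tsupport_mollifier_comp_sub_subset (hΦ : IsSmoothedFundamentalSolution Φ c) (hn : 2 ≤ n)
    {ε : ℝ} (hε : 0 < ε) (x : E n) :
    tsupport (fun y => mollifier Φ ε (x - y)) ⊆ Metric.closedBall x ε := by
  refine closure_minimal (fun y hy => ?_) Metric.isClosed_closedBall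
  by_contra h
  refine hy (hΦ.mollifier_eq_zero hn hε ?_)
  rwa [Metric.mem_closedBall', dist_eq_norm, not_le] at h

/-- The mean value property. The smoothed solutions at scales `δ` and `ε` agree beyond radius `ε`,
so their difference is a test function, and its Laplacian is the difference of the two mollifiers.
-/
theorem conv_mollifier_eq_of_le (hΦ : IsSmoothedFundamentalSolution Φ c) (hn : 2 ≤ n)
    {U : Set (E n)} {u : E n → ℝ} (hu : LocallyIntegrable u)
    (hharm : ∀ φ, IsTestFunction φ → tsupport φ ⊆ U → ∫ y, u y * lap φ y = 0)
    {x : E n} {δ ε : ℝ} (hδ : 0 < δ) (hδε : δ ≤ ε) (hU : Metric.closedBall x ε ⊆ U) :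
    conv u (mollifier Φ ε) x = conv u (mollifier Φ δ) x := by
  have hε := hδ.trans_le hδε
  set ψ : E n → ℝ := fun z => scaledKernel Φ δ z - scaledKernel Φ ε z
  have hψ0 : ∀ z, ε < ‖z‖ → ψ z = 0 := fun z hz => by
    simp only [ψ]
    rw [hΦ.scaledKernel_eq hδ (hδε.trans hz.le), hΦ.scaledKernel_eq hε hz.le, sub_self]
  have hψ : IsTestFunction ψ :=
    ⟨(hΦ.contDiff_scaledKernel δ).sub (hΦ.contDiff_scaledKernel ε),
      HasCompactSupport.intro (isCompact_closedBall (0 : E n) ε) fun z hz =>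
        hψ0 z (by simpa using hz)⟩
  have h := hharm (fun y => ψ (x - y)) (hψ.comp_sub x) <| by
    refine (closure_minimal (fun y hy => ?_) Metric.isClosed_closedBall).trans hU
    by_contra h
    refine hy (hψ0 _ ?_)
    rwa [Metric.mem_closedBall', dist_eq_norm, not_le] at h
  have h2 : ∀ y, u y * lap (fun y => ψ (x - y)) y =
      u y * mollifier Φ ε (x - y) - u y * mollifier Φ δ (x - y) := by
    intro y
    rw [lap_comp_sub hψ.1, lap_sub (hΦ.contDiff_scaledKernel δ) (hΦ.contDiff_scaledKernel ε),
      mollifier, mollifier]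
    ring
  simp only [h2] at h
  rw [integral_sub
    (((hΦ.isTestFunction_mollifier hn hε).comp_sub x).integrable_mul hu)
    (((hΦ.isTestFunction_mollifier hn hδ).comp_sub x).integrable_mul hu)] at h
  exact sub_eq_zero.mp h

theorem lap_conv_mollifier (hΦ : IsSmoothedFundamentalSolution Φ c) (hn : 2 ≤ n)
    {U : Set (E n)} {u : E n → ℝ} (hu : LocallyIntegrable u)
    (hharm : ∀ φ, IsTestFunction φ → tsupport φ ⊆ U → ∫ y, u y * lap φ y = 0)
    {x : E n} {ε : ℝ} (hε : 0 < ε) (hU : Metric.closedBall x ε ⊆ U) :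
    lap (conv u (mollifier Φ ε)) x = 0 := by
  have hm := hΦ.isTestFunction_mollifier hn hε
  rw [lap_conv hu hm, conv, ← hharm _ (hm.comp_sub x)
    ((hΦ.tsupport_mollifier_comp_sub_subset hn hε x).trans hU)]
  simp only [lap_comp_sub hm.1]

/-- Weyl's lemma, with a mean value formula and the identification of the gradient. -/
theorem exists_harmonic_representative (hΦ : IsSmoothedFundamentalSolution Φ c) (hn : 2 ≤ n)
    {U : Set (E n)} (hUo : IsOpen U) {u : E n → ℝ} {G : E n → E n} (hu : LocallyIntegrable u)
    (hG : LocallyIntegrable G)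
    (hharm : ∀ φ, IsTestFunction φ → tsupport φ ⊆ U → ∫ y, u y * lap φ y = 0)
    (hgrad : ∀ φ, IsTestFunction φ → tsupport φ ⊆ U → ∀ i,
      ∫ y, u y * pd i φ y = -∫ y, G y i * φ y) :
    ∃ v : E n → ℝ, InnerProductSpace.HarmonicOnNhd v U ∧ (∀ᵐ x, x ∈ U → v x = u x) ∧
      (∀ᵐ x, x ∈ U → ∇ v x = G x) ∧
      ∀ x ε, 0 < ε → Metric.closedBall x ε ⊆ U → v x = conv u (mollifier Φ ε) x := by
  classical
  -- Any admissible radius gives the same value, by comparison with a smaller common radius; hence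
  -- near each point one fixed radius can be used and `v` is smooth there.
  set v : E n → ℝ := fun x => if h : ∃ ε : ℝ, 0 < ε ∧ Metric.closedBall x ε ⊆ U then
    conv u (mollifier Φ h.choose) x else 0 with hv
  have hveq : ∀ x ε, 0 < ε → Metric.closedBall x ε ⊆ U → v x = conv u (mollifier Φ ε) x := by
    intro x ε hε hεU
    have h : ∃ ε : ℝ, 0 < ε ∧ Metric.closedBall x ε ⊆ U := ⟨ε, hε, hεU⟩
    simp only [hv, dif_pos h]
    have hs := h.choose_spec
    have hmin : 0 < min h.choose ε := lt_min hs.1 hε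
    rw [hΦ.conv_mollifier_eq_of_le hn hu hharm hmin (min_le_left _ _) hs.2,
      hΦ.conv_mollifier_eq_of_le hn hu hharm hmin (min_le_right _ _) hεU]
  have hloc : ∀ x ∈ U, ∃ ε : ℝ, 0 < ε ∧ ∀ y ∈ Metric.ball x ε, Metric.closedBall y ε ⊆ U := by
    intro x hx
    obtain ⟨δ, hδ, hδU⟩ := Metric.isOpen_iff.mp hUo x hx
    refine ⟨δ / 2, by positivity, fun y hy z hz => hδU ?_⟩
    rw [Metric.mem_ball] at hy ⊢
    rw [Metric.mem_closedBall] at hz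
    linarith [dist_triangle z y x]
  have hev : ∀ x ε, 0 < ε → (∀ y ∈ Metric.ball x ε, Metric.closedBall y ε ⊆ U) →
      v =ᶠ[𝓝 x] conv u (mollifier Φ ε) := by
    intro x ε hε h
    filter_upwards [Metric.ball_mem_nhds x hε] with y hy
    exact hveq y ε hε (h y hy)
  have hsmall : ∀ x ∈ U, ∀ᶠ ε in 𝓝[>] (0 : ℝ), 0 < ε ∧ Metric.closedBall x ε ⊆ U := by
    intro x hx
    obtain ⟨δ, hδ, hδU⟩ := Metric.isOpen_iff.mp hUo x hx
    filter_upwards [Ioo_mem_nhdsGT hδ] with ε hε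
    exact ⟨hε.1, (Metric.closedBall_subset_ball hε.2).trans hδU⟩
  refine ⟨v, fun x hx => ?_, ?_, ?_, hveq⟩
  · obtain ⟨ε, hε, h⟩ := hloc x hx
    rw [InnerProductSpace.harmonicAt_congr_nhds (hev x ε hε h)]
    have hc : ContDiff ℝ 2 (conv u (mollifier Φ ε)) :=
      contDiff_infty.mp (contDiff_conv hu (hΦ.isTestFunction_mollifier hn hε)) 2
    refine ⟨hc.contDiffAt, ?_⟩
    filter_upwards [Metric.ball_mem_nhds x hε] with y hy
    rw [laplacian_eq_lap hc.contDiffAt,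
      hΦ.lap_conv_mollifier hn hu hharm hε (h y hy), Pi.zero_apply]
  · filter_upwards [hΦ.ae_tendsto_conv hn hu] with x hx hxU
    refine tendsto_nhds_unique (tendsto_const_nhds.congr' ?_) hx
    filter_upwards [hsmall x hxU] with ε hε
    exact hveq x ε hε.1 hε.2
  · have hGi : ∀ i, LocallyIntegrable fun y => G y i := fun i x => by
      obtain ⟨s, hs, h⟩ := hG x
      exact ⟨s, hs, (EuclideanSpace.proj i : E n →L[ℝ] ℝ).integrable_comp h⟩
    have hae : ∀ᵐ x, ∀ i, Tendsto (fun ε => conv (fun y => G y i) (mollifier Φ ε) x) (𝓝[>] 0)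
        (𝓝 (G x i)) := ae_all_iff.mpr fun i => hΦ.ae_tendsto_conv hn (hGi i)
    filter_upwards [hae] with x hx hxU
    ext i
    rw [gradient_apply]
    refine tendsto_nhds_unique (tendsto_const_nhds.congr' ?_) (hx i)
    obtain ⟨δ, hδ, h⟩ := hloc x hxU
    filter_upwards [Ioo_mem_nhdsGT hδ] with ε hε
    have hm := hΦ.isTestFunction_mollifier hn hε.1
    have h' : ∀ y ∈ Metric.ball x ε, Metric.closedBall y ε ⊆ U := fun y hy =>
      (Metric.closedBall_subset_closedBall hε.2.le).trans (h y (Metric.ball_subset_ball hε.2.le hy))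
    -- The derivative falls on the mollifier and, by the weak gradient identity, becomes the
    -- mollification of the `i`-th component of `G`, whose limit is known almost everywhere.
    rw [pd_congr (hev x ε hε.1 h'), pd_conv hu hm]
    have h1 := hgrad _ (hm.comp_sub x) ((hΦ.tsupport_mollifier_comp_sub_subset hn hε.1 x).trans
      (h' x (Metric.mem_ball_self hε.1))) i
    simp only [pd_comp_sub (differentiable_of_smooth hm.1), mul_neg] at h1
    rw [integral_neg, neg_inj] at h1
    exact h1

end IsSmoothedFundamentalSolution

/-! ### Local limits of test functions with convergent gradients. -/

theorem tendsto_integral_inner {α H : Type*} [MeasurableSpace α] [NormedAddCommGroup H]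
    [InnerProductSpace ℝ H] {m : Measure α} {F : ℕ → α → H} {F₀ ψ : α → H}
    (hF : ∀ k, MemLp (F k) 2 m) (hF₀ : MemLp F₀ 2 m) (hψ : MemLp ψ 2 m)
    (h : Tendsto (fun k => eLpNorm (F k - F₀) 2 m) atTop (𝓝 0)) :
    Tendsto (fun k => ∫ x, inner ℝ (F k x) (ψ x) ∂m) atTop (𝓝 (∫ x, inner ℝ (F₀ x) (ψ x) ∂m)) := by
  have h1 := (Lp.tendsto_Lp_iff_tendsto_eLpNorm'' F hF F₀ hF₀).mpr h
  have h2 := h1.inner (𝕜 := ℝ) (tendsto_const_nhds (x := hψ.toLp ψ))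
  have key : ∀ (f : α → H) (hf : MemLp f 2 m),
      inner ℝ (hf.toLp f) (hψ.toLp ψ) = ∫ x, inner ℝ (f x) (ψ x) ∂m := by
    intro f hf
    rw [L2.inner_def]
    refine integral_congr_ae ?_
    filter_upwards [hf.coeFn_toLp, hψ.coeFn_toLp] with x h3 h4
    rw [h3, h4]
  simpa only [key] using h2

theorem tendsto_integral_mul {α : Type*} [MeasurableSpace α] {m : Measure α} {F : ℕ → α → ℝ}
    {F₀ ψ : α → ℝ} (hF : ∀ k, MemLp (F k) 2 m) (hF₀ : MemLp F₀ 2 m) (hψ : MemLp ψ 2 m)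
    (h : Tendsto (fun k => eLpNorm (F k - F₀) 2 m) atTop (𝓝 0)) :
    Tendsto (fun k => ∫ x, F k x * ψ x ∂m) atTop (𝓝 (∫ x, F₀ x * ψ x ∂m)) := by
  simpa [mul_comm] using tendsto_integral_inner hF hF₀ hψ h

theorem integral_mul_pd {φ ψ : E n → ℝ} (hφ : IsTestFunction φ)
    (hψ : IsTestFunction ψ) (i : Fin n) :
    ∫ x, φ x * pd i ψ x = -∫ x, pd i φ x * ψ x :=
  integral_mul_fderiv_eq_neg_fderiv_mul_of_integrable
    ((hψ.integrable_mul (hφ.pd i).continuous.locallyIntegrable))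
    ((hψ.pd i).integrable_mul hφ.continuous.locallyIntegrable)
    (hψ.integrable_mul hφ.continuous.locallyIntegrable)
    (fun x _ => hφ.differentiable x) (fun x _ => hψ.differentiable x)

/-- A finite measure on the exterior, equivalent to Lebesgue measure on bounded sets. -/
noncomputable def weightedVolume (Ω : Set (E n)) : Measure (E n) :=
  (volume.restrict (ext Ω)).withDensity fun x => ENNReal.ofReal ((1 + ‖x‖) ^ (-(n + 1 : ℝ)))

instance (Ω : Set (E n)) : IsFiniteMeasure (weightedVolume Ω) := by
  refine isFiniteMeasure_withDensity_ofReal (Integrable.restrict ?_).2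
  exact integrable_one_add_norm (by simp)

theorem weightedVolume_le (Ω : Set (E n)) : weightedVolume Ω ≤ volume.restrict (ext Ω) := by
  refine (withDensity_mono (Eventually.of_forall fun x => ?_)).trans_eq withDensity_one
  rw [Pi.one_apply, ENNReal.ofReal_le_one]
  exact Real.rpow_le_one_of_one_le_of_nonpos (by linarith [norm_nonneg x]) (by
    have : (0 : ℝ) ≤ n := by positivity
    linarith)

theorem restrict_le_smul_weightedVolume (Ω : Set (E n)) (R : ℝ) :
    volume.restrict (ext Ω ∩ Metric.ball 0 R) ≤
      ENNReal.ofReal ((1 + |R|) ^ (n + 1 : ℝ)) • weightedVolume Ω := by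
  have hw : Measurable fun x : E n => ENNReal.ofReal ((1 + ‖x‖) ^ (-(n + 1 : ℝ))) := by fun_prop
  rw [weightedVolume, ← withDensity_smul _ hw, inter_comm,
    ← Measure.restrict_restrict Metric.isOpen_ball.measurableSet,
    ← withDensity_indicator_one Metric.isOpen_ball.measurableSet]
  refine withDensity_mono (Eventually.of_forall fun x => ?_)
  by_cases hx : x ∈ Metric.ball 0 R
  · rw [indicator_of_mem hx, Pi.one_apply, Pi.smul_apply, smul_eq_mul,
      ← ENNReal.ofReal_mul (by positivity), ENNReal.one_le_ofReal,
      Real.rpow_neg (by positivity), ← div_eq_mul_inv, one_le_div (by positivity)]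
    rw [mem_ball_zero_iff] at hx
    gcongr
    exact hx.le.trans (le_abs_self R)
  · rw [indicator_of_notMem hx]
    exact zero_le

theorem weightedVolume_growth (hn : 1 ≤ n) (Ω : Set (E n)) (x : E n) (r : ℝ)
    (hr : 0 < r) (hr1 : r ≤ 1) :
    weightedVolume Ω (Metric.closedBall x r) ≤ ballVol n * ENNReal.ofReal (r ^ (n - 1)) :=
  (weightedVolume_le Ω _).trans (volume_restrict_closedBall_growth hn _ x r hr hr1)

/-- A single weighted inequality replaces one for each ball: sequences that are Cauchy in energy
become Cauchy in one complete space, and its limit serves all radii at once. -/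
theorem exists_weightedVolume_trace (hn : 3 ≤ n) {Ω : Set (E n)} (ho : IsOpen Ω)
    (hc : Convex ℝ Ω) (hne : Ω.Nonempty) :
    ∃ C, ∀ φ, ‖restrictL2 (weightedVolume Ω) φ‖ ≤
      C * ‖gradientL2 (volume.restrict (ext Ω)) φ‖ := by
  have h0 : weightedVolume Ω Ω = 0 := by
    refine le_antisymm ((weightedVolume_le Ω _).trans_eq ?_) (zero_le)
    rw [Measure.restrict_apply ho.measurableSet, ext,
      (disjoint_compl_right.mono_left subset_closure).inter_eq, measure_empty]
  have hM := lintegral_powKer_le_of_growth (by omega) (m := weightedVolume Ω) ballVol_ne_top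
    (weightedVolume_growth (by omega) Ω)
  set B : ℝ≥0∞ := potConst n ^ 2 * compConst n *
    (ballVol n * 2 ^ (n - 1) + weightedVolume Ω univ)
  have hB : B ≠ ⊤ := by
    refine ENNReal.mul_ne_top (ENNReal.mul_ne_top (ENNReal.pow_ne_top potConst_ne_top)
      compConst_ne_top) (ENNReal.add_ne_top.mpr ⟨ENNReal.mul_ne_top ballVol_ne_top
        (ENNReal.pow_ne_top ENNReal.ofNat_ne_top), measure_ne_top _ _⟩)
  refine ⟨√B.toReal, fun φ => ?_⟩
  rw [norm_restrictL2, norm_gradientL2]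
  refine toReal_eLpNorm_le (Real.sqrt_nonneg _) (φ.2.memLp_gradient _ 2) ?_
  rw [Real.sq_sqrt ENNReal.toReal_nonneg, ENNReal.ofReal_toReal hB]
  exact trace_inequality hn ho hc hne h0 hM φ.2

/-- Test functions whose gradients converge in `L²` converge locally in `L²`. -/
theorem exists_local_limit (hn : 3 ≤ n) {Ω : Set (E n)} (ho : IsOpen Ω)
    (hc : Convex ℝ Ω) (hne : Ω.Nonempty) {g : ℕ → E n → ℝ} {G : E n → E n}
    (hg : ∀ k, IsTestFunction (g k)) (hG : MemLp G 2 (volume.restrict (ext Ω)))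
    (h : Tendsto (fun k => eLpNorm (∇ (g k) - G) 2 (volume.restrict (ext Ω))) atTop (𝓝 0)) :
    ∃ u : E n → ℝ, (∀ x ∉ ext Ω, u x = 0) ∧
      ∀ R : ℝ, MemLp u 2 (volume.restrict (ext Ω ∩ Metric.ball 0 R)) ∧
        Tendsto (fun k => eLpNorm (g k - u) 2 (volume.restrict (ext Ω ∩ Metric.ball 0 R)))
          atTop (𝓝 0) := by
  obtain ⟨C, hC⟩ := exists_weightedVolume_trace hn ho hc hne
  set γ : ℕ → testFunctions n := fun k => ⟨g k, hg k⟩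
  have h1 : Tendsto (fun k => gradientL2 (volume.restrict (ext Ω)) (γ k)) atTop
      (𝓝 (hG.toLp G)) :=
    (Lp.tendsto_Lp_iff_tendsto_eLpNorm'' _ (fun k => (hg k).memLp_gradient _ 2) G hG).mpr h
  have h2 : CauchySeq fun k => restrictL2 (weightedVolume Ω) (γ k) := by
    rw [Metric.cauchySeq_iff']
    intro ε hε
    obtain ⟨N, hN⟩ := Metric.cauchySeq_iff'.mp h1.cauchySeq (ε / (|C| + 1)) (by positivity)
    refine ⟨N, fun k hk => ?_⟩
    have h3 := hN k hk
    rw [dist_eq_norm, ← map_sub] at h3 ⊢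
    calc _ ≤ C * ‖gradientL2 (volume.restrict (ext Ω)) (γ k - γ N)‖ := hC _
      _ ≤ (|C| + 1) * ‖gradientL2 (volume.restrict (ext Ω)) (γ k - γ N)‖ := by
        gcongr
        linarith [le_abs_self C]
      _ < (|C| + 1) * (ε / (|C| + 1)) := by gcongr
      _ = ε := by field_simp
  obtain ⟨w, hw⟩ := cauchySeq_tendsto_of_complete h2
  have hw2 : Tendsto (fun k => eLpNorm (g k - ⇑w) 2 (weightedVolume Ω)) atTop (𝓝 0) := by
    rw [Lp.tendsto_Lp_iff_tendsto_eLpNorm'] at hw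
    exact hw.congr fun k => eLpNorm_congr_ae
      ((((hg k).memLp _ 2).coeFn_toLp).sub EventuallyEq.rfl)
  have hmeas := (isOpen_ext Ω).measurableSet
  -- Extension by zero makes the limit locally integrable on the whole space, as convolution
  -- requires.
  refine ⟨(ext Ω).indicator w, fun x hx => indicator_of_notMem hx _, fun R => ?_⟩
  have hae : (ext Ω).indicator w =ᵐ[volume.restrict (ext Ω ∩ Metric.ball 0 R)] w := by
    filter_upwards [ae_restrict_mem (hmeas.inter Metric.isOpen_ball.measurableSet)] with x hx
    exact indicator_of_mem hx.1 _
  have hle := restrict_le_smul_weightedVolume Ω R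
  constructor
  · exact (((Lp.memLp w).smul_measure ENNReal.ofReal_ne_top).mono_measure hle).ae_eq hae.symm
  · have h4 : ∀ k, eLpNorm (g k - (ext Ω).indicator w) 2
        (volume.restrict (ext Ω ∩ Metric.ball 0 R)) ≤
        ENNReal.ofReal ((1 + |R|) ^ (n + 1 : ℝ)) ^ (1 / (2 : ℝ≥0∞)).toReal *
          eLpNorm (g k - ⇑w) 2 (weightedVolume Ω) := by
      intro k
      rw [eLpNorm_congr_ae (EventuallyEq.rfl.sub hae)]
      refine (eLpNorm_mono_measure _ hle).trans_eq ?_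
      rw [eLpNorm_smul_measure_of_ne_top ENNReal.ofNat_ne_top, smul_eq_mul]
    refine tendsto_of_tendsto_of_tendsto_of_le_of_le tendsto_const_nhds ?_
      (fun k => zero_le) h4
    have := ENNReal.Tendsto.const_mul hw2 (a := ENNReal.ofReal ((1 + |R|) ^ (n + 1 : ℝ)) ^
      (1 / (2 : ℝ≥0∞)).toReal) (Or.inr (ENNReal.rpow_ne_top_of_nonneg (by positivity)
        ENNReal.ofReal_ne_top))
    simpa using this

/-- At radii up to `R` the volume satisfies surface-type growth with constant proportional to `R`.
The resulting factor `R²` is the natural Poincaré scaling, and it keeps the growth of the limit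
function slow. -/
theorem lintegral_powKer_ball_le (hn : 3 ≤ n) {Q : Set (E n)} {R : ℝ} (hR : 0 < R)
    (hQ : Q ⊆ Metric.ball 0 R) (x : E n) :
    ∫⁻ y in Q, powKer (n - 2) (y - x) ≤
      ballVol n * (2 ^ (n - 1) + 1) * ENNReal.ofReal R ^ 2 := by
  have e : n - 2 + 1 = n - 1 := by omega
  rw [← lintegral_add_compl _ (Metric.isClosed_closedBall (x := x) (ε := R)).measurableSet]
  have h1 := lintegral_powKer_closedBall_le (m := volume.restrict Q) (p := n - 2)
    (A := ballVol n * ENNReal.ofReal R) (ENNReal.mul_ne_top ballVol_ne_top ENNReal.ofReal_ne_top)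
    hR (x := x) (by
      intro r hr hrR
      refine (Measure.restrict_apply_le _ _).trans ?_
      rw [volume_closedBall_eq x hr.le, mul_assoc, ← ENNReal.ofReal_mul hR.le, e]
      refine mul_le_mul_right (ENNReal.ofReal_le_ofReal ?_) _
      calc r ^ n = r * r ^ (n - 1) := by rw [← pow_succ', Nat.sub_add_cancel (by omega)]
        _ ≤ R * r ^ (n - 1) := by gcongr)
  have h2 := setLIntegral_powKer_compl_closedBall_le (n - 2) (volume.restrict Q) x hR
    (s := (Metric.closedBall x R)ᶜ) (t := univ) (by rw [compl_eq_univ_sdiff])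
  have h3 : volume.restrict Q univ ≤ ballVol n * ENNReal.ofReal (R ^ n) := by
    rw [Measure.restrict_apply_univ, ← volume_ball_eq 0 hR]
    exact measure_mono hQ
  refine (add_le_add h1 (h2.trans (mul_le_mul_right h3 _))).trans_eq ?_
  have h4 : ENNReal.ofReal (R⁻¹ ^ (n - 2)) * (ballVol n * ENNReal.ofReal (R ^ n)) =
      ballVol n * ENNReal.ofReal R ^ 2 := by
    rw [mul_left_comm, ← ENNReal.ofReal_mul (by positivity), ← ENNReal.ofReal_pow hR.le]
    congr 2
    obtain ⟨k, rfl⟩ : ∃ k, n = k + 2 := ⟨n - 2, by omega⟩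
    rw [Nat.add_sub_cancel, pow_add, ← mul_assoc, ← mul_pow, inv_mul_cancel₀ hR.ne', one_pow,
      one_mul]
  rw [h4, e, ENNReal.ofReal_mul (by positivity), ENNReal.ofReal_pow zero_le_two]
  simp only [ENNReal.ofReal_ofNat]
  ring

/-- Poincaré inequality on balls outside a convex set, with the scaling constant. -/
theorem exists_eLpNorm_ball_le (hn : 3 ≤ n) {Ω : Set (E n)} (ho : IsOpen Ω)
    (hc : Convex ℝ Ω) (hne : Ω.Nonempty) :
    ∃ K : ℝ≥0∞, K ≠ ⊤ ∧ ∀ φ : E n → ℝ, IsTestFunction φ → ∀ R : ℝ, 0 < R →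
      eLpNorm φ 2 (volume.restrict (ext Ω ∩ Metric.ball 0 R)) ≤
        K * ENNReal.ofReal R * eLpNorm (∇ φ) 2 (volume.restrict (ext Ω)) := by
  set K : ℝ≥0∞ := potConst n ^ 2 * compConst n * (ballVol n * (2 ^ (n - 1) + 1))
  have hK : K ≠ ⊤ := by
    refine ENNReal.mul_ne_top (ENNReal.mul_ne_top (ENNReal.pow_ne_top potConst_ne_top)
      compConst_ne_top) (ENNReal.mul_ne_top ballVol_ne_top ?_)
    exact ENNReal.add_ne_top.mpr ⟨ENNReal.pow_ne_top ENNReal.ofNat_ne_top, ENNReal.one_ne_top⟩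
  -- `K ≤ (K + 1)²` avoids an extended square root.
  refine ⟨K + 1, ENNReal.add_ne_top.mpr ⟨hK, ENNReal.one_ne_top⟩, fun φ hφ R hR => ?_⟩
  refine eLpNorm_two_le_of_lintegral_le ?_
  set Q := ext Ω ∩ Metric.ball 0 R
  have : IsFiniteMeasure (volume.restrict Q) := ⟨by
    rw [Measure.restrict_apply_univ]
    exact (measure_mono inter_subset_right).trans_lt measure_ball_lt_top⟩
  have h0 : volume.restrict Q Ω = 0 := by
    rw [Measure.restrict_apply ho.measurableSet]
    refine measure_mono_null (t := ∅) (fun x hx => ?_) measure_empty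
    exact hx.2.1 (subset_closure hx.1)
  refine (trace_inequality hn ho hc hne h0
    (lintegral_powKer_ball_le hn hR inter_subset_right) hφ).trans ?_
  gcongr
  rw [← mul_assoc, mul_pow]
  gcongr
  calc K ≤ K + 1 := le_self_add
    _ ≤ (K + 1) ^ 2 := by
      rw [sq]
      exact le_mul_of_one_le_right' le_add_self

/-- The local limit of test functions grows slowly. -/
theorem exists_eLpNorm_limit_le (hn : 3 ≤ n) {Ω : Set (E n)} (ho : IsOpen Ω)
    (hc : Convex ℝ Ω) (hne : Ω.Nonempty) {g : ℕ → E n → ℝ} {G : E n → E n} {u : E n → ℝ}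
    (hg : ∀ k, IsTestFunction (g k)) (hG : MemLp G 2 (volume.restrict (ext Ω)))
    (h : Tendsto (fun k => eLpNorm (∇ (g k) - G) 2 (volume.restrict (ext Ω))) atTop (𝓝 0))
    (hu : ∀ R : ℝ, MemLp u 2 (volume.restrict (ext Ω ∩ Metric.ball 0 R)) ∧
        Tendsto (fun k => eLpNorm (g k - u) 2 (volume.restrict (ext Ω ∩ Metric.ball 0 R)))
          atTop (𝓝 0)) :
    ∃ K : ℝ≥0∞, K ≠ ⊤ ∧ ∀ R : ℝ, 0 < R →
      eLpNorm u 2 (volume.restrict (ext Ω ∩ Metric.ball 0 R)) ≤ K * ENNReal.ofReal R := by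
  obtain ⟨K, hK, hle⟩ := exists_eLpNorm_ball_le hn ho hc hne
  refine ⟨K * eLpNorm G 2 (volume.restrict (ext Ω)), ENNReal.mul_ne_top hK hG.eLpNorm_ne_top,
    fun R hR => ?_⟩
  have h1 : ∀ k, eLpNorm u 2 (volume.restrict (ext Ω ∩ Metric.ball 0 R)) ≤
      eLpNorm (g k - u) 2 (volume.restrict (ext Ω ∩ Metric.ball 0 R)) +
        K * ENNReal.ofReal R * (eLpNorm (∇ (g k) - G) 2 (volume.restrict (ext Ω)) +
          eLpNorm G 2 (volume.restrict (ext Ω))) := by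
    intro k
    have hgk := ((hg k).memLp (volume.restrict (ext Ω ∩ Metric.ball 0 R)) 2).1
    have hdk := ((hg k).memLp_gradient (volume.restrict (ext Ω)) 2).1
    calc eLpNorm u 2 (volume.restrict (ext Ω ∩ Metric.ball 0 R))
        = eLpNorm (g k - (g k - u)) 2 (volume.restrict (ext Ω ∩ Metric.ball 0 R)) := by
          rw [sub_sub_cancel]
      _ ≤ eLpNorm (g k) 2 (volume.restrict (ext Ω ∩ Metric.ball 0 R)) +
          eLpNorm (g k - u) 2 (volume.restrict (ext Ω ∩ Metric.ball 0 R)) :=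
        eLpNorm_sub_le hgk (hgk.sub (hu R).1.1) one_le_two
      _ ≤ K * ENNReal.ofReal R * eLpNorm (∇ (g k) - G + G) 2 (volume.restrict (ext Ω)) +
          eLpNorm (g k - u) 2 (volume.restrict (ext Ω ∩ Metric.ball 0 R)) := by
        gcongr
        rw [sub_add_cancel]
        exact hle _ (hg k) R hR
      _ ≤ _ := by
        rw [add_comm]
        gcongr
        exact eLpNorm_add_le (hdk.sub hG.1) hG.1 one_le_two
  have h2 := (hu R).2.add (ENNReal.Tendsto.const_mul
    (h.add (tendsto_const_nhds (x := eLpNorm G 2 (volume.restrict (ext Ω)))))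
    (a := K * ENNReal.ofReal R) (Or.inr (ENNReal.mul_ne_top hK ENNReal.ofReal_ne_top)))
  refine (ge_of_tendsto' h2 h1).trans_eq ?_
  rw [zero_add, zero_add]
  ring

theorem locallyIntegrable_of_memLp_ball {Ω : Set (E n)} {u : E n → ℝ}
    (hu0 : ∀ x ∉ ext Ω, u x = 0)
    (hu : ∀ R : ℝ, MemLp u 2 (volume.restrict (ext Ω ∩ Metric.ball 0 R))) :
    LocallyIntegrable u := by
  intro x
  refine ⟨Metric.ball 0 (‖x‖ + 1), Metric.isOpen_ball.mem_nhds (by simp), ?_⟩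
  have hfin : IsFiniteMeasure (volume.restrict (ext Ω ∩ Metric.ball (0 : E n) (‖x‖ + 1))) := ⟨by
    rw [Measure.restrict_apply_univ]
    exact (measure_mono inter_subset_right).trans_lt measure_ball_lt_top⟩
  have h1 := (hu (‖x‖ + 1)).integrable one_le_two
  have h2 : (ext Ω).indicator u = u := by
    ext y
    by_cases hy : y ∈ ext Ω
    · rw [indicator_of_mem hy]
    · rw [indicator_of_notMem hy, hu0 y hy]
  rw [← h2, IntegrableOn, integrable_indicator_iff (isOpen_ext Ω).measurableSet, IntegrableOn,
    Measure.restrict_restrict (isOpen_ext Ω).measurableSet]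
  exact h1

theorem exists_tsupport_subset_ball {φ : E n → ℝ} (hφ : IsTestFunction φ) :
    ∃ R : ℝ, tsupport φ ⊆ Metric.ball 0 R := by
  obtain ⟨R, hR⟩ := hφ.2.isCompact.isBounded.subset_ball (0 : E n)
  exact ⟨R, hR⟩

/-- Integration by parts for the approximants, passed to the limit. Since `φ` is supported in the
exterior, only local convergence matters. -/
theorem weak_gradient {Ω : Set (E n)} {g : ℕ → E n → ℝ} {G : E n → E n} {u : E n → ℝ}
    (hg : ∀ k, IsTestFunction (g k)) (hG : MemLp G 2 (volume.restrict (ext Ω)))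
    (h : Tendsto (fun k => eLpNorm (∇ (g k) - G) 2 (volume.restrict (ext Ω))) atTop (𝓝 0))
    (hu : ∀ R : ℝ, MemLp u 2 (volume.restrict (ext Ω ∩ Metric.ball 0 R)) ∧
        Tendsto (fun k => eLpNorm (g k - u) 2 (volume.restrict (ext Ω ∩ Metric.ball 0 R)))
          atTop (𝓝 0)) {φ : E n → ℝ} (hφ : IsTestFunction φ) (hφΩ : tsupport φ ⊆ ext Ω)
    (i : Fin n) :
    ∫ y, u y * pd i φ y = -∫ y, (ext Ω).indicator G y i * φ y := by
  obtain ⟨R, hR⟩ := exists_tsupport_subset_ball hφ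
  have hpz : ∀ y, y ∉ ext Ω ∩ Metric.ball 0 R → pd i φ y = 0 := fun y hy =>
    image_eq_zero_of_notMem_tsupport fun hy' =>
      hy ⟨hφΩ (tsupport_pd_subset _ i hy'), hR (tsupport_pd_subset _ i hy')⟩
  have hz : ∀ y, y ∉ ext Ω → φ y = 0 := fun y hy =>
    image_eq_zero_of_notMem_tsupport fun hy' => hy (hφΩ hy')
  have h1 := tendsto_integral_mul (fun k => (hg k).memLp _ 2) (hu R).1 ((hφ.pd i).memLp _ 2)
    (hu R).2
  have e1 : ∀ w : E n → ℝ, ∫ y in ext Ω ∩ Metric.ball 0 R, w y * pd i φ y =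
      ∫ y, w y * pd i φ y := fun w =>
    setIntegral_eq_integral_of_forall_compl_eq_zero fun y hy => by rw [hpz y hy, mul_zero]
  simp only [e1] at h1
  have hψ : MemLp (fun y => φ y • (EuclideanSpace.single i (1 : ℝ) : E n)) 2
      (volume.restrict (ext Ω)) := by
    refine Continuous.memLp_of_hasCompactSupport (hφ.continuous.smul continuous_const) ?_
    exact hφ.2.smul_right
  have h2 := (tendsto_integral_inner (fun k => (hg k).memLp_gradient _ 2) hG hψ h).neg
  have e2 : ∀ w : E n, ∀ y, inner ℝ w (φ y • (EuclideanSpace.single i (1 : ℝ) : E n)) =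
      w i * φ y := fun w y => by
    rw [inner_smul_right, EuclideanSpace.inner_single_right]
    simp [mul_comm]
  have e3 : ∀ w : E n → E n, ∫ y in ext Ω, w y i * φ y = ∫ y, w y i * φ y := fun w =>
    setIntegral_eq_integral_of_forall_compl_eq_zero fun y hy => by rw [hz y hy, mul_zero]
  simp only [e2, e3] at h2
  simp only [gradient_apply] at h2
  have e4 : ∫ y, (ext Ω).indicator G y i * φ y = ∫ y, G y i * φ y := by
    refine integral_congr_ae (Eventually.of_forall fun y => ?_)
    by_cases hy : y ∈ ext Ω
    · simp only [indicator_of_mem hy]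
    · simp only [hz y hy, mul_zero]
  rw [e4]
  refine tendsto_nhds_unique h1 (h2.congr fun k => ?_)
  exact (integral_mul_pd (hg k) hφ i).symm

theorem weak_harmonic {Ω : Set (E n)} {G : E n → E n} {u : E n → ℝ}
    (hG : LocallyIntegrable ((ext Ω).indicator G)) (hu : LocallyIntegrable u)
    (hgrad : ∀ φ, IsTestFunction φ → tsupport φ ⊆ ext Ω → ∀ i,
      ∫ y, u y * pd i φ y = -∫ y, (ext Ω).indicator G y i * φ y)
    (hdiv : ∀ φ, IsTestFunction φ → tsupport φ ⊆ ext Ω → ∫ x in ext Ω, inner ℝ (G x) (∇ φ x) = 0)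
    {φ : E n → ℝ} (hφ : IsTestFunction φ) (hφΩ : tsupport φ ⊆ ext Ω) :
    ∫ y, u y * lap φ y = 0 := by
  have hGi : ∀ i, LocallyIntegrable fun y => (ext Ω).indicator G y i := fun i x => by
    obtain ⟨s, hs, h⟩ := hG x
    exact ⟨s, hs, (EuclideanSpace.proj i : E n →L[ℝ] ℝ).integrable_comp h⟩
  simp only [lap, Finset.mul_sum]
  rw [integral_finsetSum _ fun i _ => ((hφ.pd i).pd i).integrable_mul hu,
    Finset.sum_congr rfl fun i _ =>
      hgrad (pd i φ) (hφ.pd i) ((tsupport_pd_subset _ _).trans hφΩ) i,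
    Finset.sum_neg_distrib, ← integral_finsetSum _ fun i _ => (hφ.pd i).integrable_mul (hGi i),
    neg_eq_zero, ← hdiv φ hφ hφΩ, ← integral_indicator (isOpen_ext Ω).measurableSet]
  refine integral_congr_ae (Eventually.of_forall fun y => ?_)
  by_cases hy : y ∈ ext Ω
  · simp only [indicator_of_mem hy, inner_eq_sum, gradient_apply]
  · simp [indicator_of_notMem hy]

/-! ### Cutoffs and decay at infinity. -/

/-- Smooth cutoff functions `η R`, equal to `1` on the ball of radius `R` and supported in the
ball of radius `2 R`, with scale invariant bounds. -/
structure IsCutoffFamily (η : ℝ → E n → ℝ) (B : ℝ) : Prop where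
  nonneg_const : 0 ≤ B
  isTestFunction : ∀ R, 0 < R → IsTestFunction (η R)
  eq_one : ∀ R, 0 < R → ∀ y, ‖y‖ ≤ R → η R y = 1
  eq_zero : ∀ R, 0 < R → ∀ y, 2 * R ≤ ‖y‖ → η R y = 0
  abs_pd_le : ∀ R, 0 < R → ∀ i y, |pd i (η R) y| ≤ B * R⁻¹
  abs_lap_le : ∀ R, 0 < R → ∀ y, |lap (η R) y| ≤ B * R⁻¹ ^ 2

theorem exists_isCutoffFamily (n : ℕ) : ∃ (η : ℝ → E n → ℝ) (B : ℝ), IsCutoffFamily η B := by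
  let f : ContDiffBump (0 : E n) := ⟨1, 2, one_pos, one_lt_two⟩
  have hf : IsTestFunction f := ⟨f.contDiff, f.hasCompactSupport⟩
  have hb : ∀ i : Fin n, ∃ B, ∀ y, ‖pd i f y‖ ≤ B := fun i =>
    (hf.pd i).2.exists_bound_of_continuous (hf.pd i).continuous
  choose b hb using hb
  obtain ⟨b', hb'⟩ := hf.lap.2.exists_bound_of_continuous hf.lap.continuous
  have hnorm : ∀ {R : ℝ}, 0 < R → ∀ y : E n, ‖R⁻¹ • y‖ = ‖y‖ / R := fun hR y => by
    rw [norm_smul, norm_inv, Real.norm_of_nonneg hR.le, div_eq_inv_mul]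
  refine ⟨fun R y => f (R⁻¹ • y), ∑ i, |b i| + |b'|, by positivity, fun R hR => ⟨?_, ?_⟩,
    fun R hR y hy => ?_, fun R hR y hy => ?_,
    fun R hR i y => ?_, fun R hR y => ?_⟩
  · exact hf.1.comp (contDiff_const_smul _)
  · refine HasCompactSupport.intro (isCompact_closedBall (0 : E n) (2 * R)) fun y hy => ?_
    refine f.zero_of_le_dist ?_
    rw [mem_closedBall_zero_iff, not_le] at hy
    rw [dist_zero_right, hnorm hR, le_div_iff₀ hR]
    exact hy.le
  · refine f.one_of_mem_closedBall ?_
    rw [mem_closedBall_zero_iff, hnorm hR, div_le_iff₀ hR]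
    simpa [f] using hy
  · refine f.zero_of_le_dist ?_
    rw [dist_zero_right, hnorm hR, le_div_iff₀ hR]
    exact hy
  · have h := pd_comp_affine hf.differentiable 0 R⁻¹ i y
    simp only [zero_add] at h
    rw [h, abs_mul, abs_of_pos (inv_pos.mpr hR), mul_comm]
    have h1 : |b i| ≤ ∑ i, |b i| :=
      Finset.single_le_sum (f := fun i => |b i|) (fun _ _ => abs_nonneg _) (Finset.mem_univ i)
    have h2 := hb i (R⁻¹ • y)
    rw [Real.norm_eq_abs] at h2
    gcongr
    linarith [le_abs_self (b i), abs_nonneg b']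
  · have h := lap_comp_affine hf.1 0 R⁻¹ y
    simp only [zero_add] at h
    rw [h, abs_mul, abs_of_nonneg (by positivity : 0 ≤ R⁻¹ ^ 2), mul_comm]
    have h2 := hb' (R⁻¹ • y)
    rw [Real.norm_eq_abs] at h2
    have h1 : 0 ≤ ∑ i, |b i| := by positivity
    gcongr
    linarith [le_abs_self b']

namespace IsCutoffFamily

variable {η : ℝ → E n → ℝ} {B : ℝ}

theorem eventuallyEq_const (hη : IsCutoffFamily η B) {R : ℝ} (hR : 0 < R) {y : E n}
    (hy : ‖y‖ < R ∨ 2 * R < ‖y‖) : ∃ a : ℝ, η R =ᶠ[𝓝 y] fun _ => a := by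
  rcases hy with hy | hy
  · refine ⟨1, ?_⟩
    filter_upwards [continuous_norm.continuousAt.eventually_lt_const hy] with z hz
    exact hη.eq_one R hR z hz.le
  · refine ⟨0, ?_⟩
    filter_upwards [continuous_norm.continuousAt.eventually_const_lt hy] with z hz
    exact hη.eq_zero R hR z hz.le

theorem pd_eq_zero (hη : IsCutoffFamily η B) {R : ℝ} (hR : 0 < R) {y : E n}
    (hy : ‖y‖ < R ∨ 2 * R < ‖y‖) (i : Fin n) : pd i (η R) y = 0 := by
  obtain ⟨a, ha⟩ := hη.eventuallyEq_const hR hy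
  rw [pd_congr ha]
  simp [pd]

theorem lap_eq_zero (hη : IsCutoffFamily η B) {R : ℝ} (hR : 0 < R) {y : E n}
    (hy : ‖y‖ < R ∨ 2 * R < ‖y‖) : lap (η R) y = 0 := by
  obtain ⟨a, ha⟩ := hη.eventuallyEq_const hR hy
  rw [lap_congr ha]
  have : ∀ i : Fin n, pd i (fun _ : E n => a) = fun _ => 0 := fun i => by
    funext z
    simp [pd]
  simp only [lap, this]
  simp [pd]

end IsCutoffFamily

/-- The commutator of the Laplacian with multiplication by `η`, applied to `Ψ`. -/
noncomputable def cutoffError (η Ψ : E n → ℝ) (y : E n) : ℝ :=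
  2 * ∑ i, pd i η y * pd i Ψ y + Ψ y * lap η y

theorem isTestFunction_cutoffError {η Ψ : E n → ℝ} (hη : IsTestFunction η)
    (hΨ : ContDiff ℝ ∞ Ψ) : IsTestFunction (cutoffError η Ψ) := by
  refine ⟨(contDiff_const.mul (ContDiff.sum fun i _ => (contDiff_pd hη.1 i).mul
    (contDiff_pd hΨ i))).add (hΨ.mul (contDiff_lap hη.1)),
    HasCompactSupport.intro hη.2.isCompact fun y hy => ?_⟩
  have h1 : ∀ i, pd i η y = 0 := fun i =>
    image_eq_zero_of_notMem_tsupport fun h => hy (tsupport_pd_subset _ i h)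
  have h2 : lap η y = 0 :=
    image_eq_zero_of_notMem_tsupport fun h => hy (tsupport_lap_subset _ h)
  simp [cutoffError, h1, h2]

/-- Estimate of the cutoff error against the smoothed fundamental solution. -/
theorem abs_integral_cutoffError_le {Φ : E n → ℝ} {c : ℝ}
    (hΦ : IsSmoothedFundamentalSolution Φ c) (hn : 2 ≤ n) {η : ℝ → E n → ℝ} {B : ℝ}
    (hη : IsCutoffFamily η B) {u : E n → ℝ} (hu : LocallyIntegrable u) {R ρ : ℝ} (hR : 0 < R)
    (hρ : 1 ≤ ρ) {x : E n} (hx : ∀ y, R ≤ ‖y‖ → ‖y‖ ≤ 2 * R → ρ ≤ ‖x - y‖) :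
    |∫ y, u y * cutoffError (η R) (fun y => scaledKernel Φ 1 (x - y)) y| ≤
      (2 * (n * (B * R⁻¹ * (c * n * ρ⁻¹ ^ (n - 1)))) + c * ρ⁻¹ ^ (n - 2) * (B * R⁻¹ ^ 2)) *
        ∫ y in Metric.ball 0 (3 * R), |u y| := by
  set M := 2 * (n * (B * R⁻¹ * (c * n * ρ⁻¹ ^ (n - 1)))) + c * ρ⁻¹ ^ (n - 2) * (B * R⁻¹ ^ 2)
  have hB := hη.nonneg_const
  have hc := hΦ.pos
  have hρ0 : 0 < ρ := by linarith
  have hM : 0 ≤ M := by positivity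
  have hpt : ∀ y, ‖u y * cutoffError (η R) (fun y => scaledKernel Φ 1 (x - y)) y‖ ≤
      (Metric.ball 0 (3 * R)).indicator (fun y => M * |u y|) y := by
    intro y
    -- The commutator lives where the cutoff varies, on the annulus `R ≤ ‖y‖ ≤ 2 R`, where the
    -- explicit formulas for the kernel apply.
    by_cases hy : ‖y‖ < R ∨ 2 * R < ‖y‖
    · have h0 : cutoffError (η R) (fun y => scaledKernel Φ 1 (x - y)) y = 0 := by
        simp [cutoffError, hη.pd_eq_zero hR hy, hη.lap_eq_zero hR hy]
      rw [h0, mul_zero, norm_zero]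
      exact indicator_nonneg (fun z _ => by positivity) y
    · push Not at hy
      have hy2 := hx y hy.1 hy.2
      have hz : 1 ≤ ‖x - y‖ := hρ.trans hy2
      have hinv : ‖x - y‖⁻¹ ≤ ρ⁻¹ := by gcongr
      rw [indicator_of_mem (by rw [mem_ball_zero_iff]; linarith), norm_mul, Real.norm_eq_abs,
        Real.norm_eq_abs, mul_comm]
      gcongr
      refine (abs_add_le _ _).trans (add_le_add ?_ ?_)
      · rw [abs_mul, abs_two]
        gcongr
        refine (Finset.abs_sum_le_sum_abs _ _).trans ?_
        refine (Finset.sum_le_card_nsmul _ _ (B * R⁻¹ * (c * n * ρ⁻¹ ^ (n - 1)))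
          fun i _ => ?_).trans_eq (by simp)
        rw [pd_comp_sub (differentiable_of_smooth (hΦ.contDiff_scaledKernel 1)), abs_mul, abs_neg]
        refine mul_le_mul (hη.abs_pd_le R hR i y) ?_ (abs_nonneg _) (by positivity)
        refine (hΦ.abs_pd_scaledKernel_le hn one_pos hz i).trans ?_
        gcongr
      · rw [abs_mul]
        refine mul_le_mul ?_ (hη.abs_lap_le R hR y) (abs_nonneg _) (by positivity)
        change |scaledKernel Φ 1 (x - y)| ≤ _
        rw [hΦ.scaledKernel_eq one_pos hz, abs_of_nonneg (by positivity)]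
        gcongr
  have hint : IntegrableOn u (Metric.ball 0 (3 * R)) :=
    (hu.integrableOn_isCompact (isCompact_closedBall 0 (3 * R))).mono_set
      Metric.ball_subset_closedBall
  rw [← Real.norm_eq_abs]
  refine (norm_integral_le_of_norm_le ?_ (Eventually.of_forall hpt)).trans_eq ?_
  · rw [integrable_indicator_iff Metric.isOpen_ball.measurableSet]
    exact hint.abs.const_mul M
  · rw [integral_indicator Metric.isOpen_ball.measurableSet, integral_const_mul]

/-- A Green representation without boundary integrals: weak harmonicity is tested with `η R - η r`
times the kernel centred at `x`. Its Laplacian consists of the mollifier at `x` and of commutators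
on two annuli. -/
theorem conv_mollifier_eq_cutoffError {Φ : E n → ℝ} {c : ℝ}
    (hΦ : IsSmoothedFundamentalSolution Φ c) (hn : 2 ≤ n) {η : ℝ → E n → ℝ} {B : ℝ}
    (hη : IsCutoffFamily η B) {U : Set (E n)} {u : E n → ℝ} (hu : LocallyIntegrable u)
    (hharm : ∀ φ, IsTestFunction φ → tsupport φ ⊆ U → ∫ y, u y * lap φ y = 0)
    {r R : ℝ} (hr : 0 < r) (hU : (Metric.ball 0 r)ᶜ ⊆ U) {x : E n} (hx : 2 * r + 1 ≤ ‖x‖)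
    (hxR : ‖x‖ + 1 ≤ R) :
    conv u (mollifier Φ 1) x =
      (∫ y, u y * cutoffError (η R) (fun y => scaledKernel Φ 1 (x - y)) y) -
        ∫ y, u y * cutoffError (η r) (fun y => scaledKernel Φ 1 (x - y)) y := by
  have hR : 0 < R := by linarith
  have hrR : r ≤ R := by linarith
  set Ψ : E n → ℝ := fun y => scaledKernel Φ 1 (x - y) with hΨdef
  have hΨ : ContDiff ℝ ∞ Ψ := (hΦ.contDiff_scaledKernel 1).comp (contDiff_const.sub contDiff_id)
  have hlΨ : ∀ y, lap Ψ y = -mollifier Φ 1 (x - y) := fun y => by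
    rw [hΨdef, lap_comp_sub (hΦ.contDiff_scaledKernel 1), mollifier, neg_neg]
  have h1 := hη.isTestFunction R hR
  have h2 := hη.isTestFunction r hr
  have hζ : ContDiff ℝ ∞ fun y => η R y - η r y := h1.1.sub h2.1
  have htest : IsTestFunction fun y => (η R y - η r y) * Ψ y :=
    ⟨hζ.mul hΨ, (h1.2.sub h2.2).mul_right⟩
  have h := hharm _ htest <| by
    refine (closure_minimal (fun y hy => ?_) Metric.isOpen_ball.isClosed_compl).trans hU
    intro hy'
    rw [mem_ball_zero_iff] at hy'
    exact hy (by simp [hη.eq_one R hR y (by linarith), hη.eq_one r hr y hy'.le])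
  have hm := (hΦ.isTestFunction_mollifier hn one_pos).comp_sub x
  have hpt : ∀ y, u y * lap (fun y => (η R y - η r y) * Ψ y) y =
      u y * cutoffError (η R) Ψ y - u y * cutoffError (η r) Ψ y - u y * mollifier Φ 1 (x - y) := by
    intro y
    have hsum : ∑ i, pd i (fun y => η R y - η r y) y * pd i Ψ y =
        ∑ i, pd i (η R) y * pd i Ψ y - ∑ i, pd i (η r) y * pd i Ψ y := by
      rw [← Finset.sum_sub_distrib]
      refine Finset.sum_congr rfl fun i _ => ?_
      rw [pd_sub h1.differentiable h2.differentiable]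
      ring
    -- On the unit ball about `x` the outer cutoff is one and the inner one zero, by the two
    -- conditions on `‖x‖`.
    have hmol : (η R y - η r y) * mollifier Φ 1 (x - y) = mollifier Φ 1 (x - y) := by
      rcases lt_or_ge 1 ‖x - y‖ with hxy | hxy
      · rw [hΦ.mollifier_eq_zero hn one_pos hxy, mul_zero]
      · have h3 := norm_sub_norm_le x y
        have h4 := norm_sub_norm_le y x
        rw [norm_sub_rev] at h4
        rw [hη.eq_one R hR y (by linarith), hη.eq_zero r hr y (by linarith)]
        ring
    rw [lap_mul hζ hΨ, lap_sub h1.1 h2.1, hsum, hlΨ, mul_neg, hmol, cutoffError, cutoffError]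
    ring
  simp only [hpt] at h
  have i1 := (isTestFunction_cutoffError h1 hΨ).integrable_mul hu
  have i2 := (isTestFunction_cutoffError h2 hΨ).integrable_mul hu
  rw [integral_sub (f := fun y => u y * cutoffError (η R) Ψ y - u y * cutoffError (η r) Ψ y)
    (i1.sub i2) (hm.integrable_mul hu), integral_sub i1 i2] at h
  exact (sub_eq_zero.mp h).symm

theorem exists_integral_abs_ball_le {Ω : Set (E n)} {u : E n → ℝ}
    (hu0 : ∀ x ∉ ext Ω, u x = 0) (hum : LocallyIntegrable u) {K : ℝ≥0∞} (hK : K ≠ ⊤)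
    (hu : ∀ R : ℝ, 0 < R →
      eLpNorm u 2 (volume.restrict (ext Ω ∩ Metric.ball 0 R)) ≤ K * ENNReal.ofReal R) :
    ∃ k : ℝ, 0 ≤ k ∧ ∀ R : ℝ, 0 < R →
      ∫ y in Metric.ball 0 R, |u y| ≤ k * (R * √(R ^ n)) := by
  refine ⟨√((K ^ 2 * ballVol n).toReal), Real.sqrt_nonneg _, fun R hR => ?_⟩
  have hfin : K ^ 2 * ballVol n ≠ ⊤ := ENNReal.mul_ne_top (ENNReal.pow_ne_top hK) ballVol_ne_top
  have hmeas := (isOpen_ext Ω).measurableSet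
  have hum' : AEStronglyMeasurable u volume := hum.aestronglyMeasurable
  have h1 : ∫⁻ y in Metric.ball 0 R, ‖u y‖ₑ ^ 2 ≤ (K * ENNReal.ofReal R) ^ 2 := by
    have h2 : ∫⁻ y in Metric.ball 0 R, ‖u y‖ₑ ^ 2 =
        ∫⁻ y in ext Ω ∩ Metric.ball 0 R, ‖u y‖ₑ ^ 2 := by
      rw [← Measure.restrict_restrict hmeas, ← lintegral_indicator hmeas]
      refine lintegral_congr fun y => ?_
      by_cases hy : y ∈ ext Ω
      · rw [indicator_of_mem hy]
      · rw [indicator_of_notMem hy, hu0 y hy]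
        simp
    rw [h2, ← eLpNorm_two_sq]
    gcongr
    exact hu R hR
  have h3 := lintegral_mul_sq_le (volume.restrict (Metric.ball (0 : E n) R))
    (hum'.enorm.restrict) (measurable_const (a := (1 : ℝ≥0∞))).aemeasurable
  simp only [mul_one, one_pow, lintegral_const, Measure.restrict_apply_univ, one_mul] at h3
  rw [volume_ball_eq 0 hR] at h3
  have h4 : (∫⁻ y in Metric.ball 0 R, ‖u y‖ₑ) ^ 2 ≤
      ENNReal.ofReal ((√((K ^ 2 * ballVol n).toReal) * (R * √(R ^ n))) ^ 2) := by
    refine (h3.trans (mul_le_mul_left h1 _)).trans_eq ?_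
    rw [mul_pow K, mul_pow (√((K ^ 2 * ballVol n).toReal)), mul_pow R,
      Real.sq_sqrt ENNReal.toReal_nonneg, Real.sq_sqrt (by positivity),
      ENNReal.ofReal_mul ENNReal.toReal_nonneg, ENNReal.ofReal_toReal hfin,
      ENNReal.ofReal_mul (by positivity), ENNReal.ofReal_pow hR.le, ENNReal.ofReal_pow hR.le]
    ring
  rw [ENNReal.ofReal_pow (by positivity), ENNReal.pow_le_pow_left_iff two_ne_zero] at h4
  calc ∫ y in Metric.ball 0 R, |u y| = (∫⁻ y in Metric.ball 0 R, ‖u y‖ₑ).toReal := by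
        simp only [← Real.norm_eq_abs]
        exact integral_norm_eq_lintegral_enorm hum'.restrict
    _ ≤ _ := by
        refine (ENNReal.toReal_mono ENNReal.ofReal_ne_top h4).trans_eq ?_
        exact ENNReal.toReal_ofReal (by positivity)

/-- Weakly harmonic functions of slow growth outside a ball decay like the fundamental solution. -/
theorem exists_abs_le_of_weakly_harmonic {Φ : E n → ℝ} {c : ℝ}
    (hΦ : IsSmoothedFundamentalSolution Φ c) (hn : 3 ≤ n) {U : Set (E n)} {u : E n → ℝ}
    (hu : LocallyIntegrable u)
    (hharm : ∀ φ, IsTestFunction φ → tsupport φ ⊆ U → ∫ y, u y * lap φ y = 0)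
    {k : ℝ} (hk0 : 0 ≤ k)
    (hk : ∀ R : ℝ, 0 < R → ∫ y in Metric.ball 0 R, |u y| ≤ k * (R * √(R ^ n)))
    {r : ℝ} (hr : 0 < r) (hU : (Metric.ball 0 r)ᶜ ⊆ U) :
    ∃ C : ℝ, ∀ x : E n, 4 * r + 2 ≤ ‖x‖ →
      |conv u (mollifier Φ 1) x| ≤ C * ‖x‖⁻¹ ^ (n - 2) := by
  obtain ⟨η, B, hη⟩ := exists_isCutoffFamily n
  have hB := hη.nonneg_const
  have hc := hΦ.pos
  set I := ∫ y in Metric.ball 0 (3 * r), |u y|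
  have hI : 0 ≤ I := integral_nonneg fun _ => abs_nonneg _
  refine ⟨(2 * (n * (B * r⁻¹ * (c * n * 2 ^ (n - 2)))) + c * 2 ^ (n - 2) * (B * r⁻¹ ^ 2)) * I,
    fun x hx => ?_⟩
  have hx0 : 0 < ‖x‖ := by linarith
  set T : ℝ → ℝ := fun R => ∫ y, u y * cutoffError (η R) (fun y => scaledKernel Φ 1 (x - y)) y
    with hT
  have hT0 : conv u (mollifier Φ 1) x = -T r := by
    have hlim : Tendsto T atTop (𝓝 0) := by
      set D := 2 * (n * (B * (c * n * 2 ^ (n - 1)))) + c * 2 ^ (n - 2) * B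
      have hD : 0 ≤ D := by positivity
      -- The commutator is `O(R^(-n))` and the integral of `|u|` is `O(R^(1+n/2))`. The product is
      -- `O(R^(1-n/2))`, hence `O(R^(-1/2))` by `n ≥ 3`.
      have hle : ∀ᶠ R in atTop, |T R| ≤ D * (k * (3 * √(3 ^ n))) * (√R)⁻¹ := by
        filter_upwards [eventually_ge_atTop (2 * ‖x‖ + 2)] with R hR
        have hR0 : 0 < R := by linarith
        have hR1 : 1 ≤ R := by linarith
        have h1 := abs_integral_cutoffError_le hΦ (by omega) hη hu hR0 (ρ := R / 2) (x := x)
          (by linarith) (fun y hy _ => by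
            have := norm_sub_norm_le y x
            rw [norm_sub_rev] at this
            linarith)
        refine h1.trans ?_
        have e1 : 2 * (n * (B * R⁻¹ * (c * n * (R / 2)⁻¹ ^ (n - 1)))) +
            c * (R / 2)⁻¹ ^ (n - 2) * (B * R⁻¹ ^ 2) = D * R⁻¹ ^ n := by
          obtain ⟨p, rfl⟩ : ∃ p, n = p + 2 := ⟨n - 2, by omega⟩
          rw [show p + 2 - 1 = p + 1 by omega, show p + 2 - 2 = p by omega]
          simp only [D, div_eq_mul_inv, mul_inv, inv_inv]
          rw [show p + 2 - 1 = p + 1 by omega, show p + 2 - 2 = p by omega]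
          ring
        rw [e1]
        have e2 := hk (3 * R) (by positivity)
        calc D * R⁻¹ ^ n * ∫ y in Metric.ball 0 (3 * R), |u y|
            ≤ D * R⁻¹ ^ n * (k * (3 * R * √((3 * R) ^ n))) := by gcongr
          _ = D * (k * (3 * √(3 ^ n))) * (R * (R⁻¹ ^ n * √(R ^ n))) := by
            rw [mul_pow, Real.sqrt_mul (by positivity)]
            ring
          _ ≤ D * (k * (3 * √(3 ^ n))) * (√R)⁻¹ := by
            refine mul_le_mul_of_nonneg_left ?_ (by positivity)
            have hs : 0 < √(R ^ n) := Real.sqrt_pos.mpr (by positivity)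
            have hs2 : √(R ^ n) * √(R ^ n) = R ^ n := Real.mul_self_sqrt (by positivity)
            have e3 : R⁻¹ ^ n * √(R ^ n) = (√(R ^ n))⁻¹ := by
              refine eq_inv_of_mul_eq_one_left ?_
              rw [mul_assoc, hs2, ← mul_pow, inv_mul_cancel₀ hR0.ne', one_pow]
            have e4 : R * √R ≤ √(R ^ n) := by
              refine Real.le_sqrt_of_sq_le ?_
              rw [mul_pow, Real.sq_sqrt hR0.le, ← pow_succ]
              exact pow_le_pow_right₀ hR1 hn
            rw [e3, ← div_eq_mul_inv, div_le_iff₀ hs, ← div_eq_inv_mul,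
              le_div_iff₀ (Real.sqrt_pos.mpr hR0)]
            exact e4
      refine squeeze_zero_norm' (by simpa using hle) ?_
      have h5 : Tendsto (fun R : ℝ => (√R)⁻¹) atTop (𝓝 0) :=
        (Real.tendsto_sqrt_atTop).inv_tendsto_atTop
      simpa using h5.const_mul (D * (k * (3 * √(3 ^ n))))
    have heq : ∀ᶠ R in atTop, T R - T r = conv u (mollifier Φ 1) x := by
      filter_upwards [eventually_ge_atTop (‖x‖ + 1)] with R hR
      exact (conv_mollifier_eq_cutoffError hΦ (by omega) hη hu hharm hr hU (by linarith) hR).symm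
    have := (hlim.sub_const (T r)).congr' heq
    rw [tendsto_nhds_unique tendsto_const_nhds this, zero_sub]
  rw [hT0, abs_neg]
  have hx2 : 1 ≤ ‖x‖ / 2 := by linarith
  refine (abs_integral_cutoffError_le hΦ (by omega) hη hu hr (ρ := ‖x‖ / 2) hx2
    (fun y _ hy => by
      have := norm_sub_norm_le x y
      linarith)).trans ?_
  refine (mul_le_mul_of_nonneg_right ?_ hI).trans_eq (mul_right_comm _ _ _)
  have e1 : (‖x‖ / 2)⁻¹ ^ (n - 2) = 2 ^ (n - 2) * ‖x‖⁻¹ ^ (n - 2) := by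
    rw [inv_div, div_eq_mul_inv, mul_pow]
  -- The gradient term decays one power faster than needed, and the surplus is discarded.
  have e2 : (‖x‖ / 2)⁻¹ ^ (n - 1) ≤ (‖x‖ / 2)⁻¹ ^ (n - 2) :=
    pow_le_pow_of_le_one (by positivity) (inv_le_one_of_one_le₀ hx2) (by omega)
  calc _ ≤ 2 * (n * (B * r⁻¹ * (c * n * (‖x‖ / 2)⁻¹ ^ (n - 2)))) +
        c * (‖x‖ / 2)⁻¹ ^ (n - 2) * (B * r⁻¹ ^ 2) := by gcongr
    _ = _ := by
      rw [e1]
      ring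

theorem isBigO_zpow_of_abs_le {Ω : Set (E n)} {v : E n → ℝ} (hn : 2 ≤ n) {C ρ : ℝ}
    (h : ∀ x, ρ ≤ ‖x‖ → |v x| ≤ C * ‖x‖⁻¹ ^ (n - 2)) :
    v =O[Bornology.cobounded (E n) ⊓ 𝓟 (ext Ω)] fun x => ‖x‖ ^ (2 - (n : ℤ)) := by
  refine Asymptotics.IsBigO.of_bound C ?_
  refine Filter.Eventually.filter_mono inf_le_left ?_
  filter_upwards [eventually_cobounded_le_norm ρ] with x hx
  have e : ‖x‖ ^ (2 - (n : ℤ)) = ‖x‖⁻¹ ^ (n - 2) := by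
    rw [inv_pow, ← zpow_natCast, ← zpow_neg, Nat.cast_sub hn]
    congr 1
    push_cast
    ring
  rw [Real.norm_eq_abs, e, Real.norm_of_nonneg (by positivity)]
  exact h x hx

/-! ### Extremals are eigenfunctions. -/

/-- The extremals of the trace inequality are represented by genuine eigenfunctions. -/
theorem exists_isEigenfunction (hn : 3 ≤ n) {Ω : Set (E n)} (ho : IsOpen Ω)
    (hc : Convex ℝ Ω) (hne : Ω.Nonempty) (hb : Bornology.IsBounded Ω) {τ : ℝ} (hτ : 0 < τ)
    {g : ℕ → E n → ℝ} {G : E n → E n} {f : E n → ℝ} (hg : ∀ k, IsTestFunction (g k))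
    (hG : MemLp G 2 (volume.restrict (ext Ω))) (hf : MemLp f 2 (surfaceMeasure Ω))
    (hgG : Tendsto (fun k => eLpNorm (∇ (g k) - G) 2 (volume.restrict (ext Ω))) atTop (𝓝 0))
    (hgf : Tendsto (fun k => eLpNorm (g k - f) 2 (surfaceMeasure Ω)) atTop (𝓝 0))
    (hG0 : ¬ G =ᵐ[volume.restrict (ext Ω)] 0)
    (hfG : ∀ φ : E n → ℝ, IsTestFunction φ → ∫ x, f x * φ x ∂(surfaceMeasure Ω) =
      τ ^ 2 * ∫ x in ext Ω, inner ℝ (G x) (∇ φ x)) :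
    ∃ v, IsEigenfunction Ω (τ ^ 2)⁻¹ v := by
  have hmeas := (isOpen_ext Ω).measurableSet
  have hτ2 : τ ^ 2 ≠ 0 := by positivity
  obtain ⟨u, hu0, hu⟩ := exists_local_limit hn ho hc hne hg hG hgG
  have hul := locallyIntegrable_of_memLp_ball hu0 fun R => (hu R).1
  have hGl : LocallyIntegrable ((ext Ω).indicator G) :=
    ((memLp_indicator_iff_restrict hmeas).mpr hG).locallyIntegrable one_le_two
  have hgrad := fun φ (hφ : IsTestFunction φ) (hφΩ : tsupport φ ⊆ ext Ω) i =>
    weak_gradient hg hG hgG hu hφ hφΩ i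
  -- A test function supported in the open exterior vanishes on the frontier, so the boundary term
  -- of the Euler–Lagrange equation drops out.
  have hdiv : ∀ φ, IsTestFunction φ → tsupport φ ⊆ ext Ω →
      ∫ x in ext Ω, inner ℝ (G x) (∇ φ x) = 0 := by
    intro φ hφ hφΩ
    have h1 := hfG φ hφ
    have h2 : ∫ x, f x * φ x ∂(surfaceMeasure Ω) = 0 := by
      refine integral_eq_zero_of_ae ?_
      filter_upwards [ae_mem_frontier Ω] with x hx
      have : φ x = 0 := image_eq_zero_of_notMem_tsupport fun h =>
        hφΩ h (frontier_subset_closure hx)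
      rw [this, mul_zero, Pi.zero_apply]
    rw [h2] at h1
    exact (mul_eq_zero.mp h1.symm).resolve_left hτ2
  have hharm := fun φ (hφ : IsTestFunction φ) (hφΩ : tsupport φ ⊆ ext Ω) =>
    weak_harmonic hGl hul hgrad hdiv hφ hφΩ
  obtain ⟨Φ, c, hΦ⟩ := exists_isSmoothedFundamentalSolution hn
  obtain ⟨v, hv, hvu, hvG, hrep⟩ := hΦ.exists_harmonic_representative (by omega) (isOpen_ext Ω)
    hul hGl hharm hgrad
  have hvu' : ∀ᵐ x ∂(volume.restrict (ext Ω)), v x = u x :=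
    (ae_restrict_iff' hmeas).mpr hvu
  have hvG' : ∀ᵐ x ∂(volume.restrict (ext Ω)), ∇ v x = G x := by
    refine (ae_restrict_iff' hmeas).mpr (hvG.mono fun x hx hxΩ => ?_)
    rw [hx hxΩ, indicator_of_mem hxΩ]
  have hsub : ∀ R : ℝ, volume.restrict (ext Ω ∩ Metric.ball 0 R) ≤ volume.restrict (ext Ω) :=
    fun R => Measure.restrict_mono_set _ inter_subset_left
  have hvuR : ∀ R : ℝ, v =ᵐ[volume.restrict (ext Ω ∩ Metric.ball 0 R)] u :=
    fun R => ae_mono (hsub R) hvu'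
  have hvGR : ∀ R : ℝ, ∇ v =ᵐ[volume.restrict (ext Ω ∩ Metric.ball 0 R)] G :=
    fun R => ae_mono (hsub R) hvG'
  refine ⟨v, ?_, fun R => ⟨(hu R).1.ae_eq (hvuR R).symm,
    (hG.mono_measure (hsub R)).ae_eq (hvGR R).symm⟩, hv, ⟨f, ⟨hf, g, hg, fun R => ⟨?_, ?_⟩, hgf⟩,
    fun φ hφ => ?_⟩, ?_⟩
  -- If `v` vanished on the exterior, so would its gradient, contradicting `hG0`.
  · by_contra! h
    refine hG0 ?_
    filter_upwards [hvG', ae_restrict_mem hmeas] with x hx hxΩ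
    have h1 : v =ᶠ[𝓝 x] fun _ => 0 := by
      filter_upwards [(isOpen_ext Ω).mem_nhds hxΩ] with y hy
      exact h y hy
    rw [← hx, gradient, h1.fderiv_eq]
    simp
  · exact (hu R).2.congr fun k => eLpNorm_congr_ae (EventuallyEq.rfl.sub (hvuR R).symm)
  · have h1 : Tendsto (fun k => eLpNorm (∇ (g k) - G) 2
        (volume.restrict (ext Ω ∩ Metric.ball 0 R))) atTop (𝓝 0) :=
      tendsto_of_tendsto_of_tendsto_of_le_of_le tendsto_const_nhds hgG (fun _ => zero_le)
        fun k => eLpNorm_mono_measure _ (hsub R)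
    exact h1.congr fun k => eLpNorm_congr_ae (EventuallyEq.rfl.sub (hvGR R).symm)
  · rw [hfG φ hφ, ← mul_assoc, inv_mul_cancel₀ hτ2, one_mul]
    refine integral_congr_ae ?_
    filter_upwards [hvG'] with x hx
    rw [hx]
  · obtain ⟨K, hK, hKu⟩ := exists_eLpNorm_limit_le hn ho hc hne hg hG hgG hu
    obtain ⟨k, hk0, hk⟩ := exists_integral_abs_ball_le hu0 hul hK hKu
    obtain ⟨r, hr⟩ := hb.closure.subset_ball (0 : E n)
    have hr' : (Metric.ball (0 : E n) (|r| + 1))ᶜ ⊆ ext Ω := by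
      refine compl_subset_compl.mpr (hr.trans (Metric.ball_subset_ball ?_))
      linarith [le_abs_self r]
    obtain ⟨C, hC⟩ := exists_abs_le_of_weakly_harmonic hΦ hn hul hharm hk0 hk
      (r := |r| + 1) (by positivity) hr'
    refine isBigO_zpow_of_abs_le (by omega) (C := C) (ρ := 4 * (|r| + 1) + 2) fun x hx => ?_
    rw [hrep x 1 one_pos]
    · exact hC x hx
    · refine fun y hy => hr' ?_
      rw [Metric.mem_closedBall, dist_eq_norm, norm_sub_rev] at hy
      rw [mem_compl_iff, mem_ball_zero_iff, not_lt]
      have := norm_sub_norm_le x y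
      linarith [abs_nonneg r]

/-! ### Lower bound for all eigenvalues. -/

theorem integral_inner_self_eq {α H : Type*} [MeasurableSpace α] [NormedAddCommGroup H]
    [InnerProductSpace ℝ H] {m : Measure α} {F : α → H} (hF : MemLp F 2 m) :
    ∫ x, inner ℝ (F x) (F x) ∂m = (eLpNorm F 2 m).toReal ^ 2 := by
  rw [← Lp.norm_toLp F hF, ← real_inner_self_eq_norm_sq, L2.inner_def]
  refine integral_congr_ae ?_
  filter_upwards [hF.coeFn_toLp] with x hx
  rw [hx]

/-- The gradient of the product `ζ u`. -/
noncomputable def productGradient (ζ u : E n → ℝ) (x : E n) : E n := ζ x • ∇ u x + u x • ∇ ζ x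

theorem gradient_mul {ζ u : E n → ℝ} (hζ : Differentiable ℝ ζ) (hu : Differentiable ℝ u) :
    ∇ (fun x => ζ x * u x) = productGradient ζ u := by
  funext x
  ext i
  rw [gradient_apply, pd_mul hζ hu]
  simp [productGradient, gradient_apply]

theorem IsTestFunction.mul {φ ψ : E n → ℝ} (hφ : IsTestFunction φ) (hψ : IsTestFunction ψ) :
    IsTestFunction fun x => φ x * ψ x :=
  ⟨hφ.1.mul hψ.1, hφ.2.mul_right⟩

theorem IsTestFunction.exists_bound {ζ : E n → ℝ} (hζ : IsTestFunction ζ) :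
    ∃ c : ℝ, 0 ≤ c ∧ (∀ x, ‖ζ x‖ ≤ c) ∧ ∀ x, ‖∇ ζ x‖ ≤ c := by
  obtain ⟨c₁, h₁⟩ := hζ.2.exists_bound_of_continuous hζ.continuous
  obtain ⟨c₂, h₂⟩ := hζ.hasCompactSupport_gradient.exists_bound_of_continuous
    (continuous_gradient hζ.contDiff_one)
  exact ⟨max (max c₁ c₂) 0, le_max_right _ _,
    fun x => (h₁ x).trans ((le_max_left _ _).trans (le_max_left _ _)),
    fun x => (h₂ x).trans ((le_max_right _ _).trans (le_max_left _ _))⟩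

theorem memLp_productGradient {ζ u : E n → ℝ} (hζ : IsTestFunction ζ) {m : Measure (E n)}
    (hu : MemLp u 2 m) (hdu : MemLp (∇ u) 2 m) : MemLp (productGradient ζ u) 2 m := by
  obtain ⟨c, hc, h1, h2⟩ := hζ.exists_bound
  refine MemLp.add ?_ ?_
  · refine MemLp.of_le_mul (c := c) hdu
      (hζ.continuous.aestronglyMeasurable.smul hdu.1) (Eventually.of_forall fun x => ?_)
    rw [norm_smul]
    gcongr
    exact h1 x
  · refine MemLp.of_le_mul (c := c) hu (hu.1.smul
      (continuous_gradient hζ.contDiff_one).aestronglyMeasurable) (Eventually.of_forall fun x => ?_)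
    rw [norm_smul, mul_comm]
    gcongr
    exact h2 x

theorem tendsto_productGradient {ζ u : E n → ℝ} (hζ : IsTestFunction ζ) {m : Measure (E n)}
    [IsFiniteMeasureOnCompacts m] {g : ℕ → E n → ℝ} (hg : ∀ k, IsTestFunction (g k))
    (hu : MemLp u 2 m) (hdu : MemLp (∇ u) 2 m)
    (h : Tendsto (fun k => eLpNorm (g k - u) 2 m) atTop (𝓝 0))
    (h' : Tendsto (fun k => eLpNorm (∇ (g k) - ∇ u) 2 m) atTop (𝓝 0)) :
    Tendsto (fun k => eLpNorm (productGradient ζ (g k) - productGradient ζ u) 2 m)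
      atTop (𝓝 0) := by
  obtain ⟨c, hc, h1, h2⟩ := hζ.exists_bound
  have hle : ∀ k, eLpNorm (productGradient ζ (g k) - productGradient ζ u) 2 m ≤
      ENNReal.ofReal c * eLpNorm (∇ (g k) - ∇ u) 2 m + ENNReal.ofReal c *
        eLpNorm (g k - u) 2 m := by
    intro k
    have e : productGradient ζ (g k) - productGradient ζ u =
        (fun x => ζ x • (∇ (g k) - ∇ u) x) + fun x => (g k - u) x • ∇ ζ x := by
      funext x
      simp only [productGradient, Pi.sub_apply, Pi.add_apply, smul_sub, sub_smul]
      abel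
    have m1 := (((hg k).memLp_gradient m 2).sub hdu).1
    have m2 := (((hg k).memLp m 2).sub hu).1
    rw [e]
    refine (eLpNorm_add_le (hζ.continuous.aestronglyMeasurable.smul m1) (m2.smul
      (continuous_gradient hζ.contDiff_one).aestronglyMeasurable) one_le_two).trans
      (add_le_add ?_ ?_)
    · refine eLpNorm_le_mul_eLpNorm_of_ae_le_mul (Eventually.of_forall fun x => ?_) 2
      rw [Pi.smul_apply', norm_smul]
      gcongr
      exact h1 x
    · refine eLpNorm_le_mul_eLpNorm_of_ae_le_mul (Eventually.of_forall fun x => ?_) 2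
      rw [Pi.smul_apply', norm_smul, mul_comm]
      gcongr
      exact h2 x
  refine tendsto_of_tendsto_of_tendsto_of_le_of_le tendsto_const_nhds ?_ (fun _ => zero_le) hle
  have := (ENNReal.Tendsto.const_mul h' (a := ENNReal.ofReal c) (Or.inr ENNReal.ofReal_ne_top)).add
    (ENNReal.Tendsto.const_mul h (a := ENNReal.ofReal c) (Or.inr ENNReal.ofReal_ne_top))
  simpa using this

theorem productGradient_eq_zero {ζ u : E n → ℝ} {R : ℝ} (hζR : tsupport ζ ⊆ Metric.ball 0 R)
    {x : E n} (hx : x ∉ Metric.ball 0 R) : productGradient ζ u x = 0 := by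
  have h1 : x ∉ tsupport ζ := fun h => hx (hζR h)
  have h2 : ∇ ζ x = 0 := by
    rw [notMem_tsupport_iff_eventuallyEq] at h1
    rw [gradient, h1.fderiv_eq]
    simp
  rw [productGradient, image_eq_zero_of_notMem_tsupport h1, h2, zero_smul, smul_zero, zero_add]

theorem eLpNorm_productGradient {Ω : Set (E n)} {ζ u : E n → ℝ} {R : ℝ}
    (hζR : tsupport ζ ⊆ Metric.ball 0 R) :
    eLpNorm (productGradient ζ u) 2 (volume.restrict (ext Ω)) =
      eLpNorm (productGradient ζ u) 2 (volume.restrict (ext Ω ∩ Metric.ball 0 R)) := by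
  rw [inter_comm, ← Measure.restrict_restrict Metric.isOpen_ball.measurableSet]
  refine (eLpNorm_restrict_eq_of_support_subset fun x hx => ?_).symm
  by_contra h
  exact hx (productGradient_eq_zero hζR h)

/-- Inequalities between a function and its gradient pass to limits of cut off functions. -/
theorem eLpNorm_limit_le_productGradient {Ω : Set (E n)} {ζ u w : E n → ℝ} {R : ℝ}
    (hζ : IsTestFunction ζ) (hζR : tsupport ζ ⊆ Metric.ball 0 R) {g : ℕ → E n → ℝ}
    (hg : ∀ k, IsTestFunction (g k))
    (hu : MemLp u 2 (volume.restrict (ext Ω ∩ Metric.ball 0 R)))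
    (hdu : MemLp (∇ u) 2 (volume.restrict (ext Ω ∩ Metric.ball 0 R)))
    (h : Tendsto (fun k => eLpNorm (g k - u) 2 (volume.restrict (ext Ω ∩ Metric.ball 0 R)))
      atTop (𝓝 0))
    (h' : Tendsto (fun k => eLpNorm (∇ (g k) - ∇ u) 2
      (volume.restrict (ext Ω ∩ Metric.ball 0 R))) atTop (𝓝 0))
    {m : Measure (E n)} [IsFiniteMeasureOnCompacts m] {c : ℝ≥0∞} (hc : c ≠ ⊤)
    (hm : ∀ φ : E n → ℝ, IsTestFunction φ →
      eLpNorm φ 2 m ≤ c * eLpNorm (∇ φ) 2 (volume.restrict (ext Ω)))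
    (hζm : ∀ᵐ x ∂m, ζ x = 1) (hw : MemLp w 2 m)
    (hgw : Tendsto (fun k => eLpNorm (g k - w) 2 m) atTop (𝓝 0)) :
    eLpNorm w 2 m ≤
      c * eLpNorm (productGradient ζ u) 2 (volume.restrict (ext Ω ∩ Metric.ball 0 R)) := by
  set ν := volume.restrict (ext Ω ∩ Metric.ball 0 R)
  have hH := memLp_productGradient hζ hu hdu
  have hle : ∀ k, eLpNorm w 2 m ≤ eLpNorm (g k - w) 2 m +
      c * (eLpNorm (productGradient ζ (g k) - productGradient ζ u) 2 ν +
        eLpNorm (productGradient ζ u) 2 ν) := by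
    intro k
    have hgk := ((hg k).memLp m 2).1
    have hHk := memLp_productGradient hζ ((hg k).memLp ν 2) ((hg k).memLp_gradient ν 2)
    calc eLpNorm w 2 m = eLpNorm (g k - (g k - w)) 2 m := by rw [sub_sub_cancel]
      _ ≤ eLpNorm (g k) 2 m + eLpNorm (g k - w) 2 m := eLpNorm_sub_le hgk (hgk.sub hw.1) one_le_two
      _ = eLpNorm (g k - w) 2 m + eLpNorm (fun x => ζ x * g k x) 2 m := by
        rw [add_comm]
        congr 1
        refine eLpNorm_congr_ae (hζm.mono fun x hx => ?_)
        simp only [hx, one_mul]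
      _ ≤ eLpNorm (g k - w) 2 m + c * eLpNorm (productGradient ζ (g k)) 2 ν := by
        gcongr
        refine (hm _ (hζ.mul (hg k))).trans_eq ?_
        rw [gradient_mul hζ.differentiable (hg k).differentiable, eLpNorm_productGradient hζR]
      _ ≤ _ := by
        gcongr
        calc _ = eLpNorm (productGradient ζ (g k) - productGradient ζ u +
              productGradient ζ u) 2 ν := by rw [sub_add_cancel]
          _ ≤ _ := eLpNorm_add_le (hHk.sub hH).1 hH.1 one_le_two
  have hlim := hgw.add (ENNReal.Tendsto.const_mul ((tendsto_productGradient hζ hg hu hdu h h').add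
    (tendsto_const_nhds (x := eLpNorm (productGradient ζ u) 2 ν))) (a := c) (Or.inr hc))
  refine (ge_of_tendsto' hlim hle).trans_eq ?_
  rw [zero_add, zero_add]

/-- The cross term `2 ζ u ⟨∇ζ, ∇u⟩` is the same on both sides. The identity lets the eigenvalue
equation be tested with `ζ² u`, with an error only where `ζ` varies. -/
theorem productGradient_sq {ζ u : E n → ℝ} (hζ : Differentiable ℝ ζ) (x : E n) :
    inner ℝ (productGradient ζ u x) (productGradient ζ u x) =
      inner ℝ (productGradient (fun x => ζ x * ζ x) u x) (∇ u x) +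
        u x ^ 2 * ‖∇ ζ x‖ ^ 2 := by
  have h : ∇ (fun x => ζ x * ζ x) x = (2 * ζ x) • ∇ ζ x := by
    rw [gradient_mul hζ hζ, productGradient, ← add_smul, two_mul]
  rw [productGradient, productGradient, h, ← real_inner_self_eq_norm_sq]
  simp only [inner_add_left, inner_add_right, inner_smul_left, inner_smul_right,
    real_inner_comm (∇ ζ x) (∇ u x)]
  simp
  ring

/-- The energy identity for cut off eigenfunctions. -/
theorem integral_productGradient_sq {Ω : Set (E n)} {ζ u f : E n → ℝ} {R σ : ℝ}
    (hζ : IsTestFunction ζ) (hζR : tsupport ζ ⊆ Metric.ball 0 R) {g : ℕ → E n → ℝ}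
    (hg : ∀ k, IsTestFunction (g k))
    (hu : MemLp u 2 (volume.restrict (ext Ω ∩ Metric.ball 0 R)))
    (hdu : MemLp (∇ u) 2 (volume.restrict (ext Ω ∩ Metric.ball 0 R)))
    (h : Tendsto (fun k => eLpNorm (g k - u) 2 (volume.restrict (ext Ω ∩ Metric.ball 0 R)))
      atTop (𝓝 0))
    (h' : Tendsto (fun k => eLpNorm (∇ (g k) - ∇ u) 2
      (volume.restrict (ext Ω ∩ Metric.ball 0 R))) atTop (𝓝 0))
    [IsFiniteMeasureOnCompacts (surfaceMeasure Ω)]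
    (hζS : ∀ᵐ x ∂(surfaceMeasure Ω), ζ x = 1) (hf : MemLp f 2 (surfaceMeasure Ω))
    (hgf : Tendsto (fun k => eLpNorm (g k - f) 2 (surfaceMeasure Ω)) atTop (𝓝 0))
    (hst : ∀ φ : E n → ℝ, IsTestFunction φ →
      ∫ x in ext Ω, inner ℝ (∇ u x) (∇ φ x) = σ * ∫ x, f x * φ x ∂(surfaceMeasure Ω)) :
    (eLpNorm (productGradient ζ u) 2 (volume.restrict (ext Ω ∩ Metric.ball 0 R))).toReal ^ 2 =
      σ * (eLpNorm f 2 (surfaceMeasure Ω)).toReal ^ 2 +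
        ∫ x in ext Ω ∩ Metric.ball 0 R, u x ^ 2 * ‖∇ ζ x‖ ^ 2 := by
  set ν := volume.restrict (ext Ω ∩ Metric.ball 0 R) with hν
  have hψ := hζ.mul hζ
  have hψR : tsupport (fun x => ζ x * ζ x) ⊆ Metric.ball 0 R :=
    (closure_mono fun x hx => left_ne_zero_of_mul hx).trans hζR
  have hHψ := memLp_productGradient hψ hu hdu
  have h1 := tendsto_integral_inner (fun k => memLp_productGradient hψ ((hg k).memLp ν 2)
    ((hg k).memLp_gradient ν 2)) hHψ hdu (tendsto_productGradient hψ hg hu hdu h h')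
  have h2 := ((tendsto_integral_mul (fun k => (hg k).memLp _ 2) hf hf hgf).const_mul σ)
  -- `ζ² u` need not be a test function, so the equation is applied to `ζ² g k` and the limit is
  -- taken on both sides.
  have h3 : ∀ k, ∫ x, inner ℝ (productGradient (fun x => ζ x * ζ x) (g k) x) (∇ u x) ∂ν =
      σ * ∫ x, g k x * f x ∂(surfaceMeasure Ω) := by
    intro k
    have h4 := hst _ (hψ.mul (hg k))
    have e1 : ∫ x, f x * (ζ x * ζ x * g k x) ∂(surfaceMeasure Ω) =
        ∫ x, g k x * f x ∂(surfaceMeasure Ω) := by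
      refine integral_congr_ae (hζS.mono fun x hx => ?_)
      simp only [hx]
      ring
    rw [e1, gradient_mul hψ.differentiable (hg k).differentiable] at h4
    rw [← h4, hν, inter_comm, ← Measure.restrict_restrict Metric.isOpen_ball.measurableSet]
    rw [setIntegral_eq_integral_of_forall_compl_eq_zero fun x hx => by
      rw [productGradient_eq_zero hψR hx, inner_zero_left]]
    simp only [real_inner_comm]
  simp only [h3] at h1
  have h5 := tendsto_nhds_unique h1 h2
  have h6 : ∫ x, f x * f x ∂(surfaceMeasure Ω) =
      (eLpNorm f 2 (surfaceMeasure Ω)).toReal ^ 2 := by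
    rw [← integral_inner_self_eq hf]
    simp [← sq]
  rw [h6] at h5
  rw [← h5, ← integral_inner_self_eq (memLp_productGradient hζ hu hdu), ← integral_add]
  · exact integral_congr_ae (Eventually.of_forall fun x => productGradient_sq hζ.differentiable x)
  · refine (L2.integrable_inner (𝕜 := ℝ) (hHψ.toLp _) (hdu.toLp _)).congr ?_
    filter_upwards [hHψ.coeFn_toLp, hdu.coeFn_toLp] with x hx hx'
    rw [hx, hx']
  · obtain ⟨c, -, -, hc⟩ := hζ.exists_bound
    refine Integrable.mul_bdd (c := c ^ 2) hu.integrable_sq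
      ((continuous_gradient hζ.contDiff_one).norm.pow 2).aestronglyMeasurable
      (Eventually.of_forall fun x => ?_)
    rw [norm_pow, norm_norm]
    gcongr
    exact hc x

theorem exists_abs_le_of_isBigO_zpow (hn : 2 ≤ n) {Ω : Set (E n)} {u : E n → ℝ}
    (h : u =O[Bornology.cobounded (E n) ⊓ 𝓟 (ext Ω)] fun x => ‖x‖ ^ (2 - (n : ℤ))) :
    ∃ C ρ : ℝ, 0 ≤ C ∧ ∀ x ∈ ext Ω, ρ ≤ ‖x‖ → |u x| ≤ C * ‖x‖⁻¹ ^ (n - 2) := by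
  obtain ⟨C, hC, hb⟩ := h.exists_nonneg
  have hb := hb.bound
  rw [eventually_inf_principal, ← comap_norm_atTop, eventually_comap] at hb
  obtain ⟨ρ, hρ⟩ := eventually_atTop.mp hb
  refine ⟨C, ρ, hC, fun x hx hxρ => ?_⟩
  have e : ‖x‖ ^ (2 - (n : ℤ)) = ‖x‖⁻¹ ^ (n - 2) := by
    rw [inv_pow, ← zpow_natCast, ← zpow_neg, Nat.cast_sub hn]
    congr 1
    push_cast
    ring
  have := hρ ‖x‖ hxρ x rfl hx
  rwa [Real.norm_eq_abs, e, Real.norm_of_nonneg (by positivity)] at this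

/-- On the annulus `u²` is `O(R^(4-2n))` and the squared gradient `O(R^(-2))`, against volume
`O(R^n)`. The result `O(R^(2-n))` vanishes for `n ≥ 3`. -/
theorem tendsto_integral_sq_mul_gradient_cutoff (hn : 3 ≤ n) {Ω : Set (E n)} {u : E n → ℝ}
    {η : ℝ → E n → ℝ} {B : ℝ} (hη : IsCutoffFamily η B)
    (h : u =O[Bornology.cobounded (E n) ⊓ 𝓟 (ext Ω)] fun x => ‖x‖ ^ (2 - (n : ℤ))) :
    Tendsto (fun R => ∫ x in ext Ω ∩ Metric.ball 0 (3 * R), u x ^ 2 * ‖∇ (η R) x‖ ^ 2)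
      atTop (𝓝 0) := by
  obtain ⟨C, ρ, hC, hCu⟩ := exists_abs_le_of_isBigO_zpow (by omega) h
  have hB := hη.nonneg_const
  set M := C ^ 2 * (n * B ^ 2) * ((ballVol n).toReal * 3 ^ n)
  have hle : ∀ᶠ R in atTop,
      ‖∫ x in ext Ω ∩ Metric.ball 0 (3 * R), u x ^ 2 * ‖∇ (η R) x‖ ^ 2‖ ≤ M * R⁻¹ := by
    filter_upwards [eventually_ge_atTop (max 1 ρ)] with R hR
    have hR1 : 1 ≤ R := (le_max_left _ _).trans hR
    have hRρ : ρ ≤ R := (le_max_right _ _).trans hR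
    have hR0 : 0 < R := by linarith
    have hfin : volume (ext Ω ∩ Metric.ball 0 (3 * R)) < ⊤ :=
      (measure_mono inter_subset_right).trans_lt measure_ball_lt_top
    have hpt : ∀ x ∈ ext Ω ∩ Metric.ball 0 (3 * R), ‖u x ^ 2 * ‖∇ (η R) x‖ ^ 2‖ ≤
        (C * R⁻¹ ^ (n - 2)) ^ 2 * (n * (B * R⁻¹) ^ 2) := by
      intro x hx
      have hg : ‖∇ (η R) x‖ ^ 2 = ∑ i, pd i (η R) x ^ 2 := by
        rw [EuclideanSpace.real_norm_sq_eq]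
        simp only [gradient_apply]
      rw [hg]
      by_cases hxR : ‖x‖ < R ∨ 2 * R < ‖x‖
      · simp only [hη.pd_eq_zero hR0 hxR]
        simp
        positivity
      · push Not at hxR
        rw [norm_mul, norm_pow, Real.norm_eq_abs, Real.norm_of_nonneg (by positivity)]
        gcongr
        · refine (hCu x hx.1 (hRρ.trans hxR.1)).trans ?_
          gcongr
          exact hxR.1
        · refine (Finset.sum_le_card_nsmul _ _ ((B * R⁻¹) ^ 2) fun i _ => ?_).trans_eq (by simp)
          rw [← sq_abs]
          gcongr
          exact hη.abs_pd_le R hR0 i x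
    refine (norm_setIntegral_le_of_norm_le_const hfin hpt).trans ?_
    have hv : volume.real (ext Ω ∩ Metric.ball 0 (3 * R)) ≤ (ballVol n).toReal * (3 * R) ^ n := by
      refine (measureReal_mono inter_subset_right measure_ball_lt_top.ne).trans_eq ?_
      rw [measureReal_def, volume_ball_eq 0 (by positivity), ENNReal.toReal_mul,
        ENNReal.toReal_ofReal (by positivity)]
    calc _ ≤ (C * R⁻¹ ^ (n - 2)) ^ 2 * (n * (B * R⁻¹) ^ 2) *
          ((ballVol n).toReal * (3 * R) ^ n) := by gcongr
      _ = M * R⁻¹ ^ (n - 2) := by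
        obtain ⟨p, rfl⟩ : ∃ p, n = p + 2 := ⟨n - 2, by omega⟩
        rw [show p + 2 - 2 = p by omega]
        have e : R⁻¹ ^ p * R⁻¹ ^ 2 * R ^ (p + 2) = 1 := by
          rw [← pow_add, ← mul_pow, inv_mul_cancel₀ hR0.ne', one_pow]
        calc _ = M * R⁻¹ ^ p * (R⁻¹ ^ p * R⁻¹ ^ 2 * R ^ (p + 2)) := by
              simp only [M]
              rw [mul_pow 3 R]
              ring
          _ = _ := by rw [e, mul_one]
      _ ≤ M * R⁻¹ := by
        gcongr
        exact pow_le_of_le_one (by positivity) (inv_le_one_of_one_le₀ hR1) (by omega)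
  refine squeeze_zero_norm' hle ?_
  simpa using tendsto_inv_atTop_zero.const_mul M

/-- Every eigenvalue is bounded below by the reciprocal squared trace constant. -/
theorem inv_sq_le_of_isEigenfunction (hn : 3 ≤ n) {Ω : Set (E n)} (ho : IsOpen Ω)
    (hc : Convex ℝ Ω) (hne : Ω.Nonempty) (hb : Bornology.IsBounded Ω) {τ : ℝ} (hτ : 0 < τ)
    (htr : ∀ φ : E n → ℝ, IsTestFunction φ → eLpNorm φ 2 (surfaceMeasure Ω) ≤
      ENNReal.ofReal τ * eLpNorm (∇ φ) 2 (volume.restrict (ext Ω)))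
    {σ : ℝ} {u : E n → ℝ} (hu : IsEigenfunction Ω σ u) : (τ ^ 2)⁻¹ ≤ σ := by
  have : IsFiniteMeasure (surfaceMeasure Ω) :=
    isFiniteMeasure_surfaceMeasure (by omega) ho hc hne hb
  have hmeas := (isOpen_ext Ω).measurableSet
  obtain ⟨f, ⟨hf, g, hg, hloc, hgf⟩, hst⟩ := hu.steklov
  obtain ⟨η, B, hη⟩ := exists_isCutoffFamily n
  obtain ⟨r, hr⟩ := hb.closure.subset_ball (0 : E n)
  have hts : ∀ R, 0 < R → tsupport (η R) ⊆ Metric.ball 0 (3 * R) := by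
    intro R hR
    refine (closure_minimal (fun x hx => ?_) Metric.isClosed_closedBall).trans
      (Metric.closedBall_subset_ball (by linarith : 2 * R < 3 * R))
    by_contra h
    rw [mem_closedBall_zero_iff, not_le] at h
    exact hx (hη.eq_zero R hR x h.le)
  set A := (eLpNorm f 2 (surfaceMeasure Ω)).toReal with hA
  set H : ℝ → ℝ := fun R => (eLpNorm (productGradient (η R) u) 2
    (volume.restrict (ext Ω ∩ Metric.ball 0 (3 * R)))).toReal with hH
  set D : ℝ → ℝ := fun R => ∫ x in ext Ω ∩ Metric.ball 0 (3 * R), u x ^ 2 * ‖∇ (η R) x‖ ^ 2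
  have hD : Tendsto D atTop (𝓝 0) := tendsto_integral_sq_mul_gradient_cutoff hn hη hu.decay
  have hone : ∀ R, max 1 r ≤ R → ∀ᵐ x ∂(surfaceMeasure Ω), η R x = 1 := by
    intro R hR
    filter_upwards [ae_mem_frontier Ω] with x hx
    have h1 := hr (frontier_subset_closure hx)
    rw [mem_ball_zero_iff] at h1
    exact hη.eq_one R (one_pos.trans_le ((le_max_left _ _).trans hR)) x
      (h1.le.trans ((le_max_right _ _).trans hR))
  have hHtop : ∀ R, 0 < R → eLpNorm (productGradient (η R) u) 2
      (volume.restrict (ext Ω ∩ Metric.ball 0 (3 * R))) ≠ ⊤ := fun R hR =>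
    (memLp_productGradient (hη.isTestFunction R hR) (hu.memH1loc _).1
      (hu.memH1loc _).2).eLpNorm_ne_top
  have hAH : ∀ R, max 1 r ≤ R → A ≤ τ * H R := by
    intro R hR
    have hR0 : 0 < R := one_pos.trans_le ((le_max_left _ _).trans hR)
    have h1 := eLpNorm_limit_le_productGradient (hη.isTestFunction R hR0) (hts R hR0) hg
      (hu.memH1loc _).1 (hu.memH1loc _).2 (hloc _).1 (hloc _).2 ENNReal.ofReal_ne_top htr
      (hone R hR) hf hgf
    have h2 := ENNReal.toReal_mono (ENNReal.mul_ne_top ENNReal.ofReal_ne_top (hHtop R hR0)) h1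
    rwa [ENNReal.toReal_mul, ENNReal.toReal_ofReal hτ.le] at h2
  have hHD : ∀ R, max 1 r ≤ R → H R ^ 2 = σ * A ^ 2 + D R := by
    intro R hR
    have hR0 : 0 < R := one_pos.trans_le ((le_max_left _ _).trans hR)
    exact integral_productGradient_sq (hη.isTestFunction R hR0) (hts R hR0) hg
      (hu.memH1loc _).1 (hu.memH1loc _).2 (hloc _).1 (hloc _).2 (hone R hR) hf hgf hst
  have hA0 : 0 ≤ A := ENNReal.toReal_nonneg
  -- The trace inequality for the cut-off eigenfunction, combined with the energy identity, in the
  -- limit `R → ∞`.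
  have hlim : A ^ 2 ≤ τ ^ 2 * (σ * A ^ 2 + 0) := by
    refine ge_of_tendsto ((hD.const_add (σ * A ^ 2)).const_mul (τ ^ 2)) ?_
    filter_upwards [eventually_ge_atTop (max 1 r)] with R hR
    rw [← hHD R hR, ← mul_pow]
    exact pow_le_pow_left₀ hA0 (hAH R hR) 2
  -- If the trace vanishes, the limit inequality says nothing about `σ`. Then the energies tend to
  -- zero, and the Poincaré inequality on a fixed ball around a point where `u` is nonzero gives a
  -- contradiction.
  rcases hA0.eq_or_lt with h0 | hpos
  · exfalso
    have hH0 : Tendsto H atTop (𝓝 0) := by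
      have h1 : Tendsto (fun R => H R ^ 2) atTop (𝓝 0) := by
        refine hD.congr' ?_
        filter_upwards [eventually_ge_atTop (max 1 r)] with R hR
        rw [hHD R hR, ← h0]
        ring
      have h2 := (Real.continuous_sqrt.tendsto 0).comp h1
      rw [Real.sqrt_zero] at h2
      exact h2.congr fun R => Real.sqrt_sq ENNReal.toReal_nonneg
    obtain ⟨K, hK, hKle⟩ := exists_eLpNorm_ball_le hn ho hc hne
    obtain ⟨x₀, hx₀, hux₀⟩ := hu.ne_zero
    set R₁ := ‖x₀‖ + 1
    have hR₁ : 0 < R₁ := by positivity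
    have hKR : K * ENNReal.ofReal R₁ ≠ ⊤ := ENNReal.mul_ne_top hK ENNReal.ofReal_ne_top
    have hle : ∀ R, max 1 R₁ ≤ R → (eLpNorm u 2
        (volume.restrict (ext Ω ∩ Metric.ball 0 R₁))).toReal ≤
          (K * ENNReal.ofReal R₁).toReal * H R := by
      intro R hR
      have hR0 : 0 < R := one_pos.trans_le ((le_max_left _ _).trans hR)
      have h1 := eLpNorm_limit_le_productGradient (hη.isTestFunction R hR0) (hts R hR0) hg
        (hu.memH1loc _).1 (hu.memH1loc _).2 (hloc _).1 (hloc _).2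
        (m := volume.restrict (ext Ω ∩ Metric.ball 0 R₁)) hKR (fun φ hφ => hKle φ hφ R₁ hR₁) (by
          filter_upwards [ae_restrict_mem (hmeas.inter Metric.isOpen_ball.measurableSet)]
            with x hx
          have := mem_ball_zero_iff.mp hx.2
          exact hη.eq_one R hR0 x (this.le.trans ((le_max_right _ _).trans hR)))
        (hu.memH1loc _).1 (hloc _).1
      have h2 := ENNReal.toReal_mono (ENNReal.mul_ne_top hKR (hHtop R hR0)) h1
      rwa [ENNReal.toReal_mul] at h2
    have hz : (eLpNorm u 2 (volume.restrict (ext Ω ∩ Metric.ball 0 R₁))).toReal ≤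
        (K * ENNReal.ofReal R₁).toReal * 0 :=
      ge_of_tendsto (hH0.const_mul _)
        ((eventually_ge_atTop (max 1 R₁)).mono fun R hR => hle R hR)
    rw [mul_zero] at hz
    have hz' : eLpNorm u 2 (volume.restrict (ext Ω ∩ Metric.ball 0 R₁)) = 0 :=
      ((ENNReal.toReal_eq_zero_iff _).mp (le_antisymm hz ENNReal.toReal_nonneg)).resolve_right
        (hu.memH1loc _).1.eLpNorm_ne_top
    rw [eLpNorm_eq_zero_iff (hu.memH1loc _).1.1 two_ne_zero] at hz'
    have hopen : IsOpen (ext Ω ∩ Metric.ball (0 : E n) R₁) :=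
      (isOpen_ext Ω).inter Metric.isOpen_ball
    have hcont : ContinuousOn u (ext Ω ∩ Metric.ball 0 R₁) :=
      hu.harmonic.continuousOn.mono inter_subset_left
    have heq := Measure.eqOn_open_of_ae_eq (g := fun _ => (0 : ℝ)) hz' hopen hcont
      continuousOn_const
    exact hux₀ (heq ⟨hx₀, by rw [mem_ball_zero_iff]; exact lt_add_one _⟩)
  · have h1 : 0 < A ^ 2 := by positivity
    rw [inv_le_iff_one_le_mul₀' (by positivity)]
    nlinarith

/-! ### The least eigenvalue and thin convex bodies. -/

/-- The spectrum has a least element, controlled by the potential of the surface measure. -/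
theorem exists_isLeast_spectrum (hn : 3 ≤ n) {Ω : Set (E n)} (ho : IsOpen Ω)
    (hc : Convex ℝ Ω) {a b : ℝ} (hb : 0 < b) (ha : 0 < a) (hball : Metric.ball 0 b ⊆ Ω)
    (hbd : Ω ⊆ Metric.closedBall 0 a) {M : ℝ≥0∞} (hMtop : M ≠ ⊤)
    (hM : ∀ x, ∫⁻ y, powKer (n - 2) (y - x) ∂(surfaceMeasure Ω) ≤ M) :
    ∃ τ : ℝ, 0 < τ ∧ ENNReal.ofReal (τ ^ 2) ≤ potConst n ^ 2 * compConst n * M ∧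
      IsLeast (spectrum Ω) (τ ^ 2)⁻¹ := by
  have hbdd : Bornology.IsBounded Ω := Metric.isBounded_closedBall.subset hbd
  have hne : Ω.Nonempty := ⟨0, hball (by simpa using hb)⟩
  obtain ⟨τ, hτ, hτM, htr, g, G, f, hg, hG, hf, hgG, hgf, hG0, hfG⟩ :=
    exists_extremal hn ho hc hb ha hball hbd hMtop hM
  refine ⟨τ, hτ, hτM, ?_, ?_⟩
  · exact exists_isEigenfunction hn ho hc hne hbdd hτ hg hG hf hgG hgf hG0 hfG
  · rintro σ ⟨u, hu⟩
    exact inv_sq_le_of_isEigenfunction hn ho hc hne hbdd hτ htr hu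

/-- Up to scale `b` the general area growth is used. At each later scale `ρ = 2^j b` the area is
`O(b^(n-2) ρ)` and the kernel at most `ρ^(2-n)`, so the shell contributes `O(b)`. The total is
linear in `j`, that is, logarithmic in the length. -/
theorem lintegral_powKer_tube_closedBall_le (hn : 3 ≤ n) {Ω : Set (E n)} (ho : IsOpen Ω)
    (hc : Convex ℝ Ω) (hne : Ω.Nonempty) {i₀ : Fin n} {b : ℝ} (hb : 0 < b)
    (htube : ∀ y ∈ Ω, ∀ i ≠ i₀, |y i| ≤ b) (x : E n) (j : ℕ) :
    ∫⁻ y in Metric.closedBall x (2 ^ j * b), powKer (n - 2) (y - x) ∂(surfaceMeasure Ω) ≤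
      areaConst n * ENNReal.ofReal (2 ^ (n - 1) * b + 2 * j * b) := by
  have e : n - 2 + 1 = n - 1 := by omega
  induction j with
  | zero =>
    have := lintegral_powKer_closedBall_le (m := surfaceMeasure Ω) (p := n - 2) areaConst_ne_top hb
      (x := x) fun r hr _ => by
        rw [e]
        exact surfaceMeasure_closedBall_le (by omega) ho hc hne x hr.le
    rw [e] at this
    simpa using this
  | succ j ih =>
    have hj : 0 < 2 ^ j * b := by positivity
    have hsub : Metric.closedBall x (2 ^ j * b) ⊆ Metric.closedBall x (2 ^ (j + 1) * b) :=
      Metric.closedBall_subset_closedBall (by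
        rw [pow_succ]
        linarith)
    have h1 := setLIntegral_powKer_compl_closedBall_le (n - 2) (surfaceMeasure Ω) x hj
      (s := Metric.closedBall x (2 ^ (j + 1) * b) \ Metric.closedBall x (2 ^ j * b)) subset_rfl
    have h2 := surfaceMeasure_closedBall_le_of_tube (by omega) ho hc hne hb.le htube x
      (r := 2 ^ (j + 1) * b) (le_mul_of_one_le_left hb.le (one_le_pow₀ one_le_two))
    rw [← union_sdiff_cancel hsub]
    refine (lintegral_union_le _ _ _).trans ((add_le_add ih
      (h1.trans (mul_le_mul_right h2 _))).trans ?_)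
    rw [mul_left_comm, ← ENNReal.ofReal_mul (by positivity), ← mul_add,
      ← ENNReal.ofReal_add (by positivity) (by positivity)]
    refine mul_le_mul_right (ENNReal.ofReal_le_ofReal ?_) _
    have h3 : (2 ^ j * b)⁻¹ ^ (n - 2) * (b ^ (n - 2) * (2 ^ (j + 1) * b)) =
        ((2 : ℝ) ^ j)⁻¹ ^ (n - 2) * 2 ^ j * (2 * b) := by
      have : b⁻¹ ^ (n - 2) * b ^ (n - 2) = 1 := by
        rw [← mul_pow, inv_mul_cancel₀ hb.ne', one_pow]
      rw [mul_inv, mul_pow]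
      linear_combination ((2 : ℝ) ^ j)⁻¹ ^ (n - 2) * (2 ^ (j + 1) * b) * this
    -- This is where `n ≥ 3` enters; for `n = 3` it is an equality and all scales contribute alike.
    have h4 : ((2 : ℝ) ^ j)⁻¹ ^ (n - 2) * 2 ^ j ≤ 1 := by
      have h5 : ((2 : ℝ) ^ j)⁻¹ ^ (n - 2) ≤ ((2 : ℝ) ^ j)⁻¹ :=
        pow_le_of_le_one (by positivity) (inv_le_one_of_one_le₀ (one_le_pow₀ one_le_two))
          (by omega)
      calc _ ≤ ((2 : ℝ) ^ j)⁻¹ * 2 ^ j := by gcongr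
        _ = 1 := inv_mul_cancel₀ (by positivity)
    rw [h3]
    push_cast
    nlinarith

/-- The potential of the surface measure of a long thin convex body is small. -/
theorem lintegral_powKer_tube_le (hn : 3 ≤ n) {Ω : Set (E n)} (ho : IsOpen Ω)
    (hc : Convex ℝ Ω) (hne : Ω.Nonempty) {i₀ : Fin n} {b : ℝ} (hb : 0 < b)
    (htube : ∀ y ∈ Ω, ∀ i ≠ i₀, |y i| ≤ b) {j : ℕ} (hbd : Ω ⊆ Metric.closedBall 0 (2 ^ j * b))
    (x : E n) :
    ∫⁻ y, powKer (n - 2) (y - x) ∂(surfaceMeasure Ω) ≤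
      areaConst n * ENNReal.ofReal (b * (2 ^ (n - 1) + 1 + 2 * j)) := by
  have hj : 0 < 2 ^ j * b := by positivity
  rw [← lintegral_add_compl _
    (Metric.isClosed_closedBall (x := x) (ε := 2 ^ j * b)).measurableSet]
  have h1 := setLIntegral_powKer_compl_closedBall_le (n - 2) (surfaceMeasure Ω) x hj
    (s := (Metric.closedBall x (2 ^ j * b))ᶜ) (t := univ) (by rw [compl_eq_univ_sdiff])
  -- Beyond the length of the body the total area counts as one more shell, wherever `x` lies.
  have h2 : surfaceMeasure Ω univ ≤ areaConst n * ENNReal.ofReal (b ^ (n - 2) * (2 ^ j * b)) := by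
    refine le_trans (le_of_eq ?_) (surfaceMeasure_closedBall_le_of_tube (by omega) ho hc hne hb.le
      htube 0 (le_mul_of_one_le_left hb.le (one_le_pow₀ one_le_two)))
    refine measure_congr ?_
    filter_upwards [ae_mem_frontier Ω] with y hy
    have : y ∈ Metric.closedBall 0 (2 ^ j * b) :=
      closure_minimal hbd Metric.isClosed_closedBall (frontier_subset_closure hy)
    exact propext ⟨fun _ => this, fun _ => trivial⟩
  refine (add_le_add (lintegral_powKer_tube_closedBall_le hn ho hc hne hb htube x j)
    (h1.trans (mul_le_mul_right h2 _))).trans ?_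
  rw [mul_left_comm, ← ENNReal.ofReal_mul (by positivity), ← mul_add,
    ← ENNReal.ofReal_add (by positivity) (by positivity)]
  refine mul_le_mul_right (ENNReal.ofReal_le_ofReal ?_) _
  have h3 : (2 ^ j * b)⁻¹ ^ (n - 2) * (b ^ (n - 2) * (2 ^ j * b)) =
      ((2 : ℝ) ^ j)⁻¹ ^ (n - 2) * 2 ^ j * b := by
    have : b⁻¹ ^ (n - 2) * b ^ (n - 2) = 1 := by
      rw [← mul_pow, inv_mul_cancel₀ hb.ne', one_pow]
    rw [mul_inv, mul_pow]
    linear_combination ((2 : ℝ) ^ j)⁻¹ ^ (n - 2) * (2 ^ j * b) * this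
  have h4 : ((2 : ℝ) ^ j)⁻¹ ^ (n - 2) * 2 ^ j ≤ 1 := by
    have h5 : ((2 : ℝ) ^ j)⁻¹ ^ (n - 2) ≤ ((2 : ℝ) ^ j)⁻¹ :=
      pow_le_of_le_one (by positivity) (inv_le_one_of_one_le₀ (one_le_pow₀ one_le_two))
        (by omega)
    calc _ ≤ ((2 : ℝ) ^ j)⁻¹ * 2 ^ j := by gcongr
      _ = 1 := inv_mul_cancel₀ (by positivity)
  rw [h3]
  nlinarith

/-! ### Elongated ellipsoids. -/

/-- The ellipsoid with semi-axes `s i`. -/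
def ellipsoid (s : Fin n → ℝ) : Set (E n) := {x | ∑ i, (x i / s i) ^ 2 - 1 < 0}

variable {s : Fin n → ℝ}

theorem contDiff_ellipsoid (s : Fin n → ℝ) :
    ContDiff ℝ ∞ fun x : E n => ∑ i, (x i / s i) ^ 2 - 1 := by
  fun_prop

theorem isOpen_ellipsoid (s : Fin n → ℝ) : IsOpen (ellipsoid s) :=
  isOpen_lt (contDiff_ellipsoid s).continuous continuous_const

/-- The linear map which sends an ellipsoid to the unit ball. -/
noncomputable def ellipsoidMap (s : Fin n → ℝ) : E n →ₗ[ℝ] E n :=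
  Matrix.toLin (EuclideanSpace.basisFun (Fin n) ℝ).toBasis
    (EuclideanSpace.basisFun (Fin n) ℝ).toBasis (Matrix.diagonal fun i => (s i)⁻¹)

theorem ellipsoidMap_apply (s : Fin n → ℝ) (x : E n) (i : Fin n) :
    ellipsoidMap s x i = x i / s i := by
  rw [ellipsoidMap, Matrix.toLin_apply]
  simp [Matrix.mulVec_diagonal, div_eq_inv_mul, Pi.single_apply]

theorem ellipsoid_eq_preimage (s : Fin n → ℝ) :
    ellipsoid s = ellipsoidMap s ⁻¹' Metric.ball 0 1 := by
  ext x
  rw [mem_preimage, mem_ball_zero_iff, ← sq_lt_one_iff₀ (norm_nonneg _),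
    EuclideanSpace.real_norm_sq_eq]
  simp only [ellipsoidMap_apply]
  exact sub_neg (α := ℝ)

theorem convex_ellipsoid (s : Fin n → ℝ) : Convex ℝ (ellipsoid s) := by
  rw [ellipsoid_eq_preimage]
  exact (convex_ball _ _).linear_preimage _

theorem volume_ellipsoid (hs : ∀ i, 0 < s i) :
    volume (ellipsoid s) = ENNReal.ofReal (∏ i, s i) * ballVol n := by
  have hdet : LinearMap.det (ellipsoidMap s) = (∏ i, s i)⁻¹ := by
    rw [ellipsoidMap, LinearMap.det_toLin, Matrix.det_diagonal, Finset.prod_inv_distrib]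
  have hp : 0 < ∏ i, s i := Finset.prod_pos fun i _ => hs i
  rw [ellipsoid_eq_preimage, Measure.addHaar_preimage_linearMap _ (by
    rw [hdet]
    positivity), hdet, inv_inv, abs_of_pos hp, volume_ball_eq 0 one_pos]
  simp

theorem ellipsoid_subset_closedBall {a : ℝ} (ha : 0 < a) (hs : ∀ i, 0 < s i) (hsa : ∀ i, s i ≤ a) :
    ellipsoid s ⊆ Metric.closedBall 0 a := by
  intro x hx
  have hx' : ∑ i, (x i / s i) ^ 2 < 1 := sub_neg.mp hx
  rw [mem_closedBall_zero_iff]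
  refine abs_le_of_sq_le_sq' ?_ ha.le |>.2
  rw [EuclideanSpace.real_norm_sq_eq]
  calc ∑ i, x i ^ 2 ≤ ∑ i, a ^ 2 * (x i / s i) ^ 2 := by
        refine Finset.sum_le_sum fun i _ => ?_
        rw [← mul_pow, sq_le_sq, abs_mul, abs_div, abs_of_pos ha, abs_of_pos (hs i),
          ← mul_div_assoc, le_div_iff₀ (hs i), mul_comm]
        exact mul_le_mul_of_nonneg_right (hsa i) (abs_nonneg _)
    _ = a ^ 2 * ∑ i, (x i / s i) ^ 2 := by rw [Finset.mul_sum]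
    _ ≤ a ^ 2 := mul_le_of_le_one_right (by positivity) hx'.le

theorem ball_subset_ellipsoid {b : ℝ} (hb : 0 < b) (hsb : ∀ i, b ≤ s i) :
    Metric.ball 0 b ⊆ ellipsoid s := by
  intro x hx
  rw [mem_ball_zero_iff] at hx
  refine (sub_neg (α := ℝ)).mpr ?_
  calc ∑ i, (x i / s i) ^ 2 ≤ ∑ i, x i ^ 2 / b ^ 2 := by
        refine Finset.sum_le_sum fun i _ => ?_
        rw [div_pow]
        have := hsb i
        gcongr
    _ = ‖x‖ ^ 2 / b ^ 2 := by rw [← Finset.sum_div, EuclideanSpace.real_norm_sq_eq]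
    _ < 1 := by
      rw [div_lt_one (by positivity)]
      gcongr

theorem abs_le_of_mem_ellipsoid (hs : ∀ i, 0 < s i) {x : E n} (hx : x ∈ ellipsoid s) (i : Fin n) :
    |x i| ≤ s i := by
  have hx' : ∑ i, (x i / s i) ^ 2 < 1 := sub_neg.mp hx
  have h1 : (x i / s i) ^ 2 ≤ 1 := (Finset.single_le_sum (f := fun i => (x i / s i) ^ 2)
    (fun _ _ => sq_nonneg _) (Finset.mem_univ i)).trans hx'.le
  rwa [sq_le_one_iff_abs_le_one, abs_div, abs_of_pos (hs i), div_le_one (hs i)] at h1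

/-- Homogeneity gives the nonvanishing differential: at a boundary point the defining function
restricted to `(1 + t) x` is `(1 + t)² - 1`, with derivative `2` at zero. -/
theorem hasSmoothBoundary_ellipsoid (s : Fin n → ℝ) : HasSmoothBoundary (ellipsoid s) := by
  intro x hx
  refine ⟨_, contDiff_ellipsoid s, fun h => ?_, Eventually.of_forall fun y => Iff.rfl⟩
  have h0 : ∑ i, (x i / s i) ^ 2 - 1 = 0 :=
    frontier_lt_subset_eq (contDiff_ellipsoid s).continuous continuous_const hx
  have h1 : HasDerivAt (fun t : ℝ => ∑ i, ((x + t • x) i / s i) ^ 2 - 1) 0 0 := by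
    have h2 : HasDerivAt (fun t : ℝ => x + t • x) x 0 := by
      simpa using ((hasDerivAt_id (0 : ℝ)).smul_const x).const_add x
    have h3 : HasFDerivAt (fun x : E n => ∑ i, (x i / s i) ^ 2 - 1) (0 : E n →L[ℝ] ℝ)
        (x + (0 : ℝ) • x) := by
      rw [← h, zero_smul, add_zero]
      exact ((contDiff_ellipsoid s).differentiable (by simp) x).hasFDerivAt
    exact h3.comp_hasDerivAt (0 : ℝ) h2
  have h4 : (fun t : ℝ => ∑ i, ((x + t • x) i / s i) ^ 2 - 1) = fun t => (1 + t) ^ 2 - 1 := by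
    funext t
    have : ∀ i, ((x + t • x) i / s i) ^ 2 = (1 + t) ^ 2 * (x i / s i) ^ 2 := fun i => by
      simp only [PiLp.add_apply, PiLp.smul_apply, smul_eq_mul]
      ring
    simp only [this]
    rw [← Finset.mul_sum, sub_eq_zero.mp h0, mul_one]
  rw [h4] at h1
  have h5 : HasDerivAt (fun t : ℝ => (1 + t) ^ 2 - 1) 2 0 := by
    simpa using (((hasDerivAt_id (0 : ℝ)).const_add 1).pow 2).sub_const 1
  exact two_ne_zero (h5.unique h1)

theorem isSmoothConvexBoundedDomain_ellipsoid {a b : ℝ} (hb : 0 < b) (hsb : ∀ i, b ≤ s i)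
    (ha : 0 < a) (hsa : ∀ i, s i ≤ a) : IsSmoothConvexBoundedDomain (ellipsoid s) where
  isOpen := isOpen_ellipsoid s
  nonempty := ⟨0, ball_subset_ellipsoid hb hsb (by simpa using hb)⟩
  convex := convex_ellipsoid s
  isBounded := Metric.isBounded_closedBall.subset
    (ellipsoid_subset_closedBall ha (fun i => hb.trans_le (hsb i)) hsa)
  hasSmoothBoundary := hasSmoothBoundary_ellipsoid s

/-- Semi-axes of the elongated ellipsoids. -/
noncomputable def longAxes (i₀ : Fin n) (b : ℝ) (m : ℕ) : Fin n → ℝ :=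
  Function.update (fun _ => b) i₀ (2 ^ m * b)

theorem le_longAxes (i₀ : Fin n) {b : ℝ} (hb : 0 < b) (m : ℕ) (i : Fin n) :
    b ≤ longAxes i₀ b m i := by
  rcases eq_or_ne i i₀ with rfl | h
  · rw [longAxes, Function.update_self]
    exact le_mul_of_one_le_left hb.le (one_le_pow₀ one_le_two)
  · rw [longAxes, Function.update_of_ne h]

theorem longAxes_le (i₀ : Fin n) {b : ℝ} (hb : 0 < b) (m : ℕ) (i : Fin n) :
    longAxes i₀ b m i ≤ 2 ^ m * b := by
  rcases eq_or_ne i i₀ with rfl | h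
  · rw [longAxes, Function.update_self]
  · rw [longAxes, Function.update_of_ne h]
    exact le_mul_of_one_le_left hb.le (one_le_pow₀ one_le_two)

theorem prod_longAxes (i₀ : Fin n) (b : ℝ) (m : ℕ) : ∏ i, longAxes i₀ b m i = 2 ^ m * b ^ n := by
  have hn : n - 1 + 1 = n := Nat.sub_add_cancel i₀.pos
  rw [longAxes, Finset.prod_update_of_mem (Finset.mem_univ _), Finset.prod_const,
    ← Finset.compl_eq_univ_sdiff, Finset.card_compl, Finset.card_singleton, Fintype.card_fin,
    mul_assoc, ← pow_succ', hn]

/-- Elongated ellipsoids of fixed volume have large first exterior Steklov eigenvalue. -/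
theorem exists_isLeast_spectrum_longAxes (hn : 3 ≤ n) (i₀ : Fin n) {b : ℝ} (hb : 0 < b) (m : ℕ) :
    ∃ τ : ℝ, 0 < τ ∧
      τ ^ 2 ≤ (potConst n ^ 2 * compConst n * areaConst n).toReal *
        (b * (2 ^ (n - 1) + 1 + 2 * m)) ∧
      IsLeast (spectrum (ellipsoid (longAxes i₀ b m))) (τ ^ 2)⁻¹ := by
  have ha : 0 < 2 ^ m * b := by positivity
  have hpos : ∀ i, 0 < longAxes i₀ b m i := fun i => hb.trans_le (le_longAxes i₀ hb m i)
  have hball := ball_subset_ellipsoid hb (le_longAxes i₀ hb m)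
  have hbd := ellipsoid_subset_closedBall ha hpos (longAxes_le i₀ hb m)
  have hM := lintegral_powKer_tube_le hn (isOpen_ellipsoid _) (convex_ellipsoid _)
    ⟨0, hball (by simpa using hb)⟩ hb (i₀ := i₀) (fun y hy i hi => by
      have := abs_le_of_mem_ellipsoid hpos hy i
      rwa [longAxes, Function.update_of_ne hi] at this) hbd
  obtain ⟨τ, hτ, hle, hleast⟩ := exists_isLeast_spectrum hn (isOpen_ellipsoid _)
    (convex_ellipsoid _) hb ha hball hbd
    (ENNReal.mul_ne_top areaConst_ne_top ENNReal.ofReal_ne_top) hM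
  refine ⟨τ, hτ, ?_, hleast⟩
  rw [← mul_assoc] at hle
  have h := ENNReal.toReal_mono (ENNReal.mul_ne_top (ENNReal.mul_ne_top (ENNReal.mul_ne_top
    (ENNReal.pow_ne_top potConst_ne_top) compConst_ne_top) areaConst_ne_top)
    ENNReal.ofReal_ne_top) hle
  rwa [ENNReal.toReal_mul, ENNReal.toReal_ofReal (by positivity),
    ENNReal.toReal_ofReal (by positivity)] at h

end ExteriorSteklov

/-! ### Normalisation of the volume and the limit. -/

theorem mainTheorem3 (n : ℕ) (hn : 3 ≤ n) (V : ℝ) (hV : 0 < V) :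
    ∃ Ω : ℕ → Set (EuclideanSpace ℝ (Fin n)),
      (∀ m, ExteriorSteklov.IsSmoothConvexBoundedDomain (Ω m)) ∧
      (∀ m, volume (Ω m) = ENNReal.ofReal V) ∧
      (∀ m, IsLeast (ExteriorSteklov.spectrum (Ω m)) (ExteriorSteklov.firstEigenvalue (Ω m))) ∧
      Tendsto (fun m => ExteriorSteklov.firstEigenvalue (Ω m)) atTop atTop := by
  let i₀ : Fin n := ⟨0, by omega⟩
  have hn0 : n ≠ 0 := by omega
  have hv : 0 < (ExteriorSteklov.ballVol n).toReal :=
    ENNReal.toReal_pos ExteriorSteklov.ballVol_ne_zero ExteriorSteklov.ballVol_ne_top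
  -- With short semi-axes `β q^m` and `q^n = 1/2`, the product of the semi-axes `2^m (β q^m)^n` is
  -- `β^n = V / |B|` for every `m`.
  set β : ℝ := (V / (ExteriorSteklov.ballVol n).toReal) ^ (n : ℝ)⁻¹
  set q : ℝ := (1 / 2 : ℝ) ^ (n : ℝ)⁻¹
  have hβ : 0 < β := by positivity
  have hq : 0 < q := by positivity
  have hq1 : q < 1 := Real.rpow_lt_one (by norm_num) (by norm_num) (by positivity)
  have hβn : β ^ n = V / (ExteriorSteklov.ballVol n).toReal :=
    Real.rpow_inv_natCast_pow (by positivity) hn0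
  have hqn : q ^ n = 1 / 2 := Real.rpow_inv_natCast_pow (by norm_num) hn0
  set b : ℕ → ℝ := fun m => β * q ^ m
  have hb : ∀ m, 0 < b m := fun m => by positivity
  choose τ hτ hle hleast using fun m =>
    ExteriorSteklov.exists_isLeast_spectrum_longAxes hn i₀ (hb m) m
  have hfirst : ∀ m, ExteriorSteklov.firstEigenvalue
      (ExteriorSteklov.ellipsoid (ExteriorSteklov.longAxes i₀ (b m) m)) = (τ m ^ 2)⁻¹ :=
    fun m => (hleast m).csInf_eq
  refine ⟨fun m => ExteriorSteklov.ellipsoid (ExteriorSteklov.longAxes i₀ (b m) m), fun m => ?_,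
    fun m => ?_, fun m => ?_, ?_⟩
  · exact ExteriorSteklov.isSmoothConvexBoundedDomain_ellipsoid (hb m)
      (ExteriorSteklov.le_longAxes i₀ (hb m) m) (mul_pos (by positivity) (hb m))
      (ExteriorSteklov.longAxes_le i₀ (hb m) m)
  · have h1 : (2 : ℝ) ^ m * b m ^ n = V / (ExteriorSteklov.ballVol n).toReal := by
      have h2 : (q ^ m) ^ n = (1 / 2) ^ m := by rw [← pow_mul, mul_comm, pow_mul, hqn]
      simp only [b]
      rw [mul_pow, h2, hβn, mul_left_comm, ← mul_pow]
      norm_num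
    rw [ExteriorSteklov.volume_ellipsoid fun i =>
      (hb m).trans_le (ExteriorSteklov.le_longAxes i₀ (hb m) m i),
      ExteriorSteklov.prod_longAxes, h1,
      ← ENNReal.ofReal_toReal (ExteriorSteklov.ballVol_ne_top (n := n)),
      ENNReal.toReal_ofReal hv.le, ← ENNReal.ofReal_mul (by positivity),
      div_mul_cancel₀ _ hv.ne']
  · rw [hfirst]
    exact hleast m
  · simp only [hfirst]
    -- `τ²` is bounded by a constant times `(1 + m) q^m`: the geometric shrinking of the thickness
    -- beats the linear growth in the number of scales.
    refine Tendsto.inv_tendsto_nhdsGT_zero (tendsto_nhdsWithin_iff.mpr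
      ⟨?_, Eventually.of_forall fun m => pow_pos (hτ m) 2⟩)
    refine squeeze_zero (fun m => sq_nonneg (τ m)) hle ?_
    have h1 : Tendsto (fun m : ℕ => q ^ m) atTop (𝓝 0) :=
      tendsto_pow_atTop_nhds_zero_of_lt_one hq.le hq1
    have h2 : Tendsto (fun m : ℕ => (m : ℝ) * q ^ m) atTop (𝓝 0) :=
      tendsto_self_mul_const_pow_of_lt_one hq.le hq1
    have h3 := (((h1.const_mul ((2 : ℝ) ^ (n - 1) + 1)).add (h2.const_mul 2)).const_mul β).const_mul
      (ExteriorSteklov.potConst n ^ 2 * ExteriorSteklov.compConst n *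
        ExteriorSteklov.areaConst n).toReal
    simp only [mul_zero, add_zero] at h3
    refine h3.congr fun m => ?_
    simp only [b]
    ring
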